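/- **Setting.** Let $K\subseteq\mathbb R^d$ be convex with $\|x-y\|_2\le D$ for all $x,y\in K$ and $r\mathcal B_d\subseteq K$, where $r>0$, $D\ge 1$ and $\mathcal B_d$ is the closed Euclidean unit ball. In round $t=1,\dots,T$ the player plays $x_t\in K$, and then an adversary, who may know $x_1,\dots,x_t$, reveals a loss $f_t:\mathbb R^d\to\mathbb R$ that is convex and $G$-Lipschitz ($G\ge1$) on $\mathbb R^d$ and non-negative on $K$, together with a choice of subgradients, written $\nabla f_t$. The player accesses $K$ only through a membership oracle ("is $x\in K$?"), apart from two given starting points $\hat x,\hat y\in K$ and the numbers $d,r,D,G$. Let $\gamma(x)=\inf\{c\ge1: x/c\in K\}$. **Base algorithm** with horizon $H$ and step size $\eta$: start with the pair $(x,y)=(\hat x,\hat y)$; in each round predict $x$; then, given the loss $f$, compute a (randomized) estimate $s$ of a subgradient of $\gamma$ at $y$, put $y\leftarrow y-\eta(\nabla f(y)+3GD\,s)$, compute an approximation $c$ of $\gamma(y)$ at the new $y$, and put $x\leftarrow y/c$. The subroutines, with $\delta=1/H^2$, are required to satisfy, for every $y$: always $c\ge1$, $|c-\gamma(y)|\le\delta$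 and $y/c\in K$; and $\gamma(u)\ge\gamma(y)+\langle\mathbb E[s],u-y\rangle-\delta(1+\|u-y\|_2)$ for all $u\in\mathbb R^d$, and $\mathbb E\|s\|_2^2\le 2/r^2$. **Meta-algorithm (EFLH)** with parameter $\epsilon>0$ and horizon $T$. For $k\ge1$ with $2^{(1+\epsilon)^k}/2\le T$ let $l_k=\lfloor 2^{(1+\epsilon)^k}/2\rfloor+1$ and $\rho_k=\min\{\tfrac12,\sqrt{\log T/l_k}\}$. For each such $k$ and each round $j$ with $l_k\mid j-1$ an expert $(j,k)$ is started in round $j$ with weight $w_j^{(j,k)}=\rho_k$; it is an instance of the base algorithm with horizon $4l_k$ and $\eta=\frac{r}{2\sqrt{l_k}\,G}$, and it is active in the rounds $j,\dots,j+4l_k-1$. In round $t$ the player plays the average of the predictions $x_t^{(j,k)}$ of the active experts, weighted proportionally to $w_t^{(j,k)}$ (the origin if there is no expert), and then sets $w_{t+1}^{(j,k)}=w_t^{(j,k)}\bigl(1+\rho_k\frac{f_t(x_t)-f_t(x_t^{(j,k)})}{GD}\bigr)$ for each active expert. **Theorem.** There is an absolute constant $C>0$ such that for all $d$, $r>0$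 and $D\ge1$ there are a constant $B$ and randomized membership-oracle subroutines as above, which depend only on $d,r,D$ and (the subroutines) on the horizon $H$ of the instance that calls them and on $y$, such that the following holds for all $K,G$ as above, all $T\ge3$, all $\epsilon>0$, all starting points $\hat x,\hat y\in K$ and all adversaries as above. The subroutines meet the requirements above, and the meta-algorithm that uses them 1. always plays $x_t\in K$; 2. makes in each round, for all outcomes of its random choices, at most $B\,\dfrac{\log T\cdot\log\log T}{\min\{\epsilon,1\}}$ membership calls; 3. satisfies for all $1\le s\le t\le T$ $$\mathbb E\Bigl[\sum_{i=s}^t f_i(x_i)-\inf_{x\in K}\sum_{i=s}^t f_i(x)\Bigr]\le C\,\frac{D^2G\sqrt{\log T}\,\max\{1,t-s\}^{\frac12+\epsilon}}{r};$$ 4. if $\epsilon=1/\log T$, satisfies for all $1\le s\le t\le T$ $$\mathbb E\Bigl[\sum_{i=s}^t f_i(x_i)-\inf_{x\in K}\sum_{i=s}^t f_i(x)\Bigr]\le C\,\frac{D^2G\sqrt{\log T}\,\sqrt{\max\{1,t-s\}}}{r}.$$ -/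

import Mathlib

namespace ProjFree

/-! ### Randomized computations with a membership oracle -/

/-- Randomized computations over `E` with result in `α` whose only access to the domain is through
yes/no membership queries. Arithmetic is free, `rand n k` draws a uniform element of
`Fin (n + 1)`. -/
inductive OracleComp (E : Type) (α : Type) : Type where
  | pure (a : α) : OracleComp E α
  | query (x : E) (k : Bool → OracleComp E α) : OracleComp E α
  | rand (n : ℕ) (k : Fin (n + 1) → OracleComp E α) : OracleComp E α

namespace OracleComp

variable {E α β : Type}

/-- Run `m`, then continue with its result. -/
def bind (m : OracleComp E α) (f : α → OracleComp E β) : OracleComp E β :=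
  match m with
  | pure a => f a
  | query x k => query x fun b => (k b).bind f
  | rand n k => rand n fun i => (k i).bind f

/-- Run the computation `f` on all entries of a list, in order. -/
def traverse (f : α → OracleComp E β) : List α → OracleComp E (List β)
  | [] => pure []
  | a :: l => (f a).bind fun b => (traverse f l).bind fun bs => pure (b :: bs)

/-- The expectation of `F` of the result, when the queries are answered by `O`. -/
noncomputable def expect (O : E → Bool) (m : OracleComp E α) (F : α → ℝ) : ℝ :=
  match m with
  | pure a => F a
  | query x k => (k (O x)).expect O F
  | rand n k => (∑ i, (k i).expect O F) / (n + 1 : ℝ)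

/-- The set of results that have positive probability, when the queries are answered by `O`. -/
def support (O : E → Bool) (m : OracleComp E α) : Set α :=
  match m with
  | pure a => {a}
  | query x k => (k (O x)).support O
  | rand _ k => ⋃ i, (k i).support O

/-- The largest number of queries over all random choices, when the queries are answered
by `O`. -/
def maxCalls (O : E → Bool) (m : OracleComp E α) : ℕ :=
  match m with
  | pure _ => 0
  | query x k => (k (O x)).maxCalls O + 1
  | rand _ k => Finset.univ.sup fun i => (k i).maxCalls O

end OracleComp

open Classical in
/-- The membership oracle of `K`. -/
noncomputable def memOracle {E : Type} (K : Set E) (x : E) : Bool := decide (x ∈ K)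

/-! ### The Minkowski regularization and its approximation -/

section Base

variable {E : Type} [NormedAddCommGroup E] [InnerProductSpace ℝ E]

/-- The Minkowski regularization `γ(x) = inf {c ≥ 1 : x / c ∈ K}`. -/
noncomputable def gauge1 (K : Set E) (x : E) : ℝ :=
  sInf {c : ℝ | 1 ≤ c ∧ c⁻¹ • x ∈ K}

/-- Procedures that approximate `γ(y)` and a subgradient of `γ` at `y`; the first argument is the
time horizon, which determines the precision. -/
structure Subroutines (E : Type) where
  value : ℕ → E → OracleComp E ℝ
  subgrad : ℕ → E → OracleComp E E

/-- With the oracle of `K` the procedures for horizon `H` are `δ`-approximations: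
every output `c` of the first one is within `δ` of `γ(y)` and scales `y` into `K`; the output `s`
of the second one is in expectation a subgradient of `γ` at `y` up to `δ` and has second moment at
most `2 / r ^ 2`. -/
structure Subroutines.IsApprox (sub : Subroutines E) (K : Set E) (r : ℝ) (H : ℕ) (δ : ℝ) :
    Prop where
  value_spec : ∀ y : E, ∀ c ∈ (sub.value H y).support (memOracle K),
    1 ≤ c ∧ c⁻¹ • y ∈ K ∧ |c - gauge1 K y| ≤ δ
  subgrad_spec : ∀ y u : E,
    gauge1 K y + (sub.subgrad H y).expect (memOracle K) (fun s => inner ℝ s (u - y))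
      - δ * (1 + ‖u - y‖) ≤ gauge1 K u
  subgrad_sq : ∀ y : E,
    (sub.subgrad H y).expect (memOracle K) (fun s => ‖s‖ ^ 2) ≤ 2 / r ^ 2

/-! ### Losses -/

/-- A loss function together with a choice of its (sub)gradients. -/
structure Loss (E : Type) where
  val : E → ℝ
  grad : E → E

/-- The loss is convex and `G`-Lipschitz on the whole space and non-negative on `K`,
and `grad` selects subgradients. -/
structure Loss.IsAdmissible (f : Loss E) (K : Set E) (G : ℝ) : Prop where
  convex : ConvexOn ℝ Set.univ f.val
  lipschitz : ∀ x y : E, |f.val x - f.val y| ≤ G * ‖x - y‖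
  nonneg : ∀ x ∈ K, 0 ≤ f.val x
  subgradient : ∀ y u : E, f.val y + inner ℝ (f.grad y) (u - y) ≤ f.val u

/-! ### The base algorithm -/

/-- One update of the base algorithm with horizon `H` and step size `η`. The base algorithm keeps a
pair `(x, y)`, plays `x`, and after observing the loss `f` it makes a gradient step at `y` for
`f + 3 G D (γ - 1)` and scales the new `y` back to the domain. -/
noncomputable def baseStep (sub : Subroutines E) (H : ℕ) (η G D : ℝ) (f : Loss E) (y : E) :
    OracleComp E (E × E) :=
  (sub.subgrad H y).bind fun s =>
    let y' := y - η • (f.grad y + (3 * G * D) • s)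
    (sub.value H y').bind fun c => .pure (c⁻¹ • y', y')

/-! ### The meta-algorithm -/

/-- The numbers `l_k = ⌊2 ^ ((1 + ε) ^ k) / 2⌋ + 1`. -/
noncomputable def len (ε : ℝ) (k : ℕ) : ℕ := ⌊(2 : ℝ) ^ ((1 + ε) ^ k) / 2⌋₊ + 1

open Classical in
/-- The levels `k ≥ 1` with `2 ^ ((1 + ε) ^ k) / 2 ≤ T`, in increasing order. The upper end of the
range only makes the list finite, see `mem_levels`. -/
noncomputable def levels (ε : ℝ) (T : ℕ) : List ℕ :=
  (List.range (⌈2 * (T : ℝ) / ε⌉₊ + 1)).filter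
    fun k => decide (1 ≤ k ∧ (2 : ℝ) ^ ((1 + ε) ^ k) / 2 ≤ T)

theorem mem_levels {ε : ℝ} (hε : 0 < ε) (T k : ℕ) :
    k ∈ levels ε T ↔ 1 ≤ k ∧ (2 : ℝ) ^ ((1 + ε) ^ k) / 2 ≤ T := by
  simp only [levels, List.mem_filter, List.mem_range, decide_eq_true_eq, and_iff_right_iff_imp]
  rintro ⟨-, hk⟩
  have h1 : 1 + (k : ℝ) * ε ≤ (1 + ε) ^ k := one_add_mul_le_pow (by linarith) k
  have h2 : (1 + ε) ^ k + 1 ≤ (2 : ℝ) ^ ((1 + ε) ^ k) := by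
    have h := one_add_mul_self_le_rpow_one_add (s := 1) (by norm_num)
      (p := (1 + ε) ^ k) (one_le_pow₀ (by linarith))
    norm_num at h
    linarith
  have h3 : (k : ℝ) ≤ 2 * (T : ℝ) / ε := by
    rw [le_div_iff₀ hε]
    linarith
  exact Nat.lt_succ_of_le (by exact_mod_cast h3.trans (Nat.le_ceil _))

/-- The learning rate `min {1/2, √(log T / l_k)}` of level `k`. -/
noncomputable def rate (ε : ℝ) (T k : ℕ) : ℝ :=
  min (1 / 2) (√(Real.log T / len ε k))

/-- The record of an expert `(birth, lvl)`, an instance of the base algorithm started in round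
`birth` with lifespan and horizon `4 l_k`, `k = lvl`: its current pair `(x, y)` and weight `w`. -/
structure Expert (E : Type) where
  birth : ℕ
  lvl : ℕ
  x : E
  y : E
  w : ℝ

/-- The inputs of the algorithm: exponent `ε`, radius `r`, diameter bound `D`, Lipschitz constant
`G`, horizon `T`, and the initial pair `(x₁, y₁)` of the base algorithm. -/
structure Params (E : Type) where
  ε : ℝ
  r : ℝ
  D : ℝ
  G : ℝ
  T : ℕ
  x₁ : E
  y₁ : E

open Classical in
/-- The experts that are started in round `j`: one for each level `k` with `l_k ∣ j - 1`. -/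
noncomputable def spawn (p : Params E) (j : ℕ) : List (Expert E) :=
  ((levels p.ε p.T).filter fun k => decide (len p.ε k ∣ j - 1)).map
    fun k => ⟨j, k, p.x₁, p.y₁, rate p.ε p.T k⟩

/-- The state before a round: the active experts, and the points played so far in order. -/
structure State (E : Type) where
  experts : List (Expert E)
  plays : List E

/-- The state before round `1`. -/
noncomputable def initState (p : Params E) : State E := ⟨spawn p 1, []⟩

/-- The weighted average of the predictions of the active experts. -/
noncomputable def playPoint (es : List (Expert E)) : E :=
  (es.map fun e => (e.w / (es.map fun e' => e'.w).sum) • e.x).sum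

/-- The update of one active expert when `x` was played and the loss `f` was observed: a step of
the base algorithm with horizon `4 l_k` and step size `r / (2 √l_k G)`, and a multiplicative
update of the weight with the losses scaled by `1 / (G D)`. -/
noncomputable def updateExpert (sub : Subroutines E) (p : Params E) (x : E) (f : Loss E)
    (e : Expert E) : OracleComp E (Expert E) :=
  (baseStep sub (4 * len p.ε e.lvl) (p.r / (2 * √(len p.ε e.lvl) * p.G)) p.G p.D f e.y).bind
    fun z => .pure
      { e with
        x := z.1
        y := z.2
        w := e.w * (1 + rate p.ε p.T e.lvl * ((f.val x - f.val e.x) / (p.G * p.D))) }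

/-- An adversary: it sees the points `[x_1, …, x_t]` played up to the current round `t`
and answers with the loss of round `t`. -/
abbrev Adversary (E : Type) := List E → Loss E

open Classical in
/-- Round `t`: play, observe the loss, update the active experts, remove those whose lifespan is
over and start the experts of round `t + 1`. -/
noncomputable def round (sub : Subroutines E) (p : Params E) (adv : Adversary E) (t : ℕ)
    (σ : State E) : OracleComp E (State E) :=
  let x := playPoint σ.experts
  let plays := σ.plays ++ [x]
  (OracleComp.traverse (updateExpert sub p x (adv plays)) σ.experts).bind fun es => .pure
    { experts := (es.filter fun e => decide (t + 1 < e.birth + 4 * len p.ε e.lvl))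
        ++ spawn p (t + 1)
      plays := plays }

/-- The first `n` rounds of the algorithm against the adversary. -/
noncomputable def run (sub : Subroutines E) (p : Params E) (adv : Adversary E) :
    ℕ → OracleComp E (State E)
  | 0 => .pure (initState p)
  | n + 1 => (run sub p adv n).bind (round sub p adv (n + 1))

/-- The regret `∑_{i=s}^t f_i(x_i) - inf_{x ∈ K} ∑_{i=s}^t f_i(x)` of the played points
`[x_1, x_2, …]`, where `f_i` is the answer of the adversary to `[x_1, …, x_i]`. -/
noncomputable def regret (K : Set E) (adv : Adversary E) (plays : List E) (s t : ℕ) : ℝ :=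
  ∑ i ∈ Finset.Icc s t, (adv (plays.take i)).val (plays.getD (i - 1) 0)
    - ⨅ x : K, ∑ i ∈ Finset.Icc s t, (adv (plays.take i)).val x

/-- The expected regret of the algorithm on the rounds `s, …, t`. -/
noncomputable def expectedRegret (sub : Subroutines E) (p : Params E) (adv : Adversary E)
    (K : Set E) (s t : ℕ) : ℝ :=
  (run sub p adv p.T).expect (memOracle K) fun σ => regret K adv σ.plays s t

end Base

end ProjFree

/-!
Projections are replaced by the penalty `3 G D (γ - 1)`. As `f` is `G`-Lipschitz, moving from `y` to
the prediction `y / γ(y) ∈ K` costs at most `G D (γ(y) - 1)`, which the penalty pays for, and the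
penalty vanishes at the comparators in `K`. So each expert is stochastic gradient descent on
penalized losses, with regret of order `G D² √l_k / r` on its lifespan.

Values of `γ` are found by bisection. As `γ` is convex and Lipschitz, the forward differences at a
grid point differ from a subgradient by at most second differences of `γ`, and these telescope along
the grid lines when the grid point is drawn uniformly at random.

The played point `x` is the weighted average of the predictions `x'`, so by convexity a round
changes the potential `∑ w / ρ` by a positive multiple of `∑ w (f x - f x') ≤ 0`, apart from the
experts that are started. This bounds the excess loss over an expert of level `k` by the order of
`G D √(l_k log T)`, on average over the experts that share its length and birth.

On an interval of length `m` one takes the level with `l_k` just below `m / 2`, so that `m` is at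
most about `l_k ^ (1 + ε)`, and covers all but an initial part of length less than `l_k` by
lifespans of experts of that level; the initial part is treated in the same way.
-/

namespace ProjFree

namespace OracleComp

variable {E α β : Type} {O : E → Bool}

/-! ### Expectations, supports and query counts -/

theorem expect_bind (m : OracleComp E α) (f : α → OracleComp E β) (F : β → ℝ) :
    (m.bind f).expect O F = m.expect O fun a => (f a).expect O F := by
  induction m with
  | pure a => rfl
  | query x k ih => simp only [bind, expect, ih]
  | rand n k ih => simp only [bind, expect, ih]

theorem mem_support_bind {m : OracleComp E α} {f : α → OracleComp E β} {b : β} :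
    b ∈ (m.bind f).support O ↔ ∃ a ∈ m.support O, b ∈ (f a).support O := by
  induction m with
  | pure a => simp [bind, support]
  | query x k ih => simp only [bind, support, ih]
  | rand n k ih =>
    simp only [bind, support, Set.mem_iUnion, ih]
    constructor
    · rintro ⟨i, a, ha, hb⟩
      exact ⟨a, ⟨i, ha⟩, hb⟩
    · rintro ⟨a, ⟨i, ha⟩, hb⟩
      exact ⟨i, a, ha, hb⟩

@[simp] theorem mem_support_pure {a b : α} :
    b ∈ (pure a : OracleComp E α).support O ↔ b = a := Iff.rfl

@[simp] theorem expect_pure (a : α) (F : α → ℝ) :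
    (pure a : OracleComp E α).expect O F = F a := rfl

theorem expect_mono {m : OracleComp E α} {F F' : α → ℝ}
    (h : ∀ a ∈ m.support O, F a ≤ F' a) : m.expect O F ≤ m.expect O F' := by
  induction m with
  | pure a => exact h a rfl
  | query x k ih => exact ih _ h
  | rand n k ih =>
    simp only [expect]
    gcongr with i
    exact ih i fun a ha => h a (Set.mem_iUnion.2 ⟨i, ha⟩)

theorem expect_congr {m : OracleComp E α} {F F' : α → ℝ}
    (h : ∀ a ∈ m.support O, F a = F' a) : m.expect O F = m.expect O F' :=
  le_antisymm (expect_mono fun a ha => (h a ha).le) (expect_mono fun a ha => (h a ha).ge)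

@[simp] theorem expect_const (m : OracleComp E α) (c : ℝ) : m.expect O (fun _ => c) = c := by
  induction m with
  | pure a => rfl
  | query _ _ ih => exact ih _
  | rand n k ih =>
    simp only [expect, ih, Finset.sum_const, Finset.card_univ, Fintype.card_fin, nsmul_eq_mul]
    push_cast
    field_simp

theorem expect_add (m : OracleComp E α) (F F' : α → ℝ) :
    m.expect O (fun a => F a + F' a) = m.expect O F + m.expect O F' := by
  induction m with
  | pure a => rfl
  | query _ _ ih => exact ih _
  | rand n k ih => simp only [expect, ih, Finset.sum_add_distrib, add_div]

theorem expect_const_mul (m : OracleComp E α) (c : ℝ) (F : α → ℝ) :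
    m.expect O (fun a => c * F a) = c * m.expect O F := by
  induction m with
  | pure a => rfl
  | query _ _ ih => exact ih _
  | rand n k ih => simp only [expect, ih, ← Finset.mul_sum, mul_div_assoc]

theorem expect_sub (m : OracleComp E α) (F F' : α → ℝ) :
    m.expect O (fun a => F a - F' a) = m.expect O F - m.expect O F' := by
  have h := expect_const_mul (O := O) m (-1) F'
  have h' := expect_add (O := O) m F fun a => -1 * F' a
  simp only [neg_mul, one_mul, ← sub_eq_add_neg] at h h'
  rw [h', h, sub_eq_add_neg]

theorem expect_sum {ι : Type*} (m : OracleComp E α) (s : Finset ι) (F : ι → α → ℝ) :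
    m.expect O (fun a => ∑ i ∈ s, F i a) = ∑ i ∈ s, m.expect O (F i) := by
  classical
  induction s using Finset.induction_on with
  | empty => simp
  | insert i s hi ih => simp only [Finset.sum_insert hi, expect_add, ih]

theorem expect_le_const {m : OracleComp E α} {F : α → ℝ} {c : ℝ}
    (h : ∀ a ∈ m.support O, F a ≤ c) : m.expect O F ≤ c :=
  (expect_mono h).trans_eq (expect_const m c)

theorem maxCalls_bind_le {m : OracleComp E α} {f : α → OracleComp E β} {a b : ℕ}
    (hm : m.maxCalls O ≤ a) (hf : ∀ x ∈ m.support O, (f x).maxCalls O ≤ b) :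
    (m.bind f).maxCalls O ≤ a + b := by
  induction m generalizing a with
  | pure x => exact (hf x rfl).trans (Nat.le_add_left _ _)
  | query x k ih =>
    simp only [maxCalls] at hm
    have hk := ih (O x) (a := a - 1) (by omega) hf
    simp only [bind, maxCalls]
    omega
  | rand n k ih =>
    simp only [maxCalls, bind, Finset.sup_le_iff] at hm ⊢
    exact fun i _ => ih i (hm i (Finset.mem_univ i))
      fun x hx => hf x (Set.mem_iUnion.2 ⟨i, hx⟩)

theorem forall₂_of_mem_support_traverse {f : α → OracleComp E β} {l : List α} {bs : List β}
    (h : bs ∈ (traverse f l).support O) :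
    List.Forall₂ (fun a b => b ∈ (f a).support O) l bs := by
  induction l generalizing bs with
  | nil =>
    obtain rfl : bs = [] := h
    exact .nil
  | cons a l ih =>
    simp only [traverse, mem_support_bind, mem_support_pure] at h
    obtain ⟨b, hb, bs', hbs', rfl⟩ := h
    exact .cons hb (ih hbs')

theorem maxCalls_traverse_le {f : α → OracleComp E β} {l : List α} {c : ℕ}
    (h : ∀ a ∈ l, (f a).maxCalls O ≤ c) : (traverse f l).maxCalls O ≤ l.length * c := by
  induction l with
  | nil => simp [traverse, maxCalls]
  | cons a l ih =>
    have htail := ih fun b hb => h b (List.mem_cons_of_mem _ hb)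
    simp only [traverse, List.length_cons, Nat.succ_mul, Nat.add_comm _ c]
    exact maxCalls_bind_le (h a List.mem_cons_self) fun b _ =>
      maxCalls_bind_le (b := 0) htail fun _ _ => le_rfl

theorem expect_traverse_find? {κ : Type} [DecidableEq κ] {f : α → OracleComp E α} {key : α → κ}
    (hkey : ∀ a, ∀ b ∈ (f a).support O, key b = key a) (l : List α) (i : κ)
    (F : Option α → ℝ) :
    (traverse f l).expect O (fun bs => F (bs.find? fun b => decide (key b = i))) =
      match l.find? fun b => decide (key b = i) with
      | none => F none
      | some a => (f a).expect O fun b => F (some b) := by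
  induction l with
  | nil => rfl
  | cons a l ih =>
    simp only [traverse, expect_bind, expect_pure, List.find?_cons]
    by_cases ha : key a = i
    · simp only [ha, decide_true]
      exact expect_congr fun b hb => by simp [hkey a b hb, ha]
    · simp only [ha, decide_false, ← ih]
      exact (expect_congr fun b hb => by simp [hkey a b hb, ha]).trans (expect_const (f a) _)

/-- With oracle `O` the computation `m` returns `a` whatever the random draws. The expectation is
recorded next to the support so that both can be rewritten without an induction over `m`. -/
def Returns (O : E → Bool) (m : OracleComp E α) (a : α) : Prop :=
  m.support O = {a} ∧ ∀ F : α → ℝ, m.expect O F = F a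

theorem Returns.pure (a : α) : Returns O (OracleComp.pure a : OracleComp E α) a :=
  ⟨rfl, fun _ => rfl⟩

theorem Returns.bind {m : OracleComp E α} {f : α → OracleComp E β} {a : α} {b : β}
    (hm : Returns O m a) (hf : Returns O (f a) b) : Returns O (m.bind f) b := by
  refine ⟨?_, fun F => ?_⟩
  · ext x
    simp only [mem_support_bind, hm.1, hf.1, Set.mem_singleton_iff, exists_eq_left]
  · rw [expect_bind, hm.2, hf.2]

theorem Returns.traverse {f : α → OracleComp E β} {g : α → β} (h : ∀ a, Returns O (f a) (g a))
    (l : List α) : Returns O (OracleComp.traverse f l) (l.map g) := by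
  induction l with
  | nil => exact Returns.pure _
  | cons a l ih => exact (h a).bind (ih.bind (Returns.pure _))

section Mean

variable [NormedAddCommGroup E] [InnerProductSpace ℝ E]

/-- The expected value of a random vector. -/
noncomputable def mean (O : E → Bool) : OracleComp E E → E
  | .pure a => a
  | .query x k => (k (O x)).mean O
  | .rand n k => ((n : ℝ) + 1)⁻¹ • ∑ i, (k i).mean O

theorem expect_inner (m : OracleComp E E) (w : E) :
    m.expect O (fun s => inner ℝ w s) = inner ℝ w (m.mean O) := by
  induction m with
  | pure a => rfl
  | query _ _ ih => exact ih _
  | rand n k ih => simp only [expect, mean, ih, real_inner_smul_right, inner_sum, div_eq_inv_mul]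

end Mean

end OracleComp

/-! ### The Minkowski regularization -/

section Gauge

open Topology

variable {E : Type} [NormedAddCommGroup E] [InnerProductSpace ℝ E] {K : Set E}

theorem inv_smul_mem_of_le (hK : Convex ℝ K) (h0 : (0 : E) ∈ K) {x : E} {c c' : ℝ} (hc : 0 < c)
    (hcc : c ≤ c') (hx : c⁻¹ • x ∈ K) : c'⁻¹ • x ∈ K := by
  have h := hK.smul_mem_of_zero_mem h0 hx (t := c / c')
    ⟨div_nonneg hc.le (hc.le.trans hcc), (div_le_one (hc.trans_le hcc)).2 hcc⟩
  rwa [smul_smul, div_mul_eq_mul_div, mul_inv_cancel₀ hc.ne', one_div] at h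

theorem inv_smul_mem_of_norm_le {r : ℝ} (hball : Metric.closedBall 0 r ⊆ K) {x : E} {c : ℝ}
    (hc : 0 < c) (hx : ‖x‖ ≤ c * r) : c⁻¹ • x ∈ K := by
  apply hball
  rwa [mem_closedBall_zero_iff, norm_smul, norm_inv, Real.norm_of_nonneg hc.le,
    inv_mul_le_iff₀ hc]

theorem inv_smul_mem_of_gauge_lt (hK : Convex ℝ K) (h0 : K ∈ 𝓝 0) {x : E} {c : ℝ}
    (h : gauge K x < c) : c⁻¹ • x ∈ K := by
  obtain ⟨b, hb, hbc, hx⟩ := exists_lt_of_gauge_lt (absorbent_nhds_zero h0) h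
  exact inv_smul_mem_of_le hK (mem_of_mem_nhds h0) hb hbc.le
    ((Set.mem_smul_set_iff_inv_smul_mem₀ hb.ne' _ _).1 hx)

theorem gauge1_le {x : E} {c : ℝ} (hc : 1 ≤ c) (hx : c⁻¹ • x ∈ K) : gauge1 K x ≤ c :=
  csInf_le ⟨1, fun _ hc => hc.1⟩ ⟨hc, hx⟩

theorem gauge1_eq_max (hK : Convex ℝ K) (h0 : K ∈ 𝓝 0) (x : E) :
    gauge1 K x = max 1 (gauge K x) := by
  refine le_antisymm (le_of_forall_gt_imp_ge_of_dense fun c hc => ?_) ?_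
  · obtain ⟨hc1, hcx⟩ := max_lt_iff.1 hc
    exact gauge1_le hc1.le (inv_smul_mem_of_gauge_lt hK h0 hcx)
  · refine le_csInf ⟨max 1 (gauge K x + 1), le_max_left _ _, inv_smul_mem_of_gauge_lt hK h0
      (lt_max_of_lt_right (lt_add_one _))⟩ fun c hc => max_le hc.1 ?_
    have hc0 : 0 < c := zero_lt_one.trans_le hc.1
    exact gauge_le_of_mem hc0.le ((Set.mem_smul_set_iff_inv_smul_mem₀ hc0.ne' _ _).2 hc.2)

theorem one_le_gauge1 (hK : Convex ℝ K) (h0 : K ∈ 𝓝 0) (x : E) : 1 ≤ gauge1 K x := by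
  rw [gauge1_eq_max hK h0]
  exact le_max_left _ _

theorem gauge1_of_mem (hK : Convex ℝ K) (h0 : K ∈ 𝓝 0) {x : E} (hx : x ∈ K) :
    gauge1 K x = 1 := by
  rw [gauge1_eq_max hK h0, max_eq_left (gauge_le_one_of_mem hx)]

theorem le_gauge1_of_inv_smul_notMem (hK : Convex ℝ K) (h0 : K ∈ 𝓝 0) {x : E} {c : ℝ}
    (hx : c⁻¹ • x ∉ K) : c ≤ gauge1 K x := by
  rw [gauge1_eq_max hK h0]
  exact le_max_of_le_right (not_lt.1 fun h => hx (inv_smul_mem_of_gauge_lt hK h0 h))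

theorem convexOn_gauge1 (hK : Convex ℝ K) (h0 : K ∈ 𝓝 0) :
    ConvexOn ℝ Set.univ (gauge1 K) := by
  have hgauge : ConvexOn ℝ Set.univ (gauge K) := by
    refine ⟨convex_univ, fun x _ y _ a b ha hb _ => ?_⟩
    rw [← gauge_smul_of_nonneg ha, ← gauge_smul_of_nonneg hb]
    exact gauge_add_le hK (absorbent_nhds_zero h0) _ _
  rw [funext (gauge1_eq_max hK h0)]
  exact (convexOn_const 1 convex_univ).sup hgauge

theorem abs_gauge1_sub_le {r : ℝ} (hK : Convex ℝ K) (hr : 0 < r)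
    (hball : Metric.closedBall 0 r ⊆ K) (x y : E) :
    |gauge1 K x - gauge1 K y| ≤ 1 / r * ‖x - y‖ := by
  have h0 : K ∈ 𝓝 0 := Filter.mem_of_superset (Metric.closedBall_mem_nhds 0 hr) hball
  lift r to NNReal using hr.le
  have hlip := (hK.lipschitzWith_gauge (NNReal.coe_pos.1 hr)
    (Metric.ball_subset_closedBall.trans hball)).dist_le_mul x y
  rw [gauge1_eq_max hK h0, gauge1_eq_max hK h0]
  rw [max_comm 1, max_comm 1]
  refine (abs_max_sub_max_le_abs (gauge K x) (gauge K y) 1).trans ?_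
  rwa [Real.dist_eq, dist_eq_norm, NNReal.coe_inv, ← one_div] at hlip

end Gauge

/-! ### Subgradients of convex functions -/

section Subgradient

variable {E : Type*} [NormedAddCommGroup E] [InnerProductSpace ℝ E]

/-- `v` is a subgradient of `f` at `x`, in the sense of convex analysis. -/
def IsSubgradientAt (f : E → ℝ) (v x : E) : Prop := ∀ u, f x + inner ℝ v (u - x) ≤ f u

theorem exists_subgradient [CompleteSpace E] {f : E → ℝ} (hf : ConvexOn ℝ Set.univ f)
    (hc : Continuous f) (x : E) : ∃ v, IsSubgradientAt f v x := by
  have hopen : IsOpen {p : E × ℝ | p.1 ∈ Set.univ ∧ f p.1 < p.2} := by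
    simp only [Set.mem_univ, true_and]
    exact isOpen_lt (hc.comp continuous_fst) continuous_snd
  obtain ⟨ℓ, hℓ⟩ := geometric_hahn_banach_open_point (x := (x, f x))
    hf.convex_strict_epigraph hopen (by simp)
  set L : E →L[ℝ] ℝ := ℓ.comp (ContinuousLinearMap.inl ℝ E ℝ) with hL
  have hsep : ∀ u t, f u < t → L (u - x) < (t - f x) * -ℓ (0, 1) := by
    intro u t ht
    have hsplit : ((u, t) : E × ℝ) = (x, f x) + ((u - x, 0) + (t - f x) • (0, 1)) := by simp
    have h := hℓ (u, t) ⟨Set.mem_univ u, ht⟩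
    rw [hsplit, map_add, map_add, map_smul, smul_eq_mul] at h
    simp only [hL, ContinuousLinearMap.comp_apply, ContinuousLinearMap.inl_apply]
    linarith
  have hslope : 0 < -ℓ (0, 1) := by simpa using hsep x (f x + 1) (lt_add_one _)
  refine ⟨(InnerProductSpace.toDual ℝ E).symm ((-ℓ (0, 1))⁻¹ • L), fun u => ?_⟩
  refine le_of_forall_gt_imp_ge_of_dense fun t ht => ?_
  have h := (mul_inv_le_iff₀ hslope).2 (hsep u t ht).le
  rw [InnerProductSpace.toDual_symm_apply, smul_apply, smul_eq_mul, mul_comm]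
  linarith

theorem IsSubgradientAt.norm_le {f : E → ℝ} {L : ℝ} (hL0 : 0 ≤ L) {x v : E}
    (hv : IsSubgradientAt f v x) (hL : ∀ u, f u ≤ f x + L * ‖u - x‖) : ‖v‖ ≤ L := by
  rcases eq_or_ne v 0 with rfl | h0
  · simpa
  have h := (hv (x + v)).trans (hL (x + v))
  rw [add_sub_cancel_left, real_inner_self_eq_norm_sq, pow_two] at h
  exact le_of_mul_le_mul_right (le_of_add_le_add_left h) (norm_pos_iff.2 h0)

theorem IsSubgradientAt.inner_le_of_norm_sub_le {f : E → ℝ} {L ρ : ℝ} {x y v w : E}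
    (hv : IsSubgradientAt f v x) (hw : IsSubgradientAt f w y) (hvL : ‖v‖ ≤ L) (hwL : ‖w‖ ≤ L)
    (hxy : ‖x - y‖ ≤ ρ) (s u : E) :
    inner ℝ s (u - y) ≤ f u - f y + 2 * L * ρ + ‖s - v‖ * ‖u - y‖ := by
  have hcs : ∀ {a : E}, ‖a‖ ≤ L → inner ℝ a (x - y) ≤ L * ρ := fun ha =>
    (real_inner_le_norm _ _).trans
      (mul_le_mul ha hxy (norm_nonneg _) ((norm_nonneg _).trans ha))
  have hw' := hcs (a := -w) (by rwa [norm_neg])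
  rw [inner_neg_left] at hw'
  calc inner ℝ s (u - y)
      = inner ℝ (s - v) (u - y) + (inner ℝ v (u - x) + inner ℝ v (x - y)) := by
        rw [← inner_add_right, sub_add_sub_cancel, inner_sub_left, sub_add_cancel]
    _ ≤ ‖s - v‖ * ‖u - y‖ + (f u - f x + L * ρ) := by
        gcongr
        · exact real_inner_le_norm _ _
        · linarith [hv u]
        · exact hcs hvL
    _ ≤ f u - f y + 2 * L * ρ + ‖s - v‖ * ‖u - y‖ := by linarith [hw x]

end Subgradient

/-! ### Forward differences on a random grid -/

section Grid

variable {ι : Type*} [Fintype ι]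

theorem norm_le_sum_abs (x : EuclideanSpace ℝ ι) : ‖x‖ ≤ ∑ i, |x i| := by
  rw [EuclideanSpace.norm_eq, Real.sqrt_le_left (Finset.sum_nonneg fun i _ => abs_nonneg _)]
  exact Finset.sum_sq_le_sq_sum_of_nonneg fun i _ => abs_nonneg (x i)

theorem norm_sq_le_add_sum_abs_sub_mul {s v : EuclideanSpace ℝ ι} {c : ℝ}
    (h : ∀ i, |s i + v i| ≤ c) : ‖s‖ ^ 2 ≤ ‖v‖ ^ 2 + (∑ i, |s i - v i|) * c := by
  rw [EuclideanSpace.norm_sq_eq, EuclideanSpace.norm_sq_eq, Finset.sum_mul,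
    ← Finset.sum_add_distrib]
  gcongr with i
  calc ‖s i‖ ^ 2 = ‖v i‖ ^ 2 + (s i - v i) * (s i + v i) := by
        simp only [Real.norm_eq_abs, sq_abs]
        ring
    _ ≤ ‖v i‖ ^ 2 + |s i - v i| * |s i + v i| := by
        rw [← abs_mul]
        gcongr
        exact le_abs_self _
    _ ≤ ‖v i‖ ^ 2 + |s i - v i| * c := by
        gcongr
        exact h i

/-- The point with index `z` of the grid with mesh `q` and lowest corner `y`. -/
noncomputable def gridPoint (y : EuclideanSpace ℝ ι) (q : ℝ) (z : ι → ℕ) : EuclideanSpace ℝ ι :=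
  y + q • WithLp.toLp 2 fun j => (z j : ℝ)

theorem gridPoint_update_succ {ι : Type*} [DecidableEq ι] (y : EuclideanSpace ℝ ι) (q : ℝ)
    (z : ι → ℕ) (i : ι) :
    gridPoint y q (Function.update z i (z i + 1)) =
      gridPoint y q z + q • EuclideanSpace.single i 1 := by
  ext j
  by_cases hj : j = i
  · subst hj
    simp only [gridPoint, PiLp.add_apply, PiLp.smul_apply, Function.update_self,
      PiLp.single_apply, if_true, smul_eq_mul, Nat.cast_add, Nat.cast_one]
    ring
  · simp [gridPoint, hj]

theorem norm_gridPoint_sub_le (y : EuclideanSpace ℝ ι) {q : ℝ} (hq : 0 ≤ q) {N : ℕ}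
    (z : ι → Fin N) : ‖gridPoint y q (fun j => z j) - y‖ ≤ q * (Fintype.card ι * N) := by
  rw [gridPoint, add_sub_cancel_left, norm_smul, Real.norm_of_nonneg hq]
  gcongr
  refine (norm_le_sum_abs _).trans ?_
  rw [← nsmul_eq_mul]
  refine Finset.sum_le_card_nsmul _ _ _ fun i _ => ?_
  simp [(z i).2.le]

variable [DecidableEq ι]

theorem sum_sum_update {β M : Type*} [Fintype β] [AddCommMonoid M] (g : (ι → β) → M) (i : ι) :
    ∑ z : ι → β, ∑ t : β, g (Function.update z i t) = Fintype.card β • ∑ z : ι → β, g z := by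
  -- `(z, t) ↦ (update z i t, z i)` is an involution, so `t` may be moved out of `g`.
  have hinv : Function.Involutive fun p : (ι → β) × β => (Function.update p.1 i p.2, p.1 i) := by
    rintro ⟨z, t⟩
    simp
  have h := Equiv.sum_comp (hinv.toPerm _) fun p : (ι → β) × β => g p.1
  rw [Fintype.sum_prod_type, Fintype.sum_prod_type] at h
  simp only [Function.Involutive.coe_toPerm] at h
  rw [h, Finset.smul_sum]
  simp

theorem sum_update_succ_sub_le {N : ℕ} {L : ℝ} {φ : (ι → ℕ) → ℝ} (hφ : ∀ z, |φ z| ≤ L) (i : ι) :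
    N * ∑ z : ι → Fin N, (φ (Function.update (fun j => (z j : ℕ)) i (z i + 1)) - φ fun j => z j) ≤
      2 * L * N ^ Fintype.card ι := by
  have hmove := sum_sum_update (fun z : ι → Fin N =>
    φ (Function.update (fun j => (z j : ℕ)) i (z i + 1)) - φ fun j => z j) i
  rw [Fintype.card_fin, nsmul_eq_mul] at hmove
  have hcoe (z : ι → Fin N) (t : Fin N) : (fun j => ((Function.update z i t j : Fin N) : ℕ)) =
      Function.update (fun j => (z j : ℕ)) i t :=
    Function.comp_update (fun a : Fin N => (a : ℕ)) z i t
  calc _ = ∑ z : ι → Fin N, (φ (Function.update (fun j => (z j : ℕ)) i N) -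
        φ (Function.update (fun j => (z j : ℕ)) i 0)) := by
        rw [← hmove]
        refine Finset.sum_congr rfl fun z _ => ?_
        simp only [hcoe, Function.update_self, Function.update_idem]
        rw [Fin.sum_univ_eq_sum_range fun t =>
          φ (Function.update (fun j => (z j : ℕ)) i (t + 1)) -
            φ (Function.update (fun j => (z j : ℕ)) i t),
          Finset.sum_range_sub fun t => φ (Function.update (fun j => (z j : ℕ)) i t)]
    _ ≤ ∑ _z : ι → Fin N, 2 * L := by
        gcongr with z
        linarith [le_of_abs_le (hφ (Function.update (fun j => (z j : ℕ)) i N)),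
          neg_le_of_abs_le (hφ (Function.update (fun j => (z j : ℕ)) i 0))]
    _ = 2 * L * N ^ Fintype.card ι := by
        simp [mul_comm]

/-- The vector of the forward difference quotients of `f` at `x` with step `q` in the coordinate
directions. -/
noncomputable def forwardSlopes (f : EuclideanSpace ℝ ι → ℝ) (q : ℝ) (x : EuclideanSpace ℝ ι) :
    EuclideanSpace ℝ ι :=
  WithLp.toLp 2 fun i => (f (x + q • EuclideanSpace.single i 1) - f x) / q

variable {f : EuclideanSpace ℝ ι → ℝ} {L q κ : ℝ}

theorem IsSubgradientAt.apply_le_forwardSlopes {v x : EuclideanSpace ℝ ι}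
    (hv : IsSubgradientAt f v x) (hq : 0 < q) (i : ι) : v i ≤ forwardSlopes f q x i := by
  have h := hv (x + q • EuclideanSpace.single i 1)
  rw [add_sub_cancel_left, real_inner_smul_right, EuclideanSpace.inner_single_right] at h
  simp only [conj_trivial, one_mul] at h
  simp only [forwardSlopes]
  rw [le_div_iff₀ hq]
  linarith

theorem IsSubgradientAt.forwardSlopes_le_apply {v x : EuclideanSpace ℝ ι} {i : ι}
    (hv : IsSubgradientAt f v (x + q • EuclideanSpace.single i 1)) (hq : 0 < q) :
    forwardSlopes f q x i ≤ v i := by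
  have h := hv x
  rw [sub_add_cancel_left, inner_neg_right, real_inner_smul_right,
    EuclideanSpace.inner_single_right] at h
  simp only [conj_trivial, one_mul] at h
  simp only [forwardSlopes]
  rw [div_le_iff₀ hq]
  linarith

variable {v : EuclideanSpace ℝ ι → EuclideanSpace ℝ ι}

theorem abs_forwardSlopes_le (hq : 0 < q) (hv : ∀ x, IsSubgradientAt f (v x) x)
    (hL : ∀ x, ‖v x‖ ≤ L) (x : EuclideanSpace ℝ ι) (i : ι) : |forwardSlopes f q x i| ≤ L := by
  have hcoord (x) : |v x i| ≤ L := (PiLp.norm_apply_le (v x) i).trans (hL x)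
  exact abs_le.2 ⟨(neg_le_of_abs_le (hcoord x)).trans ((hv x).apply_le_forwardSlopes hq i),
    ((hv _).forwardSlopes_le_apply hq).trans (le_of_abs_le (hcoord _))⟩

theorem sum_forwardSlopes_sub_le (hq : 0 < q) (hv : ∀ x, IsSubgradientAt f (v x) x)
    (hL : ∀ x, ‖v x‖ ≤ L) (y : EuclideanSpace ℝ ι) (N : ℕ) (i : ι) :
    N * ∑ z : ι → Fin N, (forwardSlopes f q (gridPoint y q fun j => z j) i -
      v (gridPoint y q fun j => z j) i) ≤ 2 * L * N ^ Fintype.card ι := by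
  refine le_trans ?_ (sum_update_succ_sub_le (φ := fun z => v (gridPoint y q z) i)
    (fun z => (PiLp.norm_apply_le _ i).trans (hL _)) i)
  gcongr with z
  simp only [gridPoint_update_succ y q (fun j => ((z j : Fin N) : ℕ))]
  exact (hv _).forwardSlopes_le_apply hq

theorem sum_abs_sub_subgradient_le (hq : 0 < q) (hv : ∀ x, IsSubgradientAt f (v x) x)
    (hL : ∀ x, ‖v x‖ ≤ L) (y : EuclideanSpace ℝ ι) {N : ℕ} (hN : 0 < N)
    {s : (ι → Fin N) → EuclideanSpace ℝ ι} {i : ι}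
    (hs : ∀ z, |s z i - forwardSlopes f q (gridPoint y q fun j => z j) i| ≤ κ) :
    ∑ z : ι → Fin N, |s z i - v (gridPoint y q fun j => z j) i| ≤
      (2 * L / N + κ) * N ^ Fintype.card ι := by
  have hslopes := sum_forwardSlopes_sub_le hq hv hL y N i
  rw [mul_comm, ← le_div_iff₀ (Nat.cast_pos.2 hN)] at hslopes
  calc _ ≤ ∑ z : ι → Fin N, (κ + (forwardSlopes f q (gridPoint y q fun j => z j) i -
          v (gridPoint y q fun j => z j) i)) := by
        gcongr with z
        -- The second difference is nonnegative, so the absolute value can be dropped.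
        have hle := (hv (gridPoint y q fun j => z j)).apply_le_forwardSlopes hq i
        have hsz := abs_le.1 (hs z)
        exact abs_le.2 ⟨by linarith, by linarith⟩
    _ ≤ κ * N ^ Fintype.card ι + 2 * L * N ^ Fintype.card ι / N := by
        rw [Finset.sum_add_distrib]
        gcongr
        simp [mul_comm]
    _ = (2 * L / N + κ) * N ^ Fintype.card ι := by ring

theorem grid_average_le (hq : 0 < q) (hv : ∀ x, IsSubgradientAt f (v x) x)
    (hL : ∀ x, ‖v x‖ ≤ L) (y : EuclideanSpace ℝ ι) {N : ℕ} (hN : 0 < N)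
    {s : (ι → Fin N) → EuclideanSpace ℝ ι}
    (hs : ∀ z i, |s z i - forwardSlopes f q (gridPoint y q fun j => z j) i| ≤ κ)
    {F : (ι → Fin N) → ℝ} {a b : ℝ} (hb : 0 ≤ b)
    (hF : ∀ z, F z ≤ a + (∑ i, |s z i - v (gridPoint y q fun j => z j) i|) * b) :
    (∑ z, F z) / N ^ Fintype.card ι ≤ a + Fintype.card ι * (2 * L / N + κ) * b := by
  have hcard : (0 : ℝ) < N ^ Fintype.card ι := by positivity
  rw [div_le_iff₀ hcard]
  calc _ ≤ ∑ z : ι → Fin N, (a + (∑ i, |s z i - v (gridPoint y q fun j => z j) i|) * b) :=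
        Finset.sum_le_sum fun z _ => hF z
    _ = a * N ^ Fintype.card ι +
        (∑ i, ∑ z : ι → Fin N, |s z i - v (gridPoint y q fun j => z j) i|) * b := by
        rw [Finset.sum_add_distrib, ← Finset.sum_mul, Finset.sum_comm]
        simp [mul_comm]
    _ ≤ a * N ^ Fintype.card ι + (∑ _i : ι, (2 * L / N + κ) * N ^ Fintype.card ι) * b := by
        gcongr with i
        exact sum_abs_sub_subgradient_le hq hv hL y hN fun z => hs z i
    _ = (a + Fintype.card ι * (2 * L / N + κ) * b) * N ^ Fintype.card ι := by
        rw [Finset.sum_const, Finset.card_univ, nsmul_eq_mul]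
        ring

theorem grid_average_inner_le (hq : 0 < q) (hv : ∀ x, IsSubgradientAt f (v x) x)
    (hL : ∀ x, ‖v x‖ ≤ L) (y : EuclideanSpace ℝ ι) {N : ℕ} (hN : 0 < N)
    {s : (ι → Fin N) → EuclideanSpace ℝ ι}
    (hs : ∀ z i, |s z i - forwardSlopes f q (gridPoint y q fun j => z j) i| ≤ κ)
    (u : EuclideanSpace ℝ ι) :
    (∑ z, inner ℝ (s z) (u - y)) / N ^ Fintype.card ι ≤
      f u - f y + 2 * L * (q * (Fintype.card ι * N)) +
        Fintype.card ι * (2 * L / N + κ) * ‖u - y‖ := by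
  refine grid_average_le hq hv hL y hN hs (norm_nonneg _) fun z => ?_
  refine ((hv _).inner_le_of_norm_sub_le (hv y) (hL _) (hL y)
    (norm_gridPoint_sub_le y hq.le z) (s z) u).trans ?_
  gcongr
  exact norm_le_sum_abs _

theorem grid_average_norm_sq_le (hL0 : 0 ≤ L) (hκ : 0 ≤ κ) (hq : 0 < q)
    (hv : ∀ x, IsSubgradientAt f (v x) x) (hL : ∀ x, ‖v x‖ ≤ L)
    (y : EuclideanSpace ℝ ι) {N : ℕ} (hN : 0 < N) {s : (ι → Fin N) → EuclideanSpace ℝ ι}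
    (hs : ∀ z i, |s z i - forwardSlopes f q (gridPoint y q fun j => z j) i| ≤ κ) :
    (∑ z, ‖s z‖ ^ 2) / N ^ Fintype.card ι ≤
      L ^ 2 + Fintype.card ι * (2 * L / N + κ) * (2 * L + κ) := by
  refine grid_average_le hq hv hL y hN hs (by positivity) fun z => ?_
  refine (norm_sq_le_add_sum_abs_sub_mul (v := v (gridPoint y q fun j => z j)) (c := 2 * L + κ)
    fun i => ?_).trans (by gcongr; exact hL _)
  calc |s z i + v (gridPoint y q fun j => z j) i|
      = |(s z i - forwardSlopes f q (gridPoint y q fun j => z j) i) +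
          forwardSlopes f q (gridPoint y q fun j => z j) i +
          v (gridPoint y q fun j => z j) i| := by rw [sub_add_cancel]
    _ ≤ κ + L + L := (abs_add_three _ _ _).trans
        (add_le_add_three (hs z i) (abs_forwardSlopes_le hq hv hL _ i)
          ((PiLp.norm_apply_le _ i).trans (hL _)))
    _ = 2 * L + κ := by ring

end Grid

/-! ### Bisection -/

section Bisection

variable {E : Type} [NormedAddCommGroup E]

/-- The number of bisection steps after which the interval `[1, max 1 (‖y‖ / r)]` is shorter than
`δ`. -/
noncomputable def bisectSteps (r δ : ℝ) (y : E) : ℕ := Nat.clog 2 ⌈‖y‖ / (r * δ)⌉₊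

theorem bisectSteps_le {r δ X : ℝ} (hX : 1 ≤ X) {y : E} (hy : ‖y‖ / (r * δ) ≤ X) :
    (bisectSteps r δ y : ℝ) ≤ 2 * Real.log X + 2 := by
  have hceil : (⌈X⌉₊ : ℝ) ≤ 2 * X := (Nat.ceil_lt_add_one (zero_le_one.trans hX)).le.trans
    (by linarith)
  have : (0 : ℝ) < ⌈X⌉₊ := (zero_lt_one.trans_le hX).trans_le (Nat.le_ceil X)
  have hlogb : Real.logb 2 (2 * X) ≤ 2 * Real.log X + 1 := by
    rw [Real.logb_mul two_ne_zero (by positivity), Real.logb_self_eq_one one_lt_two, add_comm,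
      Real.logb, div_eq_inv_mul]
    gcongr
    · exact Real.log_nonneg hX
    · rw [inv_le_comm₀ (Real.log_pos one_lt_two) two_pos]
      linarith [Real.log_two_gt_d9]
  calc (bisectSteps r δ y : ℝ) ≤ Nat.clog 2 ⌈X⌉₊ := by
        exact_mod_cast Nat.clog_mono_right 2 (Nat.ceil_mono hy)
    _ = ⌈Real.logb 2 ⌈X⌉₊⌉₊ := by rw [← Real.natCeil_logb_natCast, Nat.cast_ofNat]
    _ ≤ Real.logb 2 (2 * X) + 1 := by
        refine (Nat.ceil_lt_add_one (Real.logb_nonneg one_lt_two ?_)).le.trans ?_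
        · exact hX.trans (Nat.le_ceil X)
        · gcongr
          exact one_lt_two
    _ ≤ 2 * Real.log X + 2 := by linarith

variable [InnerProductSpace ℝ E]

/-- Bisection with `n` membership queries for `γ(y)`, which is supposed to lie in `[a, b]`. The
upper end point is returned, so that the result scales `y` into the domain. -/
noncomputable def bisect (y : E) : ℕ → ℝ → ℝ → OracleComp E ℝ
  | 0, _, b => .pure b
  | n + 1, a, b => .query (((a + b) / 2)⁻¹ • y) fun ans =>
      if ans then bisect y n a ((a + b) / 2) else bisect y n ((a + b) / 2) b

theorem maxCalls_bisect (O : E → Bool) (y : E) (n : ℕ) (a b : ℝ) :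
    (bisect y n a b).maxCalls O = n := by
  induction n generalizing a b with
  | zero => rfl
  | succ n ih =>
    simp only [bisect, OracleComp.maxCalls]
    split <;> rw [ih]

variable {K : Set E} {r : ℝ}

open Topology in
theorem bisect_returns (hK : Convex ℝ K) (h0 : K ∈ 𝓝 0) {y : E} (n : ℕ) {a b : ℝ} (ha1 : 1 ≤ a)
    (hab : a ≤ b) (ha : a ≤ gauge1 K y) (hb : b⁻¹ • y ∈ K) :
    ∃ c, (bisect y n a b).Returns (memOracle K) c ∧ 1 ≤ c ∧ c⁻¹ • y ∈ K ∧
      |c - gauge1 K y| ≤ (b - a) / 2 ^ n := by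
  induction n generalizing a b with
  | zero =>
    have hle := gauge1_le (ha1.trans hab) hb
    refine ⟨b, .pure b, ha1.trans hab, hb, ?_⟩
    rw [pow_zero, div_one, abs_of_nonneg (sub_nonneg.2 hle)]
    gcongr
  | succ n ih =>
    by_cases hmid : ((a + b) / 2)⁻¹ • y ∈ K
    · obtain ⟨c, hc, hc1, hcK, herr⟩ := ih ha1 (by linarith) ha hmid
      refine ⟨c, ?_, hc1, hcK, herr.trans_eq (by rw [pow_succ]; field_simp; ring)⟩
      simpa only [OracleComp.Returns, bisect, OracleComp.support, OracleComp.expect, memOracle,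
        hmid, decide_true, if_true] using hc
    · obtain ⟨c, hc, hc1, hcK, herr⟩ := ih (a := (a + b) / 2) (by linarith) (by linarith)
        (le_gauge1_of_inv_smul_notMem hK h0 hmid) hb
      refine ⟨c, ?_, hc1, hcK, herr.trans_eq (by rw [pow_succ]; field_simp; ring)⟩
      simpa only [OracleComp.Returns, bisect, OracleComp.support, OracleComp.expect, memOracle,
        hmid, decide_false, Bool.false_eq_true, if_false] using hc

/-- Approximation of `γ(y)` up to `δ` for a domain that contains the ball of radius `r`. -/
noncomputable def approxGauge (r δ : ℝ) (y : E) : OracleComp E ℝ :=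
  bisect y (bisectSteps r δ y) 1 (max 1 (‖y‖ / r))

theorem maxCalls_approxGauge (O : E → Bool) (r δ : ℝ) (y : E) :
    (approxGauge r δ y).maxCalls O = bisectSteps r δ y :=
  maxCalls_bisect O y _ _ _

theorem approxGauge_returns (hK : Convex ℝ K) (hr : 0 < r) (hball : Metric.closedBall 0 r ⊆ K)
    {δ : ℝ} (hδ : 0 < δ) (y : E) :
    ∃ c, (approxGauge r δ y).Returns (memOracle K) c ∧ 1 ≤ c ∧ c⁻¹ • y ∈ K ∧
      |c - gauge1 K y| ≤ δ := by
  have h0 := Filter.mem_of_superset (Metric.closedBall_mem_nhds 0 hr) hball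
  obtain ⟨c, hc, hc1, hcK, herr⟩ := bisect_returns hK h0 (bisectSteps r δ y) le_rfl
    (le_max_left _ _) (one_le_gauge1 hK h0 y) (inv_smul_mem_of_norm_le hball
      (c := max 1 (‖y‖ / r)) (by positivity) ((div_le_iff₀ hr).1 (le_max_right _ _)))
  refine ⟨c, hc, hc1, hcK, herr.trans ?_⟩
  have hsteps : ‖y‖ / (r * δ) ≤ 2 ^ bisectSteps r δ y :=
    (Nat.le_ceil _).trans (by exact_mod_cast Nat.le_pow_clog one_lt_two _)
  rw [div_le_iff₀ (by positivity), sub_le_iff_le_add]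
  refine max_le (le_add_of_nonneg_left (by positivity)) (le_add_of_le_of_nonneg ?_ zero_le_one)
  rwa [← div_div, div_le_iff₀ hδ, mul_comm] at hsteps

end Bisection

/-! ### The randomized gradient estimate -/

section Estimate

variable {d : ℕ}

/-- Indices of grid points as outcomes of a single uniform draw. -/
noncomputable def gridIndex (d M : ℕ) : Fin ((M + 1) ^ d - 1 + 1) ≃ (Fin d → Fin (M + 1)) :=
  (finCongr (Nat.sub_add_cancel (Nat.one_le_pow d (M + 1) M.succ_pos))).trans
    finFunctionFinEquiv.symm

/-- Forward differences of the approximate regularization at `x`: an approximation of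
`forwardSlopes (gauge1 K) q x`. -/
noncomputable def forwardDiff (r δ q : ℝ) (x : EuclideanSpace ℝ (Fin d)) :
    OracleComp (EuclideanSpace ℝ (Fin d)) (EuclideanSpace ℝ (Fin d)) :=
  (approxGauge r δ x).bind fun c =>
    (OracleComp.traverse (fun i => approxGauge r δ (x + q • EuclideanSpace.single i 1))
      (List.finRange d)).bind fun cs =>
        .pure (WithLp.toLp 2 fun i => (cs.getD i 0 - c) / q)

/-- Forward differences at a uniformly random point of the grid with `M + 1` points in each
direction. -/
noncomputable def gridEstimate (r δ q : ℝ) (M : ℕ) (y : EuclideanSpace ℝ (Fin d)) :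
    OracleComp (EuclideanSpace ℝ (Fin d)) (EuclideanSpace ℝ (Fin d)) :=
  .rand ((M + 1) ^ d - 1) fun i => forwardDiff r δ q (gridPoint y q fun j => gridIndex d M i j)

variable {K : Set (EuclideanSpace ℝ (Fin d))} {r δ q : ℝ}

theorem exists_subgradient_gauge1 (hK : Convex ℝ K) (hr : 0 < r)
    (hball : Metric.closedBall 0 r ⊆ K) (x : EuclideanSpace ℝ (Fin d)) :
    ∃ v, IsSubgradientAt (gauge1 K) v x ∧ ‖v‖ ≤ 1 / r := by
  have hlip := abs_gauge1_sub_le hK hr hball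
  have hr' : 0 ≤ 1 / r := by positivity
  have hcont : Continuous (gauge1 K) := by
    refine (LipschitzWith.of_dist_le' (K := 1 / r) fun x y => ?_).continuous
    rw [Real.dist_eq, dist_eq_norm]
    exact hlip x y
  obtain ⟨v, hv⟩ := exists_subgradient (convexOn_gauge1 hK
    (Filter.mem_of_superset (Metric.closedBall_mem_nhds 0 hr) hball)) hcont x
  exact ⟨v, hv, hv.norm_le hr' fun u => sub_le_iff_le_add'.1 ((le_abs_self _).trans (hlip u x))⟩

theorem forwardDiff_returns (hK : Convex ℝ K) (hr : 0 < r) (hball : Metric.closedBall 0 r ⊆ K)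
    (hδ : 0 < δ) (hq : 0 < q) (x : EuclideanSpace ℝ (Fin d)) :
    ∃ s : EuclideanSpace ℝ (Fin d), (forwardDiff r δ q x).Returns (memOracle K) s ∧
      ∀ i, |s i - forwardSlopes (gauge1 K) q x i| ≤ 2 * δ / q := by
  choose g hg _ _ hgerr using approxGauge_returns hK hr hball hδ
  refine ⟨forwardSlopes g q x, (hg x).bind (.bind (.traverse (fun i => hg _) _) ?_),
    fun i => ?_⟩
  · simpa [forwardSlopes] using
      OracleComp.Returns.pure (O := memOracle K) (forwardSlopes g q x)
  · have hstep := abs_le.1 (hgerr (x + q • EuclideanSpace.single i 1))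
    have hbase := abs_le.1 (hgerr x)
    simp only [forwardSlopes]
    rw [← sub_div, abs_div, abs_of_pos hq]
    gcongr
    exact abs_le.2 ⟨by linarith, by linarith⟩

theorem maxCalls_forwardDiff_le {O : EuclideanSpace ℝ (Fin d) → Bool}
    {x : EuclideanSpace ℝ (Fin d)} {c : ℕ} (hx : bisectSteps r δ x ≤ c)
    (hstep : ∀ i : Fin d, bisectSteps r δ (x + q • EuclideanSpace.single i 1) ≤ c) :
    (forwardDiff r δ q x).maxCalls O ≤ (d + 1) * c := by
  have htraverse := OracleComp.maxCalls_traverse_le (O := O) (l := List.finRange d) (c := c)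
    (f := fun i => approxGauge r δ (x + q • EuclideanSpace.single i 1))
    fun i _ => (maxCalls_approxGauge O _ _ _).trans_le (hstep i)
  rw [List.length_finRange] at htraverse
  refine (OracleComp.maxCalls_bind_le ((maxCalls_approxGauge O _ _ _).trans_le hx)
    fun b _ => ?_).trans_eq (by ring : c + d * c = (d + 1) * c)
  exact OracleComp.maxCalls_bind_le (b := 0) htraverse fun _ _ => le_rfl

theorem expect_gridEstimate {O : EuclideanSpace ℝ (Fin d) → Bool}
    {s : EuclideanSpace ℝ (Fin d) → EuclideanSpace ℝ (Fin d)}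
    (hs : ∀ x, (forwardDiff r δ q x).Returns O (s x)) (M : ℕ) (y : EuclideanSpace ℝ (Fin d))
    (F : EuclideanSpace ℝ (Fin d) → ℝ) :
    (gridEstimate r δ q M y).expect O F =
      (∑ z : Fin d → Fin (M + 1), F (s (gridPoint y q fun j => z j))) / (M + 1 : ℕ) ^ d := by
  simp only [gridEstimate, OracleComp.expect, (hs _).2]
  rw [Equiv.sum_comp (gridIndex d M) fun z => F (s (gridPoint y q fun j => z j))]
  congr 1
  exact_mod_cast Nat.sub_add_cancel (Nat.one_le_pow d (M + 1) M.succ_pos)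

theorem expect_gridEstimate_inner_le (hK : Convex ℝ K) (hr : 0 < r)
    (hball : Metric.closedBall 0 r ⊆ K) (hδ : 0 < δ) (hq : 0 < q) (M : ℕ)
    (y u : EuclideanSpace ℝ (Fin d)) :
    (gridEstimate r δ q M y).expect (memOracle K) (fun s => inner ℝ s (u - y)) ≤
      gauge1 K u - gauge1 K y + 2 * (1 / r) * (q * (d * (M + 1 : ℕ))) +
        d * (2 * (1 / r) / (M + 1 : ℕ) + 2 * δ / q) * ‖u - y‖ := by
  choose v hv hL using exists_subgradient_gauge1 hK hr hball
  choose s hs hserr using forwardDiff_returns hK hr hball hδ hq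
  rw [expect_gridEstimate hs]
  simpa only [Fintype.card_fin] using
    grid_average_inner_le hq hv hL y M.succ_pos (fun z i => hserr _ i) u

theorem expect_gridEstimate_norm_sq_le (hK : Convex ℝ K) (hr : 0 < r)
    (hball : Metric.closedBall 0 r ⊆ K) (hδ : 0 < δ) (hq : 0 < q) (M : ℕ)
    (y : EuclideanSpace ℝ (Fin d)) :
    (gridEstimate r δ q M y).expect (memOracle K) (fun s => ‖s‖ ^ 2) ≤
      (1 / r) ^ 2 + d * (2 * (1 / r) / (M + 1 : ℕ) + 2 * δ / q) * (2 * (1 / r) + 2 * δ / q) := by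
  choose v hv hL using exists_subgradient_gauge1 hK hr hball
  choose s hs hserr using forwardDiff_returns hK hr hball hδ hq
  rw [expect_gridEstimate hs]
  simpa only [Fintype.card_fin] using grid_average_norm_sq_le (by positivity) (by positivity) hq
    hv hL y M.succ_pos fun z i => hserr _ i

theorem norm_le_of_mem_support_gridEstimate (hK : Convex ℝ K) (hr : 0 < r)
    (hball : Metric.closedBall 0 r ⊆ K) (hδ : 0 < δ) (hq : 0 < q) {M : ℕ}
    {y s : EuclideanSpace ℝ (Fin d)} (hs : s ∈ (gridEstimate r δ q M y).support (memOracle K)) :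
    ‖s‖ ≤ d * (1 / r + 2 * δ / q) := by
  choose v hv hL using exists_subgradient_gauge1 hK hr hball
  choose g hg hgerr using forwardDiff_returns hK hr hball hδ hq
  simp only [gridEstimate, OracleComp.support, (hg _).1, Set.mem_iUnion,
    Set.mem_singleton_iff] at hs
  obtain ⟨k, rfl⟩ := hs
  refine (norm_le_sum_abs _).trans ((Finset.sum_le_card_nsmul _ _ _ fun i _ => ?_).trans_eq
    (by rw [Finset.card_univ, Fintype.card_fin, nsmul_eq_mul]))
  refine (abs_sub_abs_le_abs_sub _ _).trans (hgerr _ i) |> sub_le_iff_le_add.1 |>.trans ?_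
  rw [add_comm]
  gcongr
  exact abs_forwardSlopes_le hq hv hL _ i

theorem maxCalls_gridEstimate_le {O : EuclideanSpace ℝ (Fin d) → Bool} {X : ℝ} {M : ℕ}
    (hr : 0 < r) (hδ : 0 < δ) (hq : 0 < q) (hX : 1 ≤ X) {y : EuclideanSpace ℝ (Fin d)}
    (hy : (‖y‖ + q * (d * (M + 1 : ℕ)) + q) / (r * δ) ≤ X) :
    ((gridEstimate r δ q M y).maxCalls O : ℝ) ≤ (d + 1) * (2 * Real.log X + 2) := by
  have hsteps : ∀ x : EuclideanSpace ℝ (Fin d), ‖x‖ ≤ ‖y‖ + q * (d * (M + 1 : ℕ)) + q →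
      bisectSteps r δ x ≤ ⌊2 * Real.log X + 2⌋₊ := fun x hx =>
    Nat.le_floor (bisectSteps_le hX (le_trans (by gcongr) hy))
  have hcalls : (gridEstimate r δ q M y).maxCalls O ≤ (d + 1) * ⌊2 * Real.log X + 2⌋₊ := by
    refine Finset.sup_le fun k _ => ?_
    have hgrid : ‖gridPoint y q fun j => gridIndex d M k j‖ ≤ ‖y‖ + q * (d * (M + 1 : ℕ)) := by
      refine (norm_le_norm_add_norm_sub' _ y).trans ?_
      gcongr
      simpa only [Fintype.card_fin] using norm_gridPoint_sub_le y hq.le (gridIndex d M k)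
    refine maxCalls_forwardDiff_le (hsteps _ (by linarith)) fun i => hsteps _ ?_
    refine (norm_add_le _ _).trans (add_le_add hgrid ?_)
    rw [norm_smul, Real.norm_of_nonneg hq.le, PiLp.norm_single, norm_one, mul_one]
  calc ((gridEstimate r δ q M y).maxCalls O : ℝ)
      ≤ (d + 1) * ⌊2 * Real.log X + 2⌋₊ := by exact_mod_cast hcalls
    _ ≤ (d + 1) * (2 * Real.log X + 2) := by
      gcongr
      exact Nat.floor_le (by linarith [Real.log_nonneg hX])

end Estimate

/-! ### Precision parameters and the subroutines -/

/-- The grid size for which averaging over the grid costs at most a fraction of `θ`. -/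
noncomputable def gridSize (d : ℕ) (r θ : ℝ) : ℕ := ⌈8 * (d + 1) * (1 + 1 / r) / θ⌉₊

/-- The mesh for which moving by the side of the grid costs at most `θ / 2`. -/
noncomputable def gridMesh (d : ℕ) (r θ : ℝ) : ℝ :=
  θ / (4 * (d + 1) * (1 + 1 / r) * (gridSize d r θ + 1 : ℕ))

/-- The admissible error of forward differences for the precision `θ`. -/
noncomputable def diffError (d : ℕ) (r θ : ℝ) : ℝ := θ / (8 * (d + 1) * (1 + r))

/-- The precision of function values that makes the error of forward differences with step
`gridMesh d r θ` equal to `diffError d r θ`. -/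
noncomputable def valueError (d : ℕ) (r θ : ℝ) : ℝ := diffError d r θ * gridMesh d r θ / 2

section Parameters

variable {d : ℕ} {r θ : ℝ}

theorem gridMesh_pos (hr : 0 < r) (hθ : 0 < θ) : 0 < gridMesh d r θ := by
  unfold gridMesh
  positivity

theorem diffError_pos (hr : 0 < r) (hθ : 0 < θ) : 0 < diffError d r θ := by
  unfold diffError
  positivity

theorem valueError_pos (hr : 0 < r) (hθ : 0 < θ) : 0 < valueError d r θ := by
  have hmesh := gridMesh_pos (d := d) hr hθ
  have hdiff := diffError_pos (d := d) hr hθ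
  unfold valueError
  positivity

theorem two_mul_valueError_div_gridMesh (hr : 0 < r) (hθ : 0 < θ) :
    2 * valueError d r θ / gridMesh d r θ = diffError d r θ := by
  rw [valueError, mul_div_cancel₀ _ two_ne_zero,
    mul_div_cancel_right₀ _ (gridMesh_pos hr hθ).ne']

theorem le_mul_gridSize (hθ : 0 < θ) :
    8 * (d + 1) * (1 + 1 / r) ≤ θ * (gridSize d r θ + 1 : ℕ) := by
  rw [mul_comm θ, ← div_le_iff₀ hθ]
  exact (Nat.le_ceil _).trans (Nat.cast_le.2 (Nat.le_succ (gridSize d r θ)))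

theorem gridMesh_mul_side_le (hr : 0 < r) (hθ : 0 < θ) :
    2 * (1 / r) * (gridMesh d r θ * (d * (gridSize d r θ + 1 : ℕ))) ≤ θ / 2 := by
  calc _ = θ / 2 * ((1 / r) / (1 + 1 / r)) * (d / (d + 1)) := by
        unfold gridMesh
        field_simp
        ring
    _ ≤ θ / 2 * 1 * 1 := by
        gcongr
        · exact div_le_one_of_le₀ (by linarith) (by positivity)
        · exact div_le_one_of_le₀ (by linarith) (by positivity)
    _ = θ / 2 := by ring

theorem grad_error_le (hr : 0 < r) (hθ : 0 < θ) :
    (d + 1) * (2 * (1 / r) / (gridSize d r θ + 1 : ℕ) + diffError d r θ) ≤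
      3 / 8 * (θ * min 1 (1 / r)) := by
  have hsize : 2 * (1 / r) / (gridSize d r θ + 1 : ℕ) ≤ θ * min 1 (1 / r) / (4 * (d + 1)) := by
    have h := le_mul_gridSize (d := d) (r := r) hθ
    have hmin : 1 / r ≤ min 1 (1 / r) * (1 + 1 / r) := by
      have hinv : 0 < 1 / r := by positivity
      rcases min_cases 1 (1 / r) with ⟨h, -⟩ | ⟨h, -⟩ <;> rw [h] <;> nlinarith
    rw [div_le_div_iff₀ (by positivity) (by positivity)]
    calc 2 * (1 / r) * (4 * ((d : ℝ) + 1)) ≤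
          2 * (min 1 (1 / r) * (1 + 1 / r)) * (4 * ((d : ℝ) + 1)) := by gcongr
      _ = min 1 (1 / r) * (8 * (d + 1) * (1 + 1 / r)) := by ring
      _ ≤ min 1 (1 / r) * (θ * (gridSize d r θ + 1 : ℕ)) := by gcongr
      _ = θ * min 1 (1 / r) * (gridSize d r θ + 1 : ℕ) := by ring
  have hdiff : diffError d r θ ≤ θ * min 1 (1 / r) / (8 * (d + 1)) := by
    have hmin : 1 / (1 + r) ≤ min 1 (1 / r) :=
      le_min (div_le_one_of_le₀ (by linarith) (by positivity))
        (one_div_le_one_div_of_le hr (by linarith))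
    calc diffError d r θ = θ * (1 / (1 + r)) / (8 * (d + 1)) := by
          unfold diffError
          field_simp
      _ ≤ θ * min 1 (1 / r) / (8 * (d + 1)) := by gcongr
  calc _ ≤ ((d : ℝ) + 1) *
        (θ * min 1 (1 / r) / (4 * (d + 1)) + θ * min 1 (1 / r) / (8 * (d + 1))) := by gcongr
    _ = 3 / 8 * (θ * min 1 (1 / r)) := by
        field_simp
        norm_num

theorem diffError_le (hr : 0 < r) (hθ : 0 < θ) :
    diffError d r θ ≤ 3 / 8 * (θ * min 1 (1 / r)) := by
  refine le_trans ?_ (grad_error_le (d := d) hr hθ)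
  have hdiff := diffError_pos (d := d) hr hθ
  calc diffError d r θ ≤ ((d : ℝ) + 1) * diffError d r θ :=
        le_mul_of_one_le_left hdiff.le (by linarith [d.cast_nonneg (α := ℝ)])
    _ ≤ _ := by
        gcongr
        exact le_add_of_nonneg_left (by positivity)

theorem gridMesh_mul_side_add_le (hr : 0 < r) (hθ : 0 < θ) :
    gridMesh d r θ * (d * (gridSize d r θ + 1 : ℕ)) + gridMesh d r θ ≤ θ := by
  have hmesh := gridMesh_pos (d := d) hr hθ
  calc _ ≤ gridMesh d r θ * ((d + 1) * (gridSize d r θ + 1 : ℕ)) := by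
        rw [add_one_mul (d : ℝ), mul_add]
        gcongr
        refine le_mul_of_one_le_right hmesh.le ?_
        exact_mod_cast Nat.succ_pos _
    _ = θ / (4 * (1 + 1 / r)) := by
        unfold gridMesh
        field_simp
    _ ≤ θ := by
        refine div_le_self hθ.le ?_
        linarith [one_div_pos.2 hr]

theorem valueError_le (hr : 0 < r) (hθ : 0 < θ) (hθ1 : θ ≤ 1) : valueError d r θ ≤ θ := by
  have hmesh := gridMesh_pos (d := d) hr hθ
  have hmeshθ : gridMesh d r θ ≤ θ :=
    (le_add_of_nonneg_left (by positivity)).trans (gridMesh_mul_side_add_le (d := d) hr hθ)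
  have hdiff : diffError d r θ ≤ 1 := by
    refine (diffError_le hr hθ).trans ?_
    calc 3 / 8 * (θ * min 1 (1 / r)) ≤ 3 / 8 * (1 * 1) := by
          gcongr
          exact min_le_left _ _
      _ ≤ 1 := by norm_num
  calc valueError d r θ ≤ 1 * gridMesh d r θ / 2 := by
        unfold valueError
        gcongr
    _ ≤ θ := by linarith

/-- The factor in front of `(1 / θ) ^ 3` in the bound on the reciprocal precision. -/
noncomputable def precisionConst (d : ℕ) (r : ℝ) : ℝ :=
  640 * (d + 1) ^ 3 * (1 + r) * (1 + 1 / r) ^ 2 / r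

theorem gridSize_succ_le (hr : 0 < r) (hθ : 0 < θ) (hθ1 : θ ≤ 1) :
    ((gridSize d r θ + 1 : ℕ) : ℝ) ≤ 10 * (d + 1) * (1 + 1 / r) / θ := by
  have hceil : (gridSize d r θ : ℝ) ≤ 8 * (d + 1) * (1 + 1 / r) / θ + 1 :=
    (Nat.ceil_lt_add_one (by positivity)).le
  have hone : 1 ≤ (d + 1) * (1 + 1 / r) / θ := by
    rw [one_le_div hθ]
    refine hθ1.trans (one_le_mul_of_one_le_of_one_le ?_ ?_)
    · linarith [d.cast_nonneg (α := ℝ)]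
    · linarith [one_div_pos.2 hr]
  calc ((gridSize d r θ + 1 : ℕ) : ℝ) ≤ 8 * (d + 1) * (1 + 1 / r) / θ + 1 + 1 := by
        push_cast
        gcongr
    _ ≤ 8 * (d + 1) * (1 + 1 / r) / θ + 2 * ((d + 1) * (1 + 1 / r) / θ) := by linarith
    _ = 10 * (d + 1) * (1 + 1 / r) / θ := by ring

theorem inv_valueError_le (hr : 0 < r) (hθ : 0 < θ) (hθ1 : θ ≤ 1) :
    1 / (r * valueError d r θ) ≤ precisionConst d r * (1 / θ) ^ 3 := by
  calc 1 / (r * valueError d r θ) = 64 * (d + 1) ^ 2 * (1 + r) * (1 + 1 / r) / r *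
        (1 / θ) ^ 2 * (gridSize d r θ + 1 : ℕ) := by
        unfold valueError diffError gridMesh
        field_simp
        ring
    _ ≤ 64 * (d + 1) ^ 2 * (1 + r) * (1 + 1 / r) / r *
        (1 / θ) ^ 2 * (10 * (d + 1) * (1 + 1 / r) / θ) := by
        gcongr
        exact gridSize_succ_le hr hθ hθ1
    _ = precisionConst d r * (1 / θ) ^ 3 := by
        unfold precisionConst
        field_simp
        ring

end Parameters

section GradEstimate

variable {d : ℕ} {r θ : ℝ} {K : Set (EuclideanSpace ℝ (Fin d))}

/-- The estimate of a subgradient of `γ` with precision `θ`. -/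
noncomputable def gradEstimate (r θ : ℝ) (y : EuclideanSpace ℝ (Fin d)) :
    OracleComp (EuclideanSpace ℝ (Fin d)) (EuclideanSpace ℝ (Fin d)) :=
  gridEstimate r (valueError d r θ) (gridMesh d r θ) (gridSize d r θ) y

theorem gradEstimate_isSubgradient (hK : Convex ℝ K) (hr : 0 < r)
    (hball : Metric.closedBall 0 r ⊆ K) (hθ : 0 < θ) (y u : EuclideanSpace ℝ (Fin d)) :
    gauge1 K y + (gradEstimate r θ y).expect (memOracle K) (fun s => inner ℝ s (u - y)) -
      θ * (1 + ‖u - y‖) ≤ gauge1 K u := by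
  have h := expect_gridEstimate_inner_le hK hr hball (valueError_pos (d := d) hr hθ)
    (gridMesh_pos (d := d) hr hθ) (gridSize d r θ) y u
  rw [two_mul_valueError_div_gridMesh hr hθ] at h
  have herr : d * (2 * (1 / r) / (gridSize d r θ + 1 : ℕ) + diffError d r θ) ≤ θ := by
    have hdiff := diffError_pos (d := d) hr hθ
    calc _ ≤ (d + 1) * (2 * (1 / r) / (gridSize d r θ + 1 : ℕ) + diffError d r θ) := by
          gcongr
          exact le_add_of_nonneg_right zero_le_one
      _ ≤ 3 / 8 * (θ * min 1 (1 / r)) := grad_error_le hr hθ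
      _ ≤ 3 / 8 * (θ * 1) := by
          gcongr
          exact min_le_left _ _
      _ ≤ θ := by linarith
  have hside := gridMesh_mul_side_le (d := d) hr hθ
  have herru := mul_le_mul_of_nonneg_right herr (norm_nonneg (u - y))
  simp only [gradEstimate]
  linarith

theorem expect_gradEstimate_norm_sq_le (hK : Convex ℝ K) (hr : 0 < r)
    (hball : Metric.closedBall 0 r ⊆ K) (hθ : 0 < θ) (hθ1 : θ ≤ 1)
    (y : EuclideanSpace ℝ (Fin d)) :
    (gradEstimate r θ y).expect (memOracle K) (fun s => ‖s‖ ^ 2) ≤ 2 / r ^ 2 := by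
  have h := expect_gridEstimate_norm_sq_le hK hr hball (valueError_pos (d := d) hr hθ)
    (gridMesh_pos (d := d) hr hθ) (gridSize d r θ) y
  rw [two_mul_valueError_div_gridMesh hr hθ] at h
  have hdiff0 := diffError_pos (d := d) hr hθ
  have hmin : 3 / 8 * (θ * min 1 (1 / r)) ≤ 3 / 8 * (1 / r) := by
    gcongr
    exact (mul_le_of_le_one_left (by positivity) hθ1).trans (min_le_right _ _)
  have hdiff := (diffError_le (d := d) hr hθ).trans hmin
  have herr : d * (2 * (1 / r) / (gridSize d r θ + 1 : ℕ) + diffError d r θ) ≤ 3 / 8 * (1 / r) :=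
    (mul_le_mul_of_nonneg_right (le_add_of_nonneg_right zero_le_one) (by positivity)).trans
      ((grad_error_le hr hθ).trans hmin)
  calc _ ≤ (1 / r) ^ 2 + 3 / 8 * (1 / r) * (2 * (1 / r) + 3 / 8 * (1 / r)) :=
        h.trans (by gcongr)
    _ = 121 / 64 / r ^ 2 := by
        field_simp
        norm_num
    _ ≤ 2 / r ^ 2 := by
        gcongr
        norm_num

theorem norm_le_of_mem_support_gradEstimate (hK : Convex ℝ K) (hr : 0 < r)
    (hball : Metric.closedBall 0 r ⊆ K) (hθ : 0 < θ) (hθ1 : θ ≤ 1)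
    {y s : EuclideanSpace ℝ (Fin d)} (hs : s ∈ (gradEstimate r θ y).support (memOracle K)) :
    ‖s‖ ≤ d * (2 / r) := by
  have h := norm_le_of_mem_support_gridEstimate hK hr hball (valueError_pos (d := d) hr hθ)
    (gridMesh_pos (d := d) hr hθ) hs
  rw [two_mul_valueError_div_gridMesh hr hθ] at h
  have hdiff : diffError d r θ ≤ 1 / r := by
    refine (diffError_le hr hθ).trans ?_
    calc 3 / 8 * (θ * min 1 (1 / r)) ≤ 1 * (1 * (1 / r)) := by
          gcongr
          · norm_num
          · exact min_le_right _ _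
      _ = 1 / r := by ring
  calc ‖s‖ ≤ d * (1 / r + 1 / r) := h.trans (by gcongr)
    _ = d * (2 / r) := by ring

end GradEstimate

/-- The precision of the gradient estimates for the horizon `H`. The base algorithm with horizon
`H` stays within distance `A H` of its start, so the factor `1 + A` absorbs `‖u - y‖` in the error
term of `Subroutines.IsGood.subgrad_spec`. -/
noncomputable def gradPrecision (A : ℝ) (H : ℕ) : ℝ := 1 / ((H : ℝ) ^ 2 * (1 + A))

theorem gradPrecision_pos {A : ℝ} (hA : 0 ≤ A) {H : ℕ} (hH : 1 ≤ H) : 0 < gradPrecision A H := by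
  unfold gradPrecision
  positivity

theorem gradPrecision_le {A : ℝ} (hA : 0 ≤ A) (H : ℕ) : gradPrecision A H ≤ 1 / (H : ℝ) ^ 2 := by
  unfold gradPrecision
  rw [← div_div]
  exact div_le_self (by positivity) (by linarith)

theorem gradPrecision_le_one {A : ℝ} (hA : 0 ≤ A) {H : ℕ} (hH : 1 ≤ H) :
    gradPrecision A H ≤ 1 :=
  (gradPrecision_le hA H).trans
    (div_le_one_of_le₀ (one_le_pow₀ (by exact_mod_cast hH)) (by positivity))

/-- The properties of the subroutines with horizon `H` on which the analysis is based. The number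
`A` bounds the speed of the base algorithm, in units of its step size. Besides the required
approximation quality this asks for a smaller bias of the gradient estimates and, near the
starting points, for a number of queries that is logarithmic in `H`. -/
structure Subroutines.IsGood {E : Type} [NormedAddCommGroup E] [InnerProductSpace ℝ E]
    (sub : Subroutines E) (K : Set E) (r D A B : ℝ) (H : ℕ) : Prop where
  approx : sub.IsApprox K r H (1 / (H : ℝ) ^ 2)
  subgrad_spec : ∀ y u : E,
    gauge1 K y + (sub.subgrad H y).expect (memOracle K) (fun s => inner ℝ s (u - y))
      - gradPrecision A H * (1 + ‖u - y‖) ≤ gauge1 K u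
  norm_le : ∀ y, ∀ s ∈ (sub.subgrad H y).support (memOracle K), r * (1 + 3 * D * ‖s‖) ≤ A
  calls_value : ∀ y, ‖y‖ ≤ 2 * A * H →
    ((sub.value H y).maxCalls (memOracle K) : ℝ) ≤ B * (1 + Real.log H)
  calls_subgrad : ∀ y, ‖y‖ ≤ 2 * A * H →
    ((sub.subgrad H y).maxCalls (memOracle K) : ℝ) ≤ B * (1 + Real.log H)

/-- Bisection for the values of `γ`, and forward differences at random grid points for its
subgradients, with horizon-dependent precision. -/
noncomputable def gridSubroutines (d : ℕ) (r A : ℝ) : Subroutines (EuclideanSpace ℝ (Fin d)) where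
  value H y := approxGauge r (valueError d r (gradPrecision A H)) y
  subgrad H y := gradEstimate r (gradPrecision A H) y

/-- The constant `C` such that the subroutines bisect intervals of relative length at most
`C * H ^ 7`. -/
noncomputable def bisectConst (d : ℕ) (r A : ℝ) : ℝ :=
  1 + (2 * A + 1) * (precisionConst d r * (1 + A) ^ 3)

/-- The constant in front of `1 + log H` in the bound on the number of queries. -/
noncomputable def callConst (d : ℕ) (r A : ℝ) : ℝ :=
  (d + 1) * (2 * Real.log (bisectConst d r A) + 16)

section Subroutines

variable {d : ℕ} {r A : ℝ}

theorem one_le_bisectConst (hr : 0 < r) (hA : 0 ≤ A) : 1 ≤ bisectConst d r A := by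
  unfold bisectConst precisionConst
  exact le_add_of_nonneg_right (by positivity)

theorem callConst_nonneg (hr : 0 < r) (hA : 0 ≤ A) : 0 ≤ callConst d r A := by
  have := Real.log_nonneg (one_le_bisectConst (d := d) hr hA)
  unfold callConst
  positivity

theorem div_valueError_le (hr : 0 < r) (hA : 0 ≤ A) {H : ℕ} (hH : 1 ≤ H)
    {y : EuclideanSpace ℝ (Fin d)} (hy : ‖y‖ ≤ 2 * A * H) :
    (‖y‖ + gridMesh d r (gradPrecision A H) * (d * (gridSize d r (gradPrecision A H) + 1 : ℕ)) +
      gridMesh d r (gradPrecision A H)) / (r * valueError d r (gradPrecision A H)) ≤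
      bisectConst d r A * (H : ℝ) ^ 7 := by
  have hH' : (1 : ℝ) ≤ H := by exact_mod_cast hH
  have hθ := gradPrecision_pos hA hH
  have hθ1 := gradPrecision_le_one hA hH
  have hmesh := gridMesh_mul_side_add_le (d := d) hr hθ
  have hdelta := valueError_pos (d := d) hr hθ
  have : 0 ≤ precisionConst d r := by unfold precisionConst; positivity
  calc _ ≤ (2 * A + 1) * H * (1 / (r * valueError d r (gradPrecision A H))) := by
        rw [← mul_one_div]
        gcongr
        linarith
    _ ≤ (2 * A + 1) * H * (precisionConst d r * (1 / gradPrecision A H) ^ 3) := by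
        gcongr
        exact inv_valueError_le hr hθ hθ1
    _ = (2 * A + 1) * (precisionConst d r * (1 + A) ^ 3) * (H : ℝ) ^ 7 := by
        rw [gradPrecision, one_div_one_div]
        ring
    _ ≤ bisectConst d r A * (H : ℝ) ^ 7 := by
        gcongr
        exact le_add_of_nonneg_left zero_le_one

theorem two_mul_log_bisectConst_le (hr : 0 < r) (hA : 0 ≤ A) {H : ℕ} (hH : 1 ≤ H) :
    (d + 1) * (2 * Real.log (bisectConst d r A * (H : ℝ) ^ 7) + 2) ≤
      callConst d r A * (1 + Real.log H) := by
  have hC := one_le_bisectConst (d := d) hr hA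
  have hlogC := Real.log_nonneg hC
  have hlogH := Real.log_natCast_nonneg H
  have hprod := mul_nonneg hlogC hlogH
  rw [callConst, mul_assoc, Real.log_mul (by positivity) (by positivity), Real.log_pow]
  gcongr
  push_cast
  linarith

theorem maxCalls_gridSubroutines_value_le (O : EuclideanSpace ℝ (Fin d) → Bool) (hr : 0 < r)
    (hA : 0 ≤ A) {H : ℕ} (hH : 1 ≤ H) {y : EuclideanSpace ℝ (Fin d)} (hy : ‖y‖ ≤ 2 * A * H) :
    (((gridSubroutines d r A).value H y).maxCalls O : ℝ) ≤
      callConst d r A * (1 + Real.log H) := by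
  have hC : 1 ≤ bisectConst d r A * (H : ℝ) ^ 7 := one_le_mul_of_one_le_of_one_le
    (one_le_bisectConst hr hA) (one_le_pow₀ (by exact_mod_cast hH))
  have hmesh := gridMesh_pos (d := d) hr (gradPrecision_pos hA hH)
  have hdelta := valueError_pos (d := d) hr (gradPrecision_pos hA hH)
  have hdiv : ‖y‖ / (r * valueError d r (gradPrecision A H)) ≤
      bisectConst d r A * (H : ℝ) ^ 7 := by
    refine le_trans ?_ (div_valueError_le hr hA hH hy)
    gcongr
    rw [add_assoc]
    exact le_add_of_nonneg_right (by positivity)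
  simp only [gridSubroutines, maxCalls_approxGauge]
  refine (bisectSteps_le hC hdiv).trans (le_trans ?_ (two_mul_log_bisectConst_le hr hA hH))
  exact le_mul_of_one_le_left (by linarith [Real.log_nonneg hC])
    (by linarith [d.cast_nonneg (α := ℝ)])

theorem maxCalls_gridSubroutines_subgrad_le (O : EuclideanSpace ℝ (Fin d) → Bool) (hr : 0 < r)
    (hA : 0 ≤ A) {H : ℕ} (hH : 1 ≤ H) {y : EuclideanSpace ℝ (Fin d)} (hy : ‖y‖ ≤ 2 * A * H) :
    (((gridSubroutines d r A).subgrad H y).maxCalls O : ℝ) ≤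
      callConst d r A * (1 + Real.log H) := by
  have hC : 1 ≤ bisectConst d r A * (H : ℝ) ^ 7 := one_le_mul_of_one_le_of_one_le
    (one_le_bisectConst hr hA) (one_le_pow₀ (by exact_mod_cast hH))
  have hθ := gradPrecision_pos hA hH
  exact (maxCalls_gridEstimate_le hr (valueError_pos hr hθ) (gridMesh_pos hr hθ) hC
    (div_valueError_le hr hA hH hy)).trans (two_mul_log_bisectConst_le hr hA hH)

variable {D : ℝ} {K : Set (EuclideanSpace ℝ (Fin d))}

theorem gridSubroutines_isApprox (hK : Convex ℝ K) (hr : 0 < r)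
    (hball : Metric.closedBall 0 r ⊆ K) (hA : 0 ≤ A) {H : ℕ} (hH : 1 ≤ H) :
    (gridSubroutines d r A).IsApprox K r H (1 / (H : ℝ) ^ 2) where
  value_spec y c hc := by
    have hθ := gradPrecision_pos hA hH
    obtain ⟨c', hc', hone, hmem, herr⟩ :=
      approxGauge_returns hK hr hball (valueError_pos hr hθ) y
    obtain rfl : c = c' := by
      rwa [gridSubroutines, hc'.1, Set.mem_singleton_iff] at hc
    exact ⟨hone, hmem, herr.trans ((valueError_le hr hθ (gradPrecision_le_one hA hH)).trans
      (gradPrecision_le hA H))⟩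
  subgrad_spec y u := by
    refine le_trans ?_
      (gradEstimate_isSubgradient hK hr hball (gradPrecision_pos hA hH) y u)
    gcongr
    · exact le_rfl
    · exact gradPrecision_le hA H
  subgrad_sq y := expect_gradEstimate_norm_sq_le hK hr hball (gradPrecision_pos hA hH)
    (gradPrecision_le_one hA hH) y

theorem gridSubroutines_isGood (hK : Convex ℝ K) (hr : 0 < r)
    (hball : Metric.closedBall 0 r ⊆ K) (hD : 0 ≤ D) (hA : r + 6 * d * D ≤ A) {H : ℕ}
    (hH : 1 ≤ H) : (gridSubroutines d r A).IsGood K r D A (callConst d r A) H := by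
  have hA0 : 0 ≤ A := le_trans (by positivity) hA
  exact {
    approx := gridSubroutines_isApprox hK hr hball hA0 hH
    subgrad_spec :=
      gradEstimate_isSubgradient hK hr hball (gradPrecision_pos hA0 hH)
    norm_le := fun y s hs => by
      have hs' := norm_le_of_mem_support_gradEstimate hK hr hball (gradPrecision_pos hA0 hH)
        (gradPrecision_le_one hA0 hH) hs
      calc r * (1 + 3 * D * ‖s‖) ≤ r * (1 + 3 * D * (d * (2 / r))) := by gcongr
        _ = r + 6 * d * D := by
          field_simp
          ring
        _ ≤ A := hA
    calls_value := fun y hy => maxCalls_gridSubroutines_value_le _ hr hA0 hH hy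
    calls_subgrad := fun y hy => maxCalls_gridSubroutines_subgrad_le _ hr hA0 hH hy }

end Subroutines

open OracleComp

/-! ### The recorded run -/

section Lists

variable {α β κ : Type*} {R : α → β → Prop} {l : List α} {l' : List β}

theorem exists_mem_left_of_forall₂ (h : List.Forall₂ R l l') {b : β} (hb : b ∈ l') :
    ∃ a ∈ l, R a b := by
  obtain ⟨i, hi, rfl⟩ := List.getElem_of_mem hb
  exact ⟨l[i]'(h.length_eq ▸ hi), List.getElem_mem _, h.get _ _⟩

theorem map_eq_map_of_forall₂ {γ : Type*} {f : α → γ} {g : β → γ}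
    (hfg : ∀ a b, R a b → f a = g b) (h : List.Forall₂ R l l') : l.map f = l'.map g := by
  rw [← List.forall₂_eq_eq_eq, List.forall₂_map_left_iff, List.forall₂_map_right_iff]
  exact h.imp hfg

variable [DecidableEq κ]

theorem exists_find?_of_forall₂ {key : α → κ} {key' : β → κ} (hkey : ∀ a b, R a b → key' b = key a)
    {i : κ} (h : List.Forall₂ R l l') {a : α}
    (ha : l.find? (fun a => decide (key a = i)) = some a) :
    ∃ b, l'.find? (fun b => decide (key' b = i)) = some b ∧ R a b := by
  induction h with
  | nil => simp at ha
  | @cons a' b' _ _ hab _ ih =>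
    rw [List.find?_cons] at ha ⊢
    rw [hkey _ _ hab]
    by_cases ha' : key a' = i
    · simp only [ha', decide_true, Option.some.injEq] at ha ⊢
      subst ha
      exact ⟨b', rfl, hab⟩
    · simp only [ha', decide_false] at ha ⊢
      exact ih ha

theorem sum_find?_le {key : α → κ} {g : α → ℝ} (a₀ : α) (hg : ∀ a ∈ l, 0 ≤ g a) (S : Finset κ)
    (hS : ∀ i ∈ S, (l.find? fun a => decide (key a = i)).isSome) :
    ∑ i ∈ S, g ((l.find? fun a => decide (key a = i)).getD a₀) ≤ (l.map g).sum := by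
  induction l generalizing S with
  | nil =>
    obtain rfl : S = ∅ := Finset.eq_empty_of_forall_notMem fun i hi => by simpa using hS i hi
    simp
  | cons a l ih =>
    have hne : ∀ i ∈ S.erase (key a), ((a :: l).find? fun b => decide (key b = i)) =
        l.find? fun b => decide (key b = i) := fun i hi =>
      List.find?_cons_of_neg (by simpa using (Finset.ne_of_mem_erase hi).symm)
    have htail : ∑ i ∈ S.erase (key a), g (((a :: l).find? fun b => decide (key b = i)).getD a₀) ≤
        (l.map g).sum := by
      rw [Finset.sum_congr rfl fun i hi => by rw [hne i hi]]
      exact ih (fun b hb => hg b (List.mem_cons_of_mem _ hb)) _ fun i hi =>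
        hne i hi ▸ hS i (Finset.mem_of_mem_erase hi)
    have hhead := hg a List.mem_cons_self
    rw [List.map_cons, List.sum_cons]
    by_cases ha : key a ∈ S
    · rw [← Finset.add_sum_erase _ _ ha, List.find?_cons_of_pos (by simp), Option.getD_some]
      gcongr
    · rw [Finset.erase_eq_of_notMem ha] at htail
      linarith

theorem find?_filter_append {key : α → κ} {q : α → Bool} {i : κ} {a : α}
    (hq : ∀ b, key b = i → q b = true) (ha : l.find? (fun b => decide (key b = i)) = some a)
    (m : List α) : (l.filter q ++ m).find? (fun b => decide (key b = i)) = some a := by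
  have hfilter : (fun b => decide (q b = true ∧ decide (key b = i) = true)) =
      fun b => decide (key b = i) :=
    funext fun b => decide_eq_decide.2 (by simpa using hq b)
  rw [List.find?_append, List.find?_filter, hfilter, ha, Option.some_or]

end Lists

section Trace

variable {E : Type} [NormedAddCommGroup E] [InnerProductSpace ℝ E] {sub : Subroutines E}
  {p : Params E} {adv : Adversary E} {O : E → Bool}

/-- The algorithm with a record of the states after all rounds so far. -/
noncomputable def trace (sub : Subroutines E) (p : Params E) (adv : Adversary E) :
    ℕ → OracleComp E (ℕ → State E)
  | 0 => .pure fun _ => initState p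
  | n + 1 => (trace sub p adv n).bind fun h =>
      (round sub p adv (n + 1) (h n)).bind fun σ => .pure (Function.update h (n + 1) σ)

theorem expect_run (n : ℕ) (F : State E → ℝ) :
    (run sub p adv n).expect O F = (trace sub p adv n).expect O fun h => F (h n) := by
  induction n generalizing F with
  | zero => rfl
  | succ n ih => simp only [run, trace, expect_bind, ih, expect_pure, Function.update_self]

theorem exists_trace_of_mem_support_run {n : ℕ} {σ : State E}
    (hσ : σ ∈ (run sub p adv n).support O) : ∃ h ∈ (trace sub p adv n).support O, h n = σ := by
  induction n generalizing σ with
  | zero => exact ⟨fun _ => initState p, rfl, (mem_support_pure.1 hσ).symm⟩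
  | succ n ih =>
    simp only [run, mem_support_bind] at hσ
    obtain ⟨τ, hτ, hσ⟩ := hσ
    obtain ⟨h, hh, rfl⟩ := ih hτ
    refine ⟨Function.update h (n + 1) σ, ?_, by simp⟩
    simp only [trace, mem_support_bind, mem_support_pure]
    exact ⟨h, hh, σ, hσ, rfl⟩

theorem trace_zero_of_mem_support {n : ℕ} {h : ℕ → State E}
    (hh : h ∈ (trace sub p adv n).support O) : h 0 = initState p := by
  induction n generalizing h with
  | zero => rw [mem_support_pure.1 hh]
  | succ n ih =>
    simp only [trace, mem_support_bind, mem_support_pure] at hh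
    obtain ⟨g, hg, σ, -, rfl⟩ := hh
    simp [ih hg]

theorem trace_succ_of_mem_support {n : ℕ} {h : ℕ → State E}
    (hh : h ∈ (trace sub p adv n).support O) {i : ℕ} (hi : i < n) :
    h (i + 1) ∈ (round sub p adv (i + 1) (h i)).support O := by
  induction n generalizing h with
  | zero => omega
  | succ n ih =>
    simp only [trace, mem_support_bind, mem_support_pure] at hh
    obtain ⟨g, hg, σ, hσ, rfl⟩ := hh
    rcases Nat.lt_succ_iff_lt_or_eq.1 hi with hi' | rfl
    · rw [Function.update_of_ne (by omega), Function.update_of_ne (by omega)]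
      exact ih hg hi'
    · rw [Function.update_self, Function.update_of_ne (by omega)]
      exact hσ

theorem expect_trace_of_le {m n : ℕ} (hmn : m ≤ n) {F : (ℕ → State E) → ℝ}
    (hF : DependsOn F (Set.Iic m)) :
    (trace sub p adv n).expect O F = (trace sub p adv m).expect O F := by
  induction n, hmn using Nat.le_induction with
  | base => rfl
  | succ n hn ih =>
    simp only [trace, expect_bind, expect_pure]
    rw [← ih]
    refine expect_congr fun h _ => (expect_congr fun σ _ => ?_).trans (expect_const _ _)
    exact hF fun j hj => Function.update_of_ne (by grind) _ _

theorem expect_trace_succ {i n : ℕ} (hi : i < n) {Φ : (ℕ → State E) → State E → ℝ}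
    (hΦ : DependsOn Φ (Set.Iic i)) :
    (trace sub p adv n).expect O (fun h => Φ h (h (i + 1))) =
      (trace sub p adv n).expect O fun h =>
        (round sub p adv (i + 1) (h i)).expect O (Φ h) := by
  rw [expect_trace_of_le (m := i + 1) hi, expect_trace_of_le (m := i) (n := n) hi.le]
  · simp only [trace, expect_bind, expect_pure, Function.update_self]
    refine expect_congr fun h _ => expect_congr fun σ _ => congrFun (hΦ fun j hj => ?_) σ
    exact Function.update_of_ne (by grind) _ _
  · intro h h' hh
    dsimp only
    rw [hΦ hh, hh i (Set.mem_Iic.2 le_rfl)]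
  · intro h h' hh
    dsimp only
    rw [hΦ fun j hj => hh j (Set.mem_Iic.2 (Nat.le_succ_of_le hj)),
      hh (i + 1) (Set.mem_Iic.2 le_rfl)]

end Trace

/-- The identity of an expert. -/
def Expert.key {E : Type} (e : Expert E) : ℕ × ℕ := (e.birth, e.lvl)

theorem alive_of_key_eq {E : Type} {ε : ℝ} {t : ℕ} {κ : ℕ × ℕ} (hκ : t + 1 < κ.1 + 4 * len ε κ.2)
    (e : Expert E) (he : e.key = κ) : t + 1 < e.birth + 4 * len ε e.lvl := by
  subst he
  exact hκ

section Experts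

variable {E : Type} [NormedAddCommGroup E] [InnerProductSpace ℝ E] {sub : Subroutines E}
  {p : Params E} {adv : Adversary E} {O : E → Bool}

/-- The record of the expert with identity `κ`. -/
noncomputable def State.find? (σ : State E) (κ : ℕ × ℕ) : Option (Expert E) :=
  σ.experts.find? fun e => decide (e.key = κ)

/-- The record of the expert with identity `κ`, with a junk value if it is not active. -/
noncomputable def State.expert (σ : State E) (κ : ℕ × ℕ) : Expert E :=
  (σ.find? κ).getD ⟨0, 0, 0, 0, 0⟩

/-- The point played in the round that follows the state `σ`. -/
noncomputable abbrev State.play (σ : State E) : E := playPoint σ.experts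

/-- The loss of the round that follows the state `σ`. -/
noncomputable def State.loss (adv : Adversary E) (σ : State E) : Loss E :=
  adv (σ.plays ++ [σ.play])

/-- The step size of an expert at level `k`. -/
noncomputable def stepSize (p : Params E) (k : ℕ) : ℝ := p.r / (2 * √(len p.ε k) * p.G)

/-- The point to which an expert moves from `y` if `s` is the estimated subgradient. -/
noncomputable def nextPoint (p : Params E) (k : ℕ) (f : Loss E) (y s : E) : E :=
  y - stepSize p k • (f.grad y + (3 * p.G * p.D) • s)

/-- The weight factor of an expert. -/
noncomputable def weightFactor (p : Params E) (k : ℕ) (f : Loss E) (x x' : E) : ℝ :=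
  1 + rate p.ε p.T k * ((f.val x - f.val x') / (p.G * p.D))

theorem mem_support_updateExpert {x : E} {f : Loss E} {e e' : Expert E}
    (h : e' ∈ (updateExpert sub p x f e).support O) :
    ∃ s ∈ (sub.subgrad (4 * len p.ε e.lvl) e.y).support O,
      ∃ c ∈ (sub.value (4 * len p.ε e.lvl) (nextPoint p e.lvl f e.y s)).support O,
        e' = ⟨e.birth, e.lvl, c⁻¹ • nextPoint p e.lvl f e.y s, nextPoint p e.lvl f e.y s,
          e.w * weightFactor p e.lvl f x e.x⟩ := by
  simp only [updateExpert, baseStep, mem_support_bind, mem_support_pure] at h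
  obtain ⟨z, ⟨s, hs, c, hc, rfl⟩, rfl⟩ := h
  exact ⟨s, hs, c, hc, rfl⟩

theorem key_of_mem_support_updateExpert {x : E} {f : Loss E} {e e' : Expert E}
    (h : e' ∈ (updateExpert sub p x f e).support O) : e'.key = e.key := by
  obtain ⟨s, -, c, -, rfl⟩ := mem_support_updateExpert h
  rfl

theorem expect_updateExpert_y {x : E} {f : Loss E} {e : Expert E} (F : E → ℝ) :
    (updateExpert sub p x f e).expect O (fun e' => F e'.y) =
      (sub.subgrad (4 * len p.ε e.lvl) e.y).expect O fun s => F (nextPoint p e.lvl f e.y s) := by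
  simp only [updateExpert, baseStep, expect_bind, expect_pure, expect_const]
  rfl

open Classical in
theorem mem_support_round {t : ℕ} {σ σ' : State E}
    (h : σ' ∈ (round sub p adv t σ).support O) :
    ∃ es, List.Forall₂ (fun e e' =>
        e' ∈ (updateExpert sub p (σ.play) (σ.loss adv) e).support O) σ.experts es ∧
      σ' = ⟨(es.filter fun e => decide (t + 1 < e.birth + 4 * len p.ε e.lvl)) ++ spawn p (t + 1),
        σ.plays ++ [σ.play]⟩ := by
  simp only [round, mem_support_bind, mem_support_pure] at h
  obtain ⟨es, hes, rfl⟩ := h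
  exact ⟨es, forall₂_of_mem_support_traverse hes, rfl⟩

theorem find?_of_mem_support_round {t : ℕ} {σ σ' : State E}
    (h : σ' ∈ (round sub p adv t σ).support O) {κ : ℕ × ℕ}
    (hκ : t + 1 < κ.1 + 4 * len p.ε κ.2) {e : Expert E} (he : σ.find? κ = some e) :
    ∃ e', σ'.find? κ = some e' ∧
      e' ∈ (updateExpert sub p (σ.play) (σ.loss adv) e).support O := by
  obtain ⟨es, hes, rfl⟩ := mem_support_round h
  unfold State.find? at he
  obtain ⟨e', he', h'⟩ := exists_find?_of_forall₂ (key := Expert.key) (key' := Expert.key)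
    (fun _ _ => key_of_mem_support_updateExpert) hes he
  refine ⟨e', ?_, h'⟩
  unfold State.find?
  exact find?_filter_append (fun e h => decide_eq_true (alive_of_key_eq hκ e h)) he' _

theorem expect_round_expert {t : ℕ} {σ : State E} {κ : ℕ × ℕ}
    (hκ : t + 1 < κ.1 + 4 * len p.ε κ.2) {e : Expert E} (he : σ.find? κ = some e)
    (F : Expert E → ℝ) :
    (round sub p adv t σ).expect O (fun σ' => F (σ'.expert κ)) =
      (updateExpert sub p (σ.play) (σ.loss adv) e).expect O F := by
  have hfind := expect_traverse_find? (O := O)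
    (f := updateExpert sub p (σ.play) (σ.loss adv)) (key := Expert.key)
    (fun _ _ => key_of_mem_support_updateExpert) σ.experts κ
    fun o => F (o.getD ⟨0, 0, 0, 0, 0⟩)
  unfold State.find? at he
  rw [he] at hfind
  refine Eq.trans ?_ hfind
  simp only [round, expect_bind, expect_pure]
  refine expect_congr fun es hes => ?_
  obtain ⟨e', he', -⟩ := exists_find?_of_forall₂ (key := Expert.key) (key' := Expert.key)
    (fun _ _ => key_of_mem_support_updateExpert) (forall₂_of_mem_support_traverse hes) he
  unfold State.expert State.find?
  dsimp only
  rw [he', find?_filter_append (fun e h => decide_eq_true (alive_of_key_eq hκ e h)) he' _]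

end Experts

/-! ### Invariants of the algorithm -/

section Parameters

variable {E : Type}

theorem one_le_len (ε : ℝ) (k : ℕ) : 1 ≤ len ε k := Nat.le_add_left _ _

theorem len_pos (ε : ℝ) (k : ℕ) : (0 : ℝ) < len ε k := by exact_mod_cast one_le_len ε k

theorem one_le_four_mul_len (ε : ℝ) (k : ℕ) : 1 ≤ 4 * len ε k := by
  have := one_le_len ε k
  omega

theorem rate_pos {T : ℕ} (hT : 2 ≤ T) (ε : ℝ) (k : ℕ) : 0 < rate ε T k :=
  lt_min (by norm_num)
    (Real.sqrt_pos.2 (div_pos (Real.log_pos (by exact_mod_cast hT)) (len_pos ε k)))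

theorem rate_le_half (ε : ℝ) (T k : ℕ) : rate ε T k ≤ 1 / 2 := min_le_left _ _

theorem nodup_levels (ε : ℝ) (T : ℕ) : (levels ε T).Nodup := List.nodup_range.filter _

theorem sum_weights_pos {es : List (Expert E)} (hes : es ≠ []) (hw : ∀ e ∈ es, 0 < e.w) :
    0 < ∑ i : Fin es.length, es[i].w := by
  have : Nonempty (Fin es.length) := ⟨⟨0, List.length_pos_iff.2 hes⟩⟩
  exact Finset.sum_pos (fun i _ => hw _ (List.getElem_mem _)) Finset.univ_nonempty

theorem mem_spawn {p : Params E} {j : ℕ} {e : Expert E} :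
    e ∈ spawn p j ↔ ∃ k ∈ levels p.ε p.T, len p.ε k ∣ j - 1 ∧
      e = ⟨j, k, p.x₁, p.y₁, rate p.ε p.T k⟩ := by
  simp only [spawn, List.mem_map, List.mem_filter, decide_eq_true_eq, and_assoc, @eq_comm _ _ e]

theorem length_spawn_le (p : Params E) (j : ℕ) :
    (spawn p j).length ≤ (levels p.ε p.T).length := by
  rw [spawn, List.length_map]
  exact List.length_filter_le _ _

theorem nodup_spawn_keys (p : Params E) (j : ℕ) : ((spawn p j).map Expert.key).Nodup := by
  rw [spawn, List.map_map]
  refine ((nodup_levels p.ε p.T).filter _).map fun k k' h => ?_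
  simpa [Expert.key] using h

end Parameters

section PlayPoint

variable {E : Type} [NormedAddCommGroup E] [InnerProductSpace ℝ E] {es : List (Expert E)}

theorem playPoint_eq_centerMass (es : List (Expert E)) :
    playPoint es = Finset.univ.centerMass (fun i : Fin es.length => es[i].w) fun i => es[i].x := by
  simp only [playPoint, Finset.centerMass, ← Fin.sum_univ_fun_getElem, Finset.smul_sum, smul_smul,
    div_eq_inv_mul, Fin.getElem_fin]

theorem playPoint_mem {K : Set E} (hK : Convex ℝ K) (h0 : (0 : E) ∈ K) (hw : ∀ e ∈ es, 0 < e.w)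
    (hx : ∀ e ∈ es, e.x ∈ K) : playPoint es ∈ K := by
  rcases eq_or_ne es [] with rfl | hes
  · exact h0
  rw [playPoint_eq_centerMass]
  exact hK.centerMass_mem (fun i _ => (hw _ (List.getElem_mem _)).le) (sum_weights_pos hes hw)
    fun i _ => hx _ (List.getElem_mem _)

theorem sum_weight_mul_sub_nonpos {f : E → ℝ} (hf : ConvexOn ℝ Set.univ f)
    (hw : ∀ e ∈ es, 0 < e.w) : (es.map fun e => e.w * (f (playPoint es) - f e.x)).sum ≤ 0 := by
  rcases eq_or_ne es [] with rfl | hes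
  · simp
  have hW := sum_weights_pos hes hw
  have hjensen := hf.map_centerMass_le (t := Finset.univ) (w := fun i : Fin es.length => es[i].w)
    (p := fun i => es[i].x) (fun i _ => (hw _ (List.getElem_mem _)).le) hW fun _ _ => trivial
  rw [← playPoint_eq_centerMass, Finset.centerMass, smul_eq_mul, ← div_eq_inv_mul, le_div_iff₀ hW,
    mul_comm, Finset.sum_mul] at hjensen
  rw [← Fin.sum_univ_fun_getElem es fun e => e.w * (f (playPoint es) - f e.x)]
  simpa only [mul_sub, Finset.sum_sub_distrib, ← Finset.sum_mul, mul_comm, sub_nonpos,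
    Fin.getElem_fin, Function.comp, smul_eq_mul] using hjensen

end PlayPoint

section Invariants

variable {E : Type} [NormedAddCommGroup E] [InnerProductSpace ℝ E]

/-- The standing assumptions of the analysis. The constants `A` and `B` are those of
`Subroutines.IsGood`. -/
structure Setting (sub : Subroutines E) (p : Params E) (adv : Adversary E) (K : Set E)
    (A B : ℝ) : Prop where
  convex : Convex ℝ K
  r_pos : 0 < p.r
  ball : Metric.closedBall 0 p.r ⊆ K
  diam : ∀ x ∈ K, ∀ y ∈ K, dist x y ≤ p.D
  one_le_D : 1 ≤ p.D
  one_le_G : 1 ≤ p.G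
  eps_pos : 0 < p.ε
  three_le_T : 3 ≤ p.T
  x₁_mem : p.x₁ ∈ K
  y₁_mem : p.y₁ ∈ K
  admissible : ∀ h, (adv h).IsAdmissible K p.G
  good : ∀ H : ℕ, 1 ≤ H → sub.IsGood K p.r p.D A B H
  D_le : p.D ≤ A

variable {sub : Subroutines E} {p : Params E} {adv : Adversary E} {K : Set E} {A B : ℝ}

namespace Setting

theorem mem_nhds (S : Setting sub p adv K A B) : K ∈ nhds (0 : E) :=
  Filter.mem_of_superset (Metric.closedBall_mem_nhds 0 S.r_pos) S.ball

theorem zero_mem (S : Setting sub p adv K A B) : (0 : E) ∈ K := mem_of_mem_nhds S.mem_nhds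

theorem D_pos (S : Setting sub p adv K A B) : 0 < p.D := zero_lt_one.trans_le S.one_le_D

theorem G_pos (S : Setting sub p adv K A B) : 0 < p.G := zero_lt_one.trans_le S.one_le_G

theorem A_pos (S : Setting sub p adv K A B) : 0 < A := S.D_pos.trans_le S.D_le

theorem norm_sub_le (S : Setting sub p adv K A B) {x y : E} (hx : x ∈ K) (hy : y ∈ K) :
    ‖x - y‖ ≤ p.D := by
  rw [← dist_eq_norm]
  exact S.diam x hx y hy

theorem norm_le (S : Setting sub p adv K A B) {x : E} (hx : x ∈ K) : ‖x‖ ≤ p.D := by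
  simpa using S.norm_sub_le hx S.zero_mem

theorem isSubgradientAt_grad (S : Setting sub p adv K A B) (h : List E) (y : E) :
    IsSubgradientAt (adv h).val ((adv h).grad y) y :=
  (S.admissible h).subgradient y

theorem loss_sub_le (S : Setting sub p adv K A B) (h : List E) (x y : E) :
    (adv h).val x - (adv h).val y ≤ p.G * ‖x - y‖ :=
  (abs_le.1 ((S.admissible h).lipschitz x y)).2

theorem norm_grad_le (S : Setting sub p adv K A B) (h : List E) (y : E) :
    ‖(adv h).grad y‖ ≤ p.G :=
  (S.isSubgradientAt_grad h y).norm_le S.G_pos.le fun u => by linarith [S.loss_sub_le h u y]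

theorem abs_loss_sub_le (S : Setting sub p adv K A B) (h : List E) {x y : E} (hx : x ∈ K)
    (hy : y ∈ K) : |(adv h).val x - (adv h).val y| ≤ p.G * p.D :=
  ((S.admissible h).lipschitz x y).trans
    (mul_le_mul_of_nonneg_left (S.norm_sub_le hx hy) S.G_pos.le)

theorem abs_scaled_loss_sub_le_one (S : Setting sub p adv K A B) (h : List E) {x y : E}
    (hx : x ∈ K) (hy : y ∈ K) : |((adv h).val x - (adv h).val y) / (p.G * p.D)| ≤ 1 := by
  have hGD : 0 < p.G * p.D := mul_pos S.G_pos S.D_pos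
  rw [abs_div, abs_of_pos hGD, div_le_one hGD]
  exact S.abs_loss_sub_le h hx hy

theorem rate_pos (S : Setting sub p adv K A B) (k : ℕ) : 0 < rate p.ε p.T k :=
  ProjFree.rate_pos ((Nat.le_succ 2).trans S.three_le_T) p.ε k

theorem weightFactor_pos (S : Setting sub p adv K A B) (h : List E) {x y : E} (hx : x ∈ K)
    (hy : y ∈ K) (k : ℕ) : 0 < weightFactor p k (adv h) x y := by
  have hloss := (abs_le.1 (S.abs_scaled_loss_sub_le_one h hx hy)).1
  have hrate := S.rate_pos k
  have hhalf := rate_le_half p.ε p.T k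
  unfold weightFactor
  nlinarith

theorem stepSize_pos (S : Setting sub p adv K A B) (k : ℕ) : 0 < stepSize p k :=
  div_pos S.r_pos (mul_pos (mul_pos two_pos (Real.sqrt_pos.2 (len_pos p.ε k))) S.G_pos)

theorem norm_nextPoint_sub_le (S : Setting sub p adv K A B) (k : ℕ) (h : List E) (y s : E) :
    ‖nextPoint p k (adv h) y s - y‖ ≤ p.r * (1 + 3 * p.D * ‖s‖) / (2 * √(len p.ε k)) := by
  have hsqrt : 0 < √(len p.ε k : ℝ) := Real.sqrt_pos.2 (len_pos p.ε k)
  have hG := S.G_pos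
  have hD := S.D_pos
  have hgrad : ‖(adv h).grad y + (3 * p.G * p.D) • s‖ ≤ p.G + 3 * p.G * p.D * ‖s‖ := by
    refine (norm_add_le _ _).trans (add_le_add (S.norm_grad_le h y) ?_)
    rw [norm_smul, Real.norm_of_nonneg (by positivity)]
  rw [nextPoint, sub_sub_cancel_left, norm_neg, norm_smul,
    Real.norm_of_nonneg (S.stepSize_pos k).le]
  refine (mul_le_mul_of_nonneg_left hgrad (S.stepSize_pos k).le).trans_eq ?_
  unfold stepSize
  field_simp

theorem norm_nextPoint_sub_le_of_mem_support (S : Setting sub p adv K A B) (k : ℕ) (h : List E)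
    {y s : E} (hs : s ∈ (sub.subgrad (4 * len p.ε k) y).support (memOracle K)) :
    ‖nextPoint p k (adv h) y s - y‖ ≤ A := by
  have hsqrt : (1 : ℝ) ≤ √(len p.ε k) := Real.one_le_sqrt.2 (by exact_mod_cast one_le_len p.ε k)
  have hr := S.r_pos
  have hD := S.D_pos
  calc _ ≤ p.r * (1 + 3 * p.D * ‖s‖) / (2 * √(len p.ε k)) := S.norm_nextPoint_sub_le k h y s
    _ ≤ p.r * (1 + 3 * p.D * ‖s‖) := div_le_self (by positivity) (by linarith)
    _ ≤ A := (S.good _ (one_le_four_mul_len p.ε k)).norm_le y s hs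

end Setting

/-- What holds for the active experts after `i` rounds. -/
structure ExpertInv (p : Params E) (K : Set E) (A : ℝ) (i : ℕ) (e : Expert E) : Prop where
  one_le_birth : 1 ≤ e.birth
  birth_le : e.birth ≤ i + 1
  alive : i + 1 < e.birth + 4 * len p.ε e.lvl
  lvl_mem : e.lvl ∈ levels p.ε p.T
  dvd : len p.ε e.lvl ∣ e.birth - 1
  w_pos : 0 < e.w
  x_mem : e.x ∈ K
  norm_y_le : ‖e.y‖ ≤ p.D + ((i : ℝ) + 1 - e.birth) * A

/-- What holds for the states after `i` rounds. -/
structure StateInv (p : Params E) (K : Set E) (A : ℝ) (i : ℕ) (σ : State E) : Prop where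
  expertInv : ∀ e ∈ σ.experts, ExpertInv p K A i e
  nodup : (σ.experts.map Expert.key).Nodup
  plays_mem : ∀ x ∈ σ.plays, x ∈ K
  plays_length : σ.plays.length = i

theorem StateInv.playPoint_mem {i : ℕ} {σ : State E} (h : StateInv p K A i σ) (hK : Convex ℝ K)
    (h0 : (0 : E) ∈ K) : σ.play ∈ K :=
  ProjFree.playPoint_mem hK h0 (fun e he => (h.expertInv e he).w_pos)
    fun e he => (h.expertInv e he).x_mem

namespace Setting

theorem expertInv_of_mem_spawn (S : Setting sub p adv K A B) {i : ℕ} {e : Expert E}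
    (he : e ∈ spawn p (i + 1)) : ExpertInv p K A i e := by
  obtain ⟨k, hk, hdvd, rfl⟩ := mem_spawn.1 he
  have hlen := one_le_len p.ε k
  exact {
    one_le_birth := Nat.le_add_left 1 i
    birth_le := le_rfl
    alive := by dsimp only; omega
    lvl_mem := hk
    dvd := hdvd
    w_pos := S.rate_pos k
    x_mem := S.x₁_mem
    norm_y_le := by simpa using S.norm_le S.y₁_mem }

theorem expertInv_updateExpert (S : Setting sub p adv K A B) {i : ℕ} {e e' : Expert E}
    (he : ExpertInv p K A i e) {h : List E} {x : E} (hx : x ∈ K)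
    (he' : e' ∈ (updateExpert sub p x (adv h) e).support (memOracle K))
    (halive : i + 1 + 1 < e'.birth + 4 * len p.ε e'.lvl) : ExpertInv p K A (i + 1) e' := by
  obtain ⟨s, hs, c, hc, rfl⟩ := mem_support_updateExpert he'
  have hgood := S.good _ (one_le_four_mul_len p.ε e.lvl)
  exact {
    one_le_birth := he.one_le_birth
    birth_le := he.birth_le.trans (Nat.le_succ _)
    alive := halive
    lvl_mem := he.lvl_mem
    dvd := he.dvd
    w_pos := mul_pos he.w_pos (S.weightFactor_pos h hx he.x_mem _)
    x_mem := (hgood.approx.value_spec _ c hc).2.1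
    norm_y_le := by
      have hstep := S.norm_nextPoint_sub_le_of_mem_support e.lvl h hs
      have htriangle := norm_le_norm_add_norm_sub' (nextPoint p e.lvl (adv h) e.y s) e.y
      have hy := he.norm_y_le
      push_cast
      linarith }

theorem stateInv_init (S : Setting sub p adv K A B) : StateInv p K A 0 (initState p) where
  expertInv _ he := S.expertInv_of_mem_spawn he
  nodup := nodup_spawn_keys p 1
  plays_mem := by simp [initState]
  plays_length := rfl

theorem stateInv_round (S : Setting sub p adv K A B) {i : ℕ} {σ σ' : State E}
    (hσ : StateInv p K A i σ)
    (h : σ' ∈ (round sub p adv (i + 1) σ).support (memOracle K)) : StateInv p K A (i + 1) σ' := by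
  obtain ⟨es, hes, rfl⟩ := mem_support_round h
  have hx := hσ.playPoint_mem S.convex S.zero_mem
  have hkeys : σ.experts.map Expert.key = es.map Expert.key :=
    map_eq_map_of_forall₂ (fun _ _ he => (key_of_mem_support_updateExpert he).symm) hes
  have hbirth : ∀ e' ∈ es, e'.birth ≤ i + 1 := by
    intro e' he'
    obtain ⟨e, he, hupdate⟩ := exists_mem_left_of_forall₂ hes he'
    have hkey : e'.birth = e.birth := congrArg Prod.fst (key_of_mem_support_updateExpert hupdate)
    exact hkey ▸ (hσ.expertInv e he).birth_le
  constructor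
  case expertInv =>
    intro e' he'
    rcases List.mem_append.1 he' with he' | he'
    · obtain ⟨he', halive⟩ := List.mem_filter.1 he'
      obtain ⟨e, he, hupdate⟩ := exists_mem_left_of_forall₂ hes he'
      exact S.expertInv_updateExpert (hσ.expertInv e he) hx hupdate (of_decide_eq_true halive)
    · exact S.expertInv_of_mem_spawn he'
  case nodup =>
    rw [List.map_append, List.nodup_append]
    refine ⟨(hkeys ▸ hσ.nodup).sublist (List.filter_sublist.map _), nodup_spawn_keys p _,
      fun a ha b hb hab => ?_⟩
    obtain ⟨e, he, rfl⟩ := List.mem_map.1 ha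
    obtain ⟨e', he', rfl⟩ := List.mem_map.1 hb
    obtain ⟨k, -, -, rfl⟩ := mem_spawn.1 he'
    have hold := hbirth e (List.mem_filter.1 he).1
    have hnew : e.birth = i + 1 + 1 := congrArg Prod.fst hab
    omega
  case plays_mem =>
    simpa only [List.forall_mem_append, List.forall_mem_singleton] using ⟨hσ.plays_mem, hx⟩
  case plays_length => simp only [List.length_append, hσ.plays_length, List.length_singleton]

theorem stateInv_trace (S : Setting sub p adv K A B) {n : ℕ} {h : ℕ → State E}
    (hh : h ∈ (trace sub p adv n).support (memOracle K)) {i : ℕ} (hi : i ≤ n) :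
    StateInv p K A i (h i) := by
  induction i with
  | zero =>
    rw [trace_zero_of_mem_support hh]
    exact S.stateInv_init
  | succ i ih => exact S.stateInv_round (ih (by omega)) (trace_succ_of_mem_support hh (by omega))

end Setting

theorem plays_succ_of_mem_support_trace {O : E → Bool} {n : ℕ} {h : ℕ → State E}
    (hh : h ∈ (trace sub p adv n).support O) {i : ℕ} (hi : i < n) :
    (h (i + 1)).plays = (h i).plays ++ [(h i).play] := by
  obtain ⟨es, -, hround⟩ := mem_support_round (trace_succ_of_mem_support hh hi)
  rw [hround]

end Invariants

section ActiveExperts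

variable {E : Type}

theorem State.mem_of_find? {σ : State E} {κ : ℕ × ℕ} {e : Expert E}
    (h : σ.find? κ = some e) : e ∈ σ.experts ∧ e.key = κ :=
  ⟨List.mem_of_find?_eq_some h, by simpa using List.find?_some h⟩

theorem State.expert_of_find? [NormedAddCommGroup E] {σ : State E} {κ : ℕ × ℕ} {e : Expert E}
    (h : σ.find? κ = some e) : σ.expert κ = e := by
  rw [State.expert, h, Option.getD_some]

/-- The expert of level `k` that is started in round `a + 1` is active after `i` rounds. Its
identity is `(a + 1, k)`. -/
structure IsActive (p : Params E) (a k i : ℕ) : Prop where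
  lvl_mem : k ∈ levels p.ε p.T
  dvd : len p.ε k ∣ a
  le : a ≤ i
  lt_end : i < a + 4 * len p.ε k

theorem IsActive.mono {p : Params E} {a k i j : ℕ} (hact : IsActive p a k i) (haj : a ≤ j)
    (hji : j ≤ i) : IsActive p a k j :=
  ⟨hact.lvl_mem, hact.dvd, haj, hji.trans_lt hact.lt_end⟩

variable [NormedAddCommGroup E] [InnerProductSpace ℝ E] {sub : Subroutines E} {p : Params E}
  {adv : Adversary E} {K : Set E} {A B : ℝ} {n a k i : ℕ} {h : ℕ → State E}

namespace Setting

theorem exists_experts_eq_append_spawn (S : Setting sub p adv K A B)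
    (hh : h ∈ (trace sub p adv n).support (memOracle K)) (hi : i ≤ n) :
    ∃ es, (h i).experts = es ++ spawn p (i + 1) ∧ ∀ e ∈ es, e.birth ≤ i := by
  cases i with
  | zero =>
    refine ⟨[], ?_, by simp⟩
    rw [trace_zero_of_mem_support hh]
    rfl
  | succ i =>
    obtain ⟨es, hes, hround⟩ := mem_support_round (trace_succ_of_mem_support hh hi)
    refine ⟨_, by rw [hround], fun e' he' => ?_⟩
    obtain ⟨e, he, hupdate⟩ := exists_mem_left_of_forall₂ hes (List.mem_filter.1 he').1
    rw [show e'.birth = e.birth from congrArg Prod.fst (key_of_mem_support_updateExpert hupdate)]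
    exact ((S.stateInv_trace hh (by omega)).expertInv e he).birth_le

theorem find?_birth (S : Setting sub p adv K A B)
    (hh : h ∈ (trace sub p adv n).support (memOracle K)) (hact : IsActive p a k a) (ha : a ≤ n) :
    (h a).find? (a + 1, k) = some ⟨a + 1, k, p.x₁, p.y₁, rate p.ε p.T k⟩ := by
  obtain ⟨es, hes, hbirth⟩ := S.exists_experts_eq_append_spawn hh ha
  have hold : es.find? (fun e => decide (e.key = (a + 1, k))) = none := by
    rw [List.find?_eq_none]
    intro e he
    have := hbirth e he
    simp only [Expert.key, decide_eq_true_eq, Prod.mk.injEq, not_and]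
    omega
  have hspawn : ((spawn p (a + 1)).find? fun e => decide (e.key = (a + 1, k))).isSome := by
    rw [List.find?_isSome]
    exact ⟨_, mem_spawn.2 ⟨k, hact.lvl_mem, by simpa using hact.dvd, rfl⟩, by simp [Expert.key]⟩
  obtain ⟨e, he⟩ := Option.isSome_iff_exists.1 hspawn
  have hkey : e.key = (a + 1, k) := by simpa using List.find?_some he
  obtain ⟨k', -, -, rfl⟩ := mem_spawn.1 (List.mem_of_find?_eq_some he)
  obtain rfl : k' = k := congrArg Prod.snd hkey
  rw [State.find?, hes, List.find?_append, hold, he]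
  rfl

theorem expert_birth_eq (S : Setting sub p adv K A B)
    (hh : h ∈ (trace sub p adv n).support (memOracle K)) (hact : IsActive p a k a) (ha : a ≤ n) :
    (h a).expert (a + 1, k) = ⟨a + 1, k, p.x₁, p.y₁, rate p.ε p.T k⟩ :=
  State.expert_of_find? (S.find?_birth hh hact ha)

theorem find?_of_isActive (S : Setting sub p adv K A B)
    (hh : h ∈ (trace sub p adv n).support (memOracle K)) (hact : IsActive p a k i) (hi : i ≤ n) :
    (h i).find? (a + 1, k) = some ((h i).expert (a + 1, k)) := by
  have hai := hact.le
  induction i, hai using Nat.le_induction with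
  | base => rw [S.expert_birth_eq hh hact hi, S.find?_birth hh hact hi]
  | succ i hai ih =>
    have hend := hact.lt_end
    obtain ⟨e, he, -⟩ := find?_of_mem_support_round (trace_succ_of_mem_support hh hi)
      (κ := (a + 1, k)) (by dsimp only; omega) (ih (hact.mono hai i.le_succ) (by omega))
    rw [State.expert_of_find? he, he]

theorem expert_succ_mem_support (S : Setting sub p adv K A B)
    (hh : h ∈ (trace sub p adv n).support (memOracle K)) (hact : IsActive p a k (i + 1))
    (hai : a ≤ i) (hi : i < n) :
    (h (i + 1)).expert (a + 1, k) ∈ (updateExpert sub p (h i).play ((h i).loss adv)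
      ((h i).expert (a + 1, k))).support (memOracle K) := by
  have hend := hact.lt_end
  obtain ⟨e, he, hupdate⟩ := find?_of_mem_support_round (trace_succ_of_mem_support hh hi)
    (κ := (a + 1, k)) (by dsimp only; omega)
    (S.find?_of_isActive hh (hact.mono hai i.le_succ) hi.le)
  rwa [State.expert_of_find? he]

theorem expert_key (S : Setting sub p adv K A B)
    (hh : h ∈ (trace sub p adv n).support (memOracle K)) (hact : IsActive p a k i) (hi : i ≤ n) :
    ((h i).expert (a + 1, k)).key = (a + 1, k) :=
  (State.mem_of_find? (S.find?_of_isActive hh hact hi)).2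

theorem expert_lvl (S : Setting sub p adv K A B)
    (hh : h ∈ (trace sub p adv n).support (memOracle K)) (hact : IsActive p a k i) (hi : i ≤ n) :
    ((h i).expert (a + 1, k)).lvl = k :=
  congrArg Prod.snd (S.expert_key hh hact hi)

theorem expertInv_expert (S : Setting sub p adv K A B)
    (hh : h ∈ (trace sub p adv n).support (memOracle K)) (hact : IsActive p a k i) (hi : i ≤ n) :
    ExpertInv p K A i ((h i).expert (a + 1, k)) :=
  (S.stateInv_trace hh hi).expertInv _ (State.mem_of_find? (S.find?_of_isActive hh hact hi)).1

theorem play_mem (S : Setting sub p adv K A B)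
    (hh : h ∈ (trace sub p adv n).support (memOracle K)) (hi : i ≤ n) : (h i).play ∈ K :=
  (S.stateInv_trace hh hi).playPoint_mem S.convex S.zero_mem

end Setting

end ActiveExperts

/-! ### The potential of the meta-algorithm -/

section Potential

theorem sub_two_mul_sq_le_log_one_add {x : ℝ} (hx : |x| ≤ 1 / 2) :
    x - 2 * x ^ 2 ≤ Real.log (1 + x) := by
  obtain ⟨hlower, -⟩ := abs_le.1 hx
  have hpos : 0 < 1 + x := by linarith
  refine le_trans ?_ (Real.one_sub_inv_le_log_of_pos hpos)
  rw [show 1 - (1 + x)⁻¹ = x / (1 + x) by field_simp; ring, le_div_iff₀ hpos]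
  nlinarith [sq_nonneg x]

theorem sum_log_le_card_mul_log {ι : Type*} {s : Finset ι} {v : ι → ℝ} {α : ℝ}
    (hv : ∀ i ∈ s, 0 < v i) (hα : 0 < α) (hsum : ∑ i ∈ s, v i ≤ α * s.card) :
    ∑ i ∈ s, Real.log (v i) ≤ s.card * Real.log α := by
  calc ∑ i ∈ s, Real.log (v i) ≤ ∑ i ∈ s, (v i / α - 1 + Real.log α) := by
        refine Finset.sum_le_sum fun i hi => ?_
        have hlog := Real.log_le_sub_one_of_pos (div_pos (hv i hi) hα)
        rw [Real.log_div (hv i hi).ne' hα.ne'] at hlog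
        linarith
    _ = (∑ i ∈ s, v i) / α - s.card + s.card * Real.log α := by
        simp only [Finset.sum_add_distrib, Finset.sum_sub_distrib, Finset.sum_div,
          Finset.sum_const, nsmul_eq_mul, mul_one]
    _ ≤ s.card * Real.log α := by
        have := (div_le_iff₀' hα).2 hsum
        linarith

variable {E : Type}

/-- The sum of the weights relative to the initial weights. -/
noncomputable def potential (p : Params E) (es : List (Expert E)) : ℝ :=
  (es.map fun e => e.w / rate p.ε p.T e.lvl).sum

theorem potential_append (p : Params E) (es es' : List (Expert E)) :
    potential p (es ++ es') = potential p es + potential p es' := by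
  simp only [potential, List.map_append, List.sum_append]

theorem potential_spawn_le {p : Params E} (hT : 2 ≤ p.T) (j : ℕ) :
    potential p (spawn p j) ≤ (levels p.ε p.T).length := by
  have hone : ∀ e ∈ spawn p j, e.w / rate p.ε p.T e.lvl = 1 := by
    intro e he
    obtain ⟨k, -, -, rfl⟩ := mem_spawn.1 he
    exact div_self (rate_pos hT p.ε k).ne'
  rw [potential, List.map_congr_left hone, List.map_const', List.sum_replicate, nsmul_eq_mul,
    mul_one]
  exact_mod_cast length_spawn_le p j

theorem potential_filter_le {p : Params E} (hT : 2 ≤ p.T) {es : List (Expert E)}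
    (hw : ∀ e ∈ es, 0 ≤ e.w) (q : Expert E → Bool) :
    potential p (es.filter q) ≤ potential p es :=
  List.Sublist.sum_le_sum (List.filter_sublist.map _) <| List.forall_mem_map.2 fun e he =>
    div_nonneg (hw e he) (rate_pos hT p.ε _).le

variable [NormedAddCommGroup E] [InnerProductSpace ℝ E] {sub : Subroutines E} {p : Params E}
  {adv : Adversary E} {K : Set E} {A B : ℝ} {n a k i c : ℕ} {h : ℕ → State E}

/-- The amount by which the loss of the played point exceeds the loss of the expert `κ` in the
round that follows the state `σ`. -/
noncomputable def State.excess (adv : Adversary E) (σ : State E) (κ : ℕ × ℕ) : ℝ :=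
  (σ.loss adv).val σ.play - (σ.loss adv).val (σ.expert κ).x

namespace Setting

theorem two_le_T (S : Setting sub p adv K A B) : 2 ≤ p.T := (Nat.le_succ 2).trans S.three_le_T

theorem potential_update_le (S : Setting sub p adv K A B) {σ : State E}
    (hw : ∀ e ∈ σ.experts, 0 < e.w) {O : E → Bool} {es : List (Expert E)}
    (hes : List.Forall₂ (fun e e' => e' ∈ (updateExpert sub p σ.play (σ.loss adv) e).support O)
      σ.experts es) : potential p es ≤ potential p σ.experts := by
  have hGD : 0 < p.G * p.D := mul_pos S.G_pos S.D_pos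
  have hmap : es.map (fun e => e.w / rate p.ε p.T e.lvl) = σ.experts.map fun e =>
      e.w / rate p.ε p.T e.lvl +
        (p.G * p.D)⁻¹ * (e.w * ((σ.loss adv).val σ.play - (σ.loss adv).val e.x)) := by
    refine (map_eq_map_of_forall₂ (fun e e' he => ?_) hes).symm
    obtain ⟨s, -, c, -, rfl⟩ := mem_support_updateExpert he
    have := (S.rate_pos e.lvl).ne'
    simp only [weightFactor]
    field_simp
  rw [potential, potential, hmap, List.sum_map_add, List.sum_map_mul_left]
  exact add_le_of_nonpos_right (mul_nonpos_of_nonneg_of_nonpos (by positivity)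
    (sum_weight_mul_sub_nonpos (S.admissible _).convex hw))

theorem potential_round_le (S : Setting sub p adv K A B) {σ σ' : State E}
    (hσ : StateInv p K A i σ)
    (hround : σ' ∈ (round sub p adv (i + 1) σ).support (memOracle K)) :
    potential p σ'.experts ≤ potential p σ.experts + (levels p.ε p.T).length := by
  obtain ⟨es, hes, rfl⟩ := mem_support_round hround
  have hx := hσ.playPoint_mem S.convex S.zero_mem
  have hw : ∀ e' ∈ es, 0 ≤ e'.w := by
    intro e' he'
    obtain ⟨e, he, hupdate⟩ := exists_mem_left_of_forall₂ hes he'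
    obtain ⟨s, -, c, -, rfl⟩ := mem_support_updateExpert hupdate
    have hinv := hσ.expertInv e he
    exact (mul_pos hinv.w_pos (S.weightFactor_pos _ hx hinv.x_mem _)).le
  rw [potential_append]
  exact add_le_add ((potential_filter_le S.two_le_T hw _).trans
    (S.potential_update_le (fun e he => (hσ.expertInv e he).w_pos) hes))
    (potential_spawn_le S.two_le_T _)

theorem potential_trace_le (S : Setting sub p adv K A B)
    (hh : h ∈ (trace sub p adv n).support (memOracle K)) (hi : i ≤ n) :
    potential p (h i).experts ≤ (i + 1) * (levels p.ε p.T).length := by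
  induction i with
  | zero =>
    rw [trace_zero_of_mem_support hh]
    simpa [initState] using potential_spawn_le S.two_le_T 1
  | succ i ih =>
    have hstep := S.potential_round_le (S.stateInv_trace hh (by omega))
      (trace_succ_of_mem_support hh hi)
    have := ih (by omega)
    push_cast
    linarith

theorem le_log_weightFactor (S : Setting sub p adv K A B) (k : ℕ) (h : List E) {x y : E}
    (hx : x ∈ K) (hy : y ∈ K) :
    rate p.ε p.T k * (((adv h).val x - (adv h).val y) / (p.G * p.D)) - 2 * rate p.ε p.T k ^ 2 ≤
      Real.log (weightFactor p k (adv h) x y) := by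
  have hm := S.abs_scaled_loss_sub_le_one h hx hy
  rw [weightFactor]
  set m := ((adv h).val x - (adv h).val y) / (p.G * p.D)
  have hrate := S.rate_pos k
  have habs : |rate p.ε p.T k * m| ≤ rate p.ε p.T k := by
    rw [abs_mul, abs_of_pos hrate]
    exact mul_le_of_le_one_right hrate.le hm
  have hlog := sub_two_mul_sq_le_log_one_add (habs.trans (rate_le_half p.ε p.T k))
  have hsq := sq_le_sq.2 (habs.trans (le_abs_self _))
  linarith

theorem excess_le_log_weight (S : Setting sub p adv K A B)
    (hh : h ∈ (trace sub p adv n).support (memOracle K)) (hact : IsActive p a k c) (hc : c ≤ n) :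
    rate p.ε p.T k * ((∑ i ∈ Finset.Ico a c, (h i).excess adv (a + 1, k)) / (p.G * p.D)) -
        2 * rate p.ε p.T k ^ 2 * (c - a) ≤
      Real.log (((h c).expert (a + 1, k)).w / rate p.ε p.T k) := by
  have hrate := S.rate_pos k
  have hac := hact.le
  induction c, hac using Nat.le_induction with
  | base =>
    rw [S.expert_birth_eq hh hact hc]
    simp [hrate.ne']
  | succ c hac ih =>
    have hact' := hact.mono hac c.le_succ
    have ih := ih hact' (by omega)
    have hinv := S.expertInv_expert hh hact' (by omega)
    have hx := S.play_mem hh (i := c) (by omega)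
    have hstep : rate p.ε p.T k * ((h c).excess adv (a + 1, k) / (p.G * p.D)) -
        2 * rate p.ε p.T k ^ 2 ≤ Real.log (weightFactor p k ((h c).loss adv) (h c).play
          ((h c).expert (a + 1, k)).x) := S.le_log_weightFactor k _ hx hinv.x_mem
    have hfactor : 0 < weightFactor p k ((h c).loss adv) (h c).play
        ((h c).expert (a + 1, k)).x := S.weightFactor_pos _ hx hinv.x_mem k
    obtain ⟨s, -, c', -, hexpert⟩ :=
      mem_support_updateExpert (S.expert_succ_mem_support hh hact hac hc)
    rw [hexpert, S.expert_lvl hh hact' (by omega), mul_div_right_comm,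
      Real.log_mul (div_pos hinv.w_pos hrate).ne' hfactor.ne', Finset.sum_Ico_succ_top hac,
      add_div, mul_add]
    push_cast
    linarith

theorem sum_relative_weight_le_potential (S : Setting sub p adv K A B)
    (hh : h ∈ (trace sub p adv n).support (memOracle K)) {Q : Finset ℕ}
    (hQ : ∀ k ∈ Q, IsActive p a k c) (hc : c ≤ n) :
    ∑ k ∈ Q, ((h c).expert (a + 1, k)).w / rate p.ε p.T k ≤ potential p (h c).experts := by
  have hle := sum_find?_le (key := Expert.key) (g := fun e => e.w / rate p.ε p.T e.lvl)
    (⟨0, 0, 0, 0, 0⟩ : Expert E) (l := (h c).experts)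
    (fun e he => div_nonneg ((S.stateInv_trace hh hc).expertInv e he).w_pos.le (S.rate_pos _).le)
    (Q.map (Function.Embedding.sectR (a + 1) ℕ)) (by
      intro κ hκ
      obtain ⟨k, hk, rfl⟩ := Finset.mem_map.1 hκ
      exact Option.isSome_iff_exists.2 ⟨_, S.find?_of_isActive hh (hQ k hk) hc⟩)
  rw [Finset.sum_map] at hle
  refine le_trans (Finset.sum_congr rfl fun k hk => ?_).le hle
  change _ = ((h c).expert (a + 1, k)).w / rate p.ε p.T ((h c).expert (a + 1, k)).lvl
  rw [S.expert_lvl hh (hQ k hk) hc]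

/-- One cannot bound the excess over a single expert by `log T / rate`, because the potential is
only bounded by the number of all experts started so far; but on average over the `|Q|` experts of
the same rate, the bound on the potential improves by the factor `|Q|`. -/
theorem sum_sum_excess_le (S : Setting sub p adv K A B)
    (hh : h ∈ (trace sub p adv n).support (memOracle K)) {Q : Finset ℕ}
    (hQ : ∀ j ∈ Q, IsActive p a j c) (hrate : ∀ j ∈ Q, rate p.ε p.T j = rate p.ε p.T k)
    (hc : c ≤ n) {α : ℝ} (hα : 0 < α)
    (hcard : ((c : ℝ) + 1) * (levels p.ε p.T).length ≤ α * Q.card) :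
    ∑ j ∈ Q, ∑ i ∈ Finset.Ico a c, (h i).excess adv (a + 1, j) ≤
      Q.card * (p.G * p.D * (Real.log α / rate p.ε p.T k + 2 * rate p.ε p.T k * (c - a))) := by
  have hGD : 0 < p.G * p.D := mul_pos S.G_pos S.D_pos
  have hk := S.rate_pos k
  have hlog : ∑ j ∈ Q, Real.log (((h c).expert (a + 1, j)).w / rate p.ε p.T j) ≤
      Q.card * Real.log α :=
    sum_log_le_card_mul_log
      (fun j hj => div_pos (S.expertInv_expert hh (hQ j hj) hc).w_pos (S.rate_pos j)) hα
      ((S.sum_relative_weight_le_potential hh hQ hc).trans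
        ((S.potential_trace_le hh hc).trans hcard))
  have hexcess := (Finset.sum_le_sum fun j hj => S.excess_le_log_weight hh (hQ j hj) hc).trans hlog
  rw [Finset.sum_congr rfl fun j hj => by rw [hrate j hj], Finset.sum_sub_distrib,
    ← Finset.mul_sum, ← Finset.sum_div, Finset.sum_const, nsmul_eq_mul] at hexcess
  set X := ∑ j ∈ Q, ∑ i ∈ Finset.Ico a c, (h i).excess adv (a + 1, j)
  have hscaled : rate p.ε p.T k * X / (p.G * p.D) ≤
      Q.card * (Real.log α + 2 * rate p.ε p.T k ^ 2 * (c - a)) := by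
    rw [mul_div_assoc]
    linarith
  rw [div_le_iff₀ hGD, ← le_div_iff₀' hk] at hscaled
  refine hscaled.trans_eq ?_
  field_simp

end Setting

end Potential

/-! ### The regret of a single expert -/

section RegretOn

variable {E : Type} [NormedAddCommGroup E] [InnerProductSpace ℝ E] {adv : Adversary E} {K : Set E}
  {x y : State E → E} {h : ℕ → State E} {a b c : ℕ}

/-- The regret on the rounds `a + 1, …, b` of a player who plays `x σ` in the round after the
state `σ`, when `h i` is the state after `i` rounds. -/
noncomputable def regretOn (adv : Adversary E) (K : Set E) (x : State E → E) (h : ℕ → State E)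
    (a b : ℕ) : ℝ :=
  ∑ i ∈ Finset.Ico a b, ((h i).loss adv).val (x (h i)) -
    ⨅ u : K, ∑ i ∈ Finset.Ico a b, ((h i).loss adv).val u

theorem regretOn_self : regretOn adv K x h a a = 0 := by
  simp [regretOn]

theorem regretOn_sub_regretOn : regretOn adv K x h a b - regretOn adv K y h a b =
    ∑ i ∈ Finset.Ico a b, (((h i).loss adv).val (x (h i)) - ((h i).loss adv).val (y (h i))) := by
  rw [Finset.sum_sub_distrib, regretOn, regretOn, sub_sub_sub_cancel_right]

variable [Nonempty K]

theorem regretOn_le_of_forall_le {β : ℝ} (hβ : ∀ u ∈ K, ∑ i ∈ Finset.Ico a b,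
      (((h i).loss adv).val (x (h i)) - ((h i).loss adv).val u) ≤ β) :
    regretOn adv K x h a b ≤ β := by
  rw [regretOn, sub_le_comm]
  refine le_ciInf fun u => ?_
  rw [sub_le_comm, ← Finset.sum_sub_distrib]
  exact hβ u u.2

theorem regretOn_le_add (hadv : ∀ l, ∀ u ∈ K, 0 ≤ (adv l).val u) (hab : a ≤ b) (hbc : b ≤ c) :
    regretOn adv K x h a c ≤ regretOn adv K x h a b + regretOn adv K x h b c := by
  have hbdd : ∀ a b, BddBelow (Set.range fun u : K =>
      ∑ i ∈ Finset.Ico a b, ((h i).loss adv).val u) := by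
    refine fun a b => ⟨0, ?_⟩
    rintro _ ⟨u, rfl⟩
    exact Finset.sum_nonneg fun i _ => hadv _ u u.2
  have hinf : (⨅ u : K, ∑ i ∈ Finset.Ico a b, ((h i).loss adv).val u) +
      (⨅ u : K, ∑ i ∈ Finset.Ico b c, ((h i).loss adv).val u) ≤
      ⨅ u : K, ∑ i ∈ Finset.Ico a c, ((h i).loss adv).val u := by
    refine le_ciInf fun u => ?_
    rw [← Finset.sum_Ico_consecutive _ hab hbc]
    exact add_le_add (ciInf_le (hbdd a b) u) (ciInf_le (hbdd b c) u)
  unfold regretOn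
  rw [← Finset.sum_Ico_consecutive (fun i => ((h i).loss adv).val (x (h i))) hab hbc]
  linarith

end RegretOn

section Descent

variable {E : Type*} [NormedAddCommGroup E] [InnerProductSpace ℝ E] {y : ℕ → E} {a c : ℕ}

theorem sum_inner_sub_succ (hac : a ≤ c) (u : E) :
    ∑ i ∈ Finset.Ico a c, inner ℝ (y i - y (i + 1)) (y i - u) =
      1 / 2 * (‖y a - u‖ ^ 2 - ‖y c - u‖ ^ 2 +
        ∑ i ∈ Finset.Ico a c, ‖y i - y (i + 1)‖ ^ 2) := by
  induction c, hac using Nat.le_induction with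
  | base => simp
  | succ c hac ih =>
    rw [Finset.sum_Ico_succ_top hac, Finset.sum_Ico_succ_top hac, ih,
      show y (c + 1) - u = (y c - u) - (y c - y (c + 1)) by abel, norm_sub_sq_real (y c - u),
      real_inner_comm]
    ring

theorem sum_inner_le_of_descent (e : ℕ → E) {u : E} (hac : a ≤ c) {D : ℝ}
    (hu : ‖y a - u‖ ≤ D) :
    ∑ i ∈ Finset.Ico a c, inner ℝ (e i) (y i - u) ≤
      D ^ 2 + 1 / 2 * ∑ i ∈ Finset.Ico a c, ‖y i - y (i + 1)‖ ^ 2 +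
        1 / 2 * ‖∑ i ∈ Finset.Ico a c, (e i - (y i - y (i + 1)))‖ ^ 2 +
        ∑ i ∈ Finset.Ico a c, inner ℝ (y i - y a) (e i - (y i - y (i + 1))) := by
  set N := ∑ i ∈ Finset.Ico a c, (e i - (y i - y (i + 1)))
  have hsplit : ∑ i ∈ Finset.Ico a c, inner ℝ (e i) (y i - u) =
      ∑ i ∈ Finset.Ico a c, inner ℝ (y i - y (i + 1)) (y i - u) +
      ∑ i ∈ Finset.Ico a c, inner ℝ (y i - y a) (e i - (y i - y (i + 1))) +
      inner ℝ N (y a - u) := by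
    rw [sum_inner, ← Finset.sum_add_distrib, ← Finset.sum_add_distrib]
    refine Finset.sum_congr rfl fun i _ => ?_
    rw [← sub_add_sub_cancel (y i) (y a) u, real_inner_comm (e i - (y i - y (i + 1))) (y i - y a)]
    simp only [inner_sub_left, inner_add_right]
    ring
  have hsq : ‖y a - u‖ ^ 2 ≤ D ^ 2 := by gcongr
  have hN : inner ℝ N (y a - u) ≤ 1 / 2 * ‖N‖ ^ 2 + 1 / 2 * D ^ 2 := by
    have hyoung := two_mul_le_add_sq ‖N‖ ‖y a - u‖
    linarith [real_inner_le_norm N (y a - u)]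
  have hend := sq_nonneg ‖y c - u‖
  rw [hsplit, sum_inner_sub_succ hac]
  linarith

end Descent

section ExpertRegret

variable {E : Type} [NormedAddCommGroup E] [InnerProductSpace ℝ E] {sub : Subroutines E}
  {p : Params E} {adv : Adversary E} {K : Set E} {A B : ℝ} {n a k i c : ℕ} {h : ℕ → State E}

/-- The conditional expectation, given the state `σ`, of the step of the expert `κ` in the
following round. -/
noncomputable def meanStep (sub : Subroutines E) (p : Params E) (adv : Adversary E) (K : Set E)
    (κ : ℕ × ℕ) (σ : State E) : E :=
  stepSize p κ.2 • ((σ.loss adv).grad (σ.expert κ).y + (3 * p.G * p.D) •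
    (sub.subgrad (4 * len p.ε κ.2) (σ.expert κ).y).mean (memOracle K))

/-- The deviation of the step of the expert `κ` in round `i + 1` from its conditional
expectation. -/
noncomputable def noise (sub : Subroutines E) (p : Params E) (adv : Adversary E) (K : Set E)
    (κ : ℕ × ℕ) (h : ℕ → State E) (i : ℕ) : E :=
  meanStep sub p adv K κ (h i) - (((h i).expert κ).y - ((h (i + 1)).expert κ).y)

namespace Setting

theorem expect_round_expert_y (S : Setting sub p adv K A B)
    (hh : h ∈ (trace sub p adv n).support (memOracle K)) (hact : IsActive p a k (i + 1))
    (hai : a ≤ i) (hi : i < n) (F : E → ℝ) :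
    (round sub p adv (i + 1) (h i)).expect (memOracle K) (fun σ => F (σ.expert (a + 1, k)).y) =
      (sub.subgrad (4 * len p.ε k) ((h i).expert (a + 1, k)).y).expect (memOracle K) fun s =>
        F (nextPoint p k ((h i).loss adv) ((h i).expert (a + 1, k)).y s) := by
  have hend := hact.lt_end
  have hact' := hact.mono hai i.le_succ
  rw [expect_round_expert (κ := (a + 1, k)) (by dsimp only; omega)
    (S.find?_of_isActive hh hact' hi.le) fun e => F e.y, expect_updateExpert_y,
    S.expert_lvl hh hact' hi.le]

/-- The noise is a martingale difference sequence. -/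
theorem expect_inner_noise (S : Setting sub p adv K A B) (hact : IsActive p a k (i + 1))
    (hai : a ≤ i) (hi : i < n) {W : (ℕ → State E) → E} (hW : DependsOn W (Set.Iic i)) :
    (trace sub p adv n).expect (memOracle K)
      (fun h => inner ℝ (W h) (noise sub p adv K (a + 1, k) h i)) = 0 := by
  have hcond := expect_trace_succ (sub := sub) (p := p) (adv := adv) (O := memOracle K) hi
    (Φ := fun h σ => inner ℝ (W h) (meanStep sub p adv K (a + 1, k) (h i) -
      (((h i).expert (a + 1, k)).y - (σ.expert (a + 1, k)).y))) fun h h' hpast => by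
        simp only [hW hpast, hpast i (Set.mem_Iic.2 le_rfl)]
  refine hcond.trans ((expect_congr fun h hh => ?_).trans (expect_const _ 0))
  rw [S.expect_round_expert_y hh hact hai hi fun y => inner ℝ (W h)
    (meanStep sub p adv K (a + 1, k) (h i) - (((h i).expert (a + 1, k)).y - y))]
  simp only [nextPoint, sub_sub_cancel, meanStep, ← smul_sub, add_sub_add_left_eq_sub,
    real_inner_smul_right, inner_sub_right]
  rw [expect_const_mul, expect_const_mul, expect_sub, expect_const, expect_inner, sub_self,
    mul_zero, mul_zero]

theorem expect_norm_step_sq_le (S : Setting sub p adv K A B) (hrD : p.r ≤ p.D)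
    (hact : IsActive p a k (i + 1)) (hai : a ≤ i) (hi : i < n) :
    (trace sub p adv n).expect (memOracle K)
      (fun h => ‖((h i).expert (a + 1, k)).y - ((h (i + 1)).expert (a + 1, k)).y‖ ^ 2) ≤
      10 * p.D ^ 2 / len p.ε k := by
  have hD := S.D_pos
  have hr := S.r_pos
  have hl := len_pos p.ε k
  have hcond := expect_trace_succ (sub := sub) (p := p) (adv := adv) (O := memOracle K) hi
    (Φ := fun h σ => ‖((h i).expert (a + 1, k)).y - (σ.expert (a + 1, k)).y‖ ^ 2)
    fun h h' hpast => by simp only [hpast i (Set.mem_Iic.2 le_rfl)]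
  refine hcond.trans_le (expect_le_const fun h hh => ?_)
  rw [S.expect_round_expert_y hh hact hai hi fun y => ‖((h i).expert (a + 1, k)).y - y‖ ^ 2]
  set y := ((h i).expert (a + 1, k)).y
  have hsq := (S.good _ (one_le_four_mul_len p.ε k)).approx.subgrad_sq y
  have hstep : ∀ s : E, ‖y - nextPoint p k ((h i).loss adv) y s‖ ^ 2 ≤
      p.r ^ 2 / (4 * len p.ε k) * (2 + 18 * p.D ^ 2 * ‖s‖ ^ 2) := by
    intro s
    rw [norm_sub_rev]
    calc _ ≤ (p.r * (1 + 3 * p.D * ‖s‖) / (2 * √(len p.ε k))) ^ 2 := by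
          gcongr
          exact S.norm_nextPoint_sub_le k _ y s
      _ = p.r ^ 2 / (4 * len p.ε k) * (1 + 3 * p.D * ‖s‖) ^ 2 := by
          rw [div_pow, mul_pow 2, Real.sq_sqrt hl.le]
          ring
      _ ≤ _ := by
          gcongr
          linarith [two_mul_le_add_sq 1 (3 * p.D * ‖s‖)]
  refine (expect_mono fun s _ => hstep s).trans ?_
  rw [expect_const_mul, expect_add, expect_const, expect_const_mul]
  calc _ ≤ p.r ^ 2 / (4 * len p.ε k) * (2 + 18 * p.D ^ 2 * (2 / p.r ^ 2)) := by gcongr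
    _ = (2 * p.r ^ 2 + 36 * p.D ^ 2) / (4 * len p.ε k) := by
      field_simp
      ring
    _ ≤ (2 * p.D ^ 2 + 38 * p.D ^ 2) / (4 * len p.ε k) := by gcongr; norm_num
    _ = _ := by field_simp; ring

theorem expect_norm_noise_sq_le (S : Setting sub p adv K A B) (hrD : p.r ≤ p.D)
    (hact : IsActive p a k (i + 1)) (hai : a ≤ i) (hi : i < n) :
    (trace sub p adv n).expect (memOracle K)
      (fun h => ‖noise sub p adv K (a + 1, k) h i‖ ^ 2) ≤ 10 * p.D ^ 2 / len p.ε k := by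
  refine le_trans ?_ (S.expect_norm_step_sq_le hrD hact hai hi)
  have horth := S.expect_inner_noise hact hai hi
    (W := fun h => meanStep sub p adv K (a + 1, k) (h i)) fun h h' hpast => by
      simp only [hpast i (Set.mem_Iic.2 le_rfl)]
  have hle : ∀ h : ℕ → State E, ‖noise sub p adv K (a + 1, k) h i‖ ^ 2 ≤
      ‖((h i).expert (a + 1, k)).y - ((h (i + 1)).expert (a + 1, k)).y‖ ^ 2 +
        2 * inner ℝ (meanStep sub p adv K (a + 1, k) (h i))
          (noise sub p adv K (a + 1, k) h i) := by
    intro h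
    rw [show ((h i).expert (a + 1, k)).y - ((h (i + 1)).expert (a + 1, k)).y =
      meanStep sub p adv K (a + 1, k) (h i) - noise sub p adv K (a + 1, k) h i by
        rw [noise, sub_sub_cancel], norm_sub_sq_real]
    linarith [sq_nonneg ‖meanStep sub p adv K (a + 1, k) (h i)‖]
  refine (expect_mono fun h _ => hle h).trans_eq ?_
  rw [expect_add, expect_const_mul, horth, mul_zero, add_zero]

theorem expect_norm_sum_noise_sq_le (S : Setting sub p adv K A B) (hrD : p.r ≤ p.D)
    (hact : IsActive p a k c) (hc : c ≤ n) :
    (trace sub p adv n).expect (memOracle K)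
      (fun h => ‖∑ i ∈ Finset.Ico a c, noise sub p adv K (a + 1, k) h i‖ ^ 2) ≤
      (c - a) * (10 * p.D ^ 2 / len p.ε k) := by
  have hac := hact.le
  induction c, hac using Nat.le_induction with
  | base => simp
  | succ c hac ih =>
    have ih := ih (hact.mono hac c.le_succ) (by omega)
    have hnoise := S.expect_norm_noise_sq_le hrD hact hac hc
    have horth := S.expect_inner_noise hact hac hc
      (W := fun h => ∑ i ∈ Finset.Ico a c, noise sub p adv K (a + 1, k) h i) fun h h' hpast =>
        Finset.sum_congr rfl fun i hi => by
          have := (Finset.mem_Ico.1 hi).2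
          rw [noise, noise, hpast i (Set.mem_Iic.2 (by omega)),
            hpast (i + 1) (Set.mem_Iic.2 (by omega))]
    simp only [Finset.sum_Ico_succ_top hac, norm_add_sq_real]
    rw [expect_add, expect_add, expect_const_mul, horth]
    push_cast
    linarith

theorem exists_expert_y_eq_smul_x (S : Setting sub p adv K A B)
    (hh : h ∈ (trace sub p adv n).support (memOracle K)) (hact : IsActive p a k (i + 1))
    (hai : a ≤ i) (hi : i < n) :
    ∃ c : ℝ, 1 ≤ c ∧
      c ≤ gauge1 K ((h (i + 1)).expert (a + 1, k)).y + 1 / ((4 * len p.ε k : ℕ) : ℝ) ^ 2 ∧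
      ((h (i + 1)).expert (a + 1, k)).y = c • ((h (i + 1)).expert (a + 1, k)).x := by
  obtain ⟨s, -, c, hc, hexpert⟩ :=
    mem_support_updateExpert (S.expert_succ_mem_support hh hact hai hi)
  rw [S.expert_lvl hh (hact.mono hai i.le_succ) hi.le] at hc hexpert
  rw [hexpert]
  obtain ⟨hc1, -, hcγ⟩ := (S.good _ (one_le_four_mul_len p.ε k)).approx.value_spec _ c hc
  refine ⟨c, hc1, by linarith [(abs_le.1 hcγ).2], ?_⟩
  rw [smul_inv_smul₀ (by linarith)]

theorem norm_expert_x_sub_y_le (S : Setting sub p adv K A B)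
    (hh : h ∈ (trace sub p adv n).support (memOracle K)) (hact : IsActive p a k (i + 1))
    (hai : a ≤ i) (hi : i < n) :
    ‖((h (i + 1)).expert (a + 1, k)).x - ((h (i + 1)).expert (a + 1, k)).y‖ ≤
      p.D * (gauge1 K ((h (i + 1)).expert (a + 1, k)).y - 1 +
        1 / ((4 * len p.ε k : ℕ) : ℝ) ^ 2) := by
  obtain ⟨c, hc1, hcγ, hy⟩ := S.exists_expert_y_eq_smul_x hh hact hai hi
  have hx := S.norm_le (S.expertInv_expert hh hact hi).x_mem
  have hD := S.D_pos
  calc _ = (c - 1) * ‖((h (i + 1)).expert (a + 1, k)).x‖ := by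
        rw [norm_sub_rev, hy, sub_eq_add_neg, ← neg_one_smul ℝ, ← add_smul, ← sub_eq_add_neg,
          norm_smul, Real.norm_of_nonneg (by linarith)]
    _ ≤ (c - 1) * p.D := mul_le_mul_of_nonneg_left hx (by linarith)
    _ ≤ _ := by
        rw [mul_comm]
        gcongr
        linarith

/-- The prediction of a new expert is unrelated to its iterate, which costs `G D` once. -/
theorem loss_expert_x_sub_y_le (S : Setting sub p adv K A B)
    (hh : h ∈ (trace sub p adv n).support (memOracle K)) (hact : IsActive p a k i)
    (hi : i ≤ n) :
    ((h i).loss adv).val ((h i).expert (a + 1, k)).x -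
        ((h i).loss adv).val ((h i).expert (a + 1, k)).y ≤
      p.G * p.D * (gauge1 K ((h i).expert (a + 1, k)).y - 1 +
        1 / ((4 * len p.ε k : ℕ) : ℝ) ^ 2) + if i = a then p.G * p.D else 0 := by
  have hG := S.G_pos
  have hD := S.D_pos
  have hγ := one_le_gauge1 S.convex S.mem_nhds ((h i).expert (a + 1, k)).y
  have hnonneg : 0 ≤ p.G * p.D * (gauge1 K ((h i).expert (a + 1, k)).y - 1 +
      1 / ((4 * len p.ε k : ℕ) : ℝ) ^ 2) :=
    mul_nonneg (by positivity) (add_nonneg (by linarith) (by positivity))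
  rcases hact.le.eq_or_lt with rfl | hlt
  · rw [if_pos rfl]
    rw [S.expert_birth_eq hh hact hi] at hnonneg ⊢
    have := (abs_le.1 (S.abs_loss_sub_le ((h a).plays ++ [(h a).play]) S.x₁_mem S.y₁_mem)).2
    exact this.trans (le_add_of_nonneg_left hnonneg)
  · obtain ⟨j, rfl⟩ : ∃ j, i = j + 1 := ⟨i - 1, by omega⟩
    rw [if_neg hlt.ne', add_zero, mul_assoc]
    exact (S.loss_sub_le _ _ _).trans (mul_le_mul_of_nonneg_left
      (S.norm_expert_x_sub_y_le hh hact (by omega) hi) hG.le)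

/-- The term with `γ` on the left pays for replacing the iterate by the prediction of the expert. -/
theorem regularized_loss_sub_le (S : Setting sub p adv K A B) (σ : State E) (κ : ℕ × ℕ)
    {u : E} (hu : u ∈ K) :
    (σ.loss adv).val (σ.expert κ).y - (σ.loss adv).val u +
        3 * p.G * p.D * (gauge1 K (σ.expert κ).y - 1) ≤
      (stepSize p κ.2)⁻¹ * inner ℝ (meanStep sub p adv K κ σ) ((σ.expert κ).y - u) +
        3 * p.G * p.D * (gradPrecision A (4 * len p.ε κ.2) * (1 + ‖u - (σ.expert κ).y‖)) := by
  have hG := S.G_pos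
  have hD := S.D_pos
  set y := (σ.expert κ).y with hy
  have hloss : (σ.loss adv).val y + inner ℝ ((σ.loss adv).grad y) (u - y) ≤ (σ.loss adv).val u :=
    S.isSubgradientAt_grad _ y u
  have hgauge := (S.good _ (one_le_four_mul_len p.ε κ.2)).subgrad_spec y u
  simp only [real_inner_comm (u - y)] at hgauge
  rw [expect_inner, gauge1_of_mem S.convex S.mem_nhds hu] at hgauge
  rw [meanStep, ← hy, real_inner_smul_left, inv_mul_cancel_left₀ (S.stepSize_pos κ.2).ne',
    inner_add_left, real_inner_smul_left, ← neg_sub u y, inner_neg_right, inner_neg_right,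
    real_inner_comm (u - y) (mean _ _)]
  have := mul_le_mul_of_nonneg_left hgauge (by positivity : 0 ≤ 3 * p.G * p.D)
  linarith

theorem gradPrecision_mul_le (S : Setting sub p adv K A B)
    (hh : h ∈ (trace sub p adv n).support (memOracle K)) (hact : IsActive p a k i) (hi : i ≤ n)
    {u : E} (hu : u ∈ K) :
    gradPrecision A (4 * len p.ε k) * (1 + ‖u - ((h i).expert (a + 1, k)).y‖) ≤
      2 / ((4 * len p.ε k : ℕ) : ℝ) := by
  have hA := S.A_pos
  have hH : (1 : ℝ) ≤ (4 * len p.ε k : ℕ) := by exact_mod_cast one_le_four_mul_len p.ε k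
  have hlife : (i : ℝ) + 1 ≤ a + (4 * len p.ε k : ℕ) := by exact_mod_cast hact.lt_end
  have hy := (S.expertInv_expert hh hact hi).norm_y_le
  rw [show ((h i).expert (a + 1, k)).birth = a + 1 from
    congrArg Prod.fst (S.expert_key hh hact hi)] at hy
  push_cast at hy
  set H : ℝ := ((4 * len p.ε k : ℕ) : ℝ)
  have hdist : 1 + ‖u - ((h i).expert (a + 1, k)).y‖ ≤ 2 * H * (1 + A) := by
    have hle := (_root_.norm_sub_le u ((h i).expert (a + 1, k)).y).trans
      (add_le_add (S.norm_le hu) hy)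
    have hgrowth : ((i : ℝ) + 1 - (a + 1)) * A ≤ (H - 1) * A :=
      mul_le_mul_of_nonneg_right (by linarith) hA.le
    have := S.D_le
    nlinarith
  calc _ ≤ 1 / (H ^ 2 * (1 + A)) * (2 * H * (1 + A)) := by
        unfold gradPrecision
        gcongr
    _ = _ := by field_simp

theorem loss_expert_sub_le (S : Setting sub p adv K A B)
    (hh : h ∈ (trace sub p adv n).support (memOracle K)) (hact : IsActive p a k i)
    (hi : i ≤ n) {u : E} (hu : u ∈ K) :
    ((h i).loss adv).val ((h i).expert (a + 1, k)).x - ((h i).loss adv).val u ≤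
      (stepSize p k)⁻¹ *
        inner ℝ (meanStep sub p adv K (a + 1, k) (h i)) (((h i).expert (a + 1, k)).y - u) +
      (7 * (p.G * p.D) / (4 * len p.ε k : ℕ) + if i = a then p.G * p.D else 0) := by
  have hGD : 0 < p.G * p.D := mul_pos S.G_pos S.D_pos
  have hγ := one_le_gauge1 S.convex S.mem_nhds ((h i).expert (a + 1, k)).y
  have hxy := S.loss_expert_x_sub_y_le hh hact hi
  have hyu := S.regularized_loss_sub_le (h i) (a + 1, k) hu
  have hprec := mul_le_mul_of_nonneg_left (S.gradPrecision_mul_le hh hact hi hu) hGD.le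
  have hH : (1 : ℝ) ≤ (4 * len p.ε k : ℕ) := by exact_mod_cast one_le_four_mul_len p.ε k
  set H : ℝ := ((4 * len p.ε k : ℕ) : ℝ)
  have hsq : p.G * p.D * (1 / H ^ 2) ≤ p.G * p.D * (1 / H) :=
    mul_le_mul_of_nonneg_left
      (one_div_le_one_div_of_le (by linarith) (le_self_pow₀ hH two_ne_zero)) hGD.le
  have hslack : 0 ≤ p.G * p.D * (gauge1 K ((h i).expert (a + 1, k)).y - 1) :=
    mul_nonneg hGD.le (by linarith)
  rw [show 7 * (p.G * p.D) / H = 3 * (p.G * p.D * (2 / H)) + p.G * p.D * (1 / H) by ring]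
  linarith

theorem sum_loss_expert_sub_le (S : Setting sub p adv K A B)
    (hh : h ∈ (trace sub p adv n).support (memOracle K)) (hact : IsActive p a k c)
    (hc : c ≤ n) {u : E} (hu : u ∈ K) :
    ∑ i ∈ Finset.Ico a c,
        (((h i).loss adv).val ((h i).expert (a + 1, k)).x - ((h i).loss adv).val u) ≤
      (stepSize p k)⁻¹ * ∑ i ∈ Finset.Ico a c, inner ℝ (meanStep sub p adv K (a + 1, k) (h i))
        (((h i).expert (a + 1, k)).y - u) + 8 * (p.G * p.D) := by
  have hGD : 0 < p.G * p.D := mul_pos S.G_pos S.D_pos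
  refine (Finset.sum_le_sum fun i hi => S.loss_expert_sub_le hh
    (hact.mono (Finset.mem_Ico.1 hi).1 (Finset.mem_Ico.1 hi).2.le)
    ((Finset.mem_Ico.1 hi).2.le.trans hc) hu).trans ?_
  rw [Finset.sum_add_distrib, ← Finset.mul_sum, Finset.sum_add_distrib, Finset.sum_const,
    Nat.card_Ico, nsmul_eq_mul]
  have hrounds : ((c - a : ℕ) : ℝ) * (7 * (p.G * p.D) / (4 * len p.ε k : ℕ)) ≤
      7 * (p.G * p.D) := by
    have hend := hact.lt_end
    have hH : (0 : ℝ) < (4 * len p.ε k : ℕ) := by exact_mod_cast one_le_four_mul_len p.ε k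
    have hlife : ((c - a : ℕ) : ℝ) ≤ (4 * len p.ε k : ℕ) := by exact_mod_cast (by omega)
    rw [mul_div_left_comm]
    exact mul_le_of_le_one_right (by positivity) ((div_le_one hH).2 hlife)
  have hbirth : ∑ i ∈ Finset.Ico a c, (if i = a then p.G * p.D else 0) ≤ p.G * p.D := by
    rw [Finset.sum_ite_eq']
    split_ifs
    exacts [le_rfl, hGD.le]
  linarith

end Setting

/-- The bound of `sum_inner_le_of_descent` for the iterates of the expert `(a + 1, k)`. -/
noncomputable def descentBound (sub : Subroutines E) (p : Params E) (adv : Adversary E) (K : Set E)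
    (a k c : ℕ) (h : ℕ → State E) : ℝ :=
  p.D ^ 2 + 1 / 2 * ∑ i ∈ Finset.Ico a c,
      ‖((h i).expert (a + 1, k)).y - ((h (i + 1)).expert (a + 1, k)).y‖ ^ 2 +
    1 / 2 * ‖∑ i ∈ Finset.Ico a c, noise sub p adv K (a + 1, k) h i‖ ^ 2 +
    ∑ i ∈ Finset.Ico a c, inner ℝ (((h i).expert (a + 1, k)).y - ((h a).expert (a + 1, k)).y)
      (noise sub p adv K (a + 1, k) h i)

/-- The common factor of the bounds on the regret. -/
noncomputable def regretScale (p : Params E) : ℝ := p.G * p.D ^ 2 / p.r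

namespace Setting

theorem nonempty (S : Setting sub p adv K A B) : Nonempty K := ⟨⟨0, S.zero_mem⟩⟩

theorem regretScale_pos (S : Setting sub p adv K A B) : 0 < regretScale p :=
  div_pos (mul_pos S.G_pos (pow_pos S.D_pos 2)) S.r_pos

theorem mul_le_regretScale (S : Setting sub p adv K A B) (hrD : p.r ≤ p.D) :
    p.G * p.D ≤ regretScale p := by
  have hG := S.G_pos
  have hD := S.D_pos
  rw [regretScale, le_div_iff₀ S.r_pos, sq, ← mul_assoc]
  gcongr

theorem regretOn_expert_le (S : Setting sub p adv K A B)
    (hh : h ∈ (trace sub p adv n).support (memOracle K)) (hact : IsActive p a k c)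
    (hc : c ≤ n) :
    regretOn adv K (fun σ => (σ.expert (a + 1, k)).x) h a c ≤
      (stepSize p k)⁻¹ * descentBound sub p adv K a k c h + 8 * (p.G * p.D) := by
  have := S.nonempty
  refine regretOn_le_of_forall_le fun u hu =>
    (S.sum_loss_expert_sub_le hh hact hc hu).trans (add_le_add_left ?_ _)
  refine mul_le_mul_of_nonneg_left (sum_inner_le_of_descent
    (y := fun i => ((h i).expert (a + 1, k)).y) _ hact.le ?_) (inv_pos.2 (S.stepSize_pos k)).le
  rw [S.expert_birth_eq hh (hact.mono le_rfl hact.le) (hact.le.trans hc)]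
  exact S.norm_sub_le S.y₁_mem hu

theorem expect_descentBound_le (S : Setting sub p adv K A B) (hrD : p.r ≤ p.D)
    (hact : IsActive p a k c) (hc : c ≤ n) :
    (trace sub p adv n).expect (memOracle K) (descentBound sub p adv K a k c) ≤
      41 * p.D ^ 2 := by
  have hl := len_pos p.ε k
  have hsteps : ∑ i ∈ Finset.Ico a c, (trace sub p adv n).expect (memOracle K)
      (fun h => ‖((h i).expert (a + 1, k)).y - ((h (i + 1)).expert (a + 1, k)).y‖ ^ 2) ≤
      (c - a) * (10 * p.D ^ 2 / len p.ε k) := by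
    refine (Finset.sum_le_card_nsmul _ _ (10 * p.D ^ 2 / len p.ε k) fun i hi => ?_).trans_eq ?_
    · obtain ⟨hai, hic⟩ := Finset.mem_Ico.1 hi
      exact S.expect_norm_step_sq_le hrD (hact.mono (by omega) hic) hai (by omega)
    · rw [Nat.card_Ico, nsmul_eq_mul, Nat.cast_sub hact.le]
  have hnoise := S.expect_norm_sum_noise_sq_le hrD hact hc
  have horth : ∑ i ∈ Finset.Ico a c, (trace sub p adv n).expect (memOracle K)
      (fun h => inner ℝ (((h i).expert (a + 1, k)).y - ((h a).expert (a + 1, k)).y)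
        (noise sub p adv K (a + 1, k) h i)) = 0 := by
    refine Finset.sum_eq_zero fun i hi => ?_
    obtain ⟨hai, hic⟩ := Finset.mem_Ico.1 hi
    exact S.expect_inner_noise (hact.mono (by omega) hic) hai (by omega)
      fun h h' hpast => by simp only [hpast i (Set.mem_Iic.2 le_rfl), hpast a (Set.mem_Iic.2 hai)]
  have hlife : ((c : ℝ) - a) * (10 * p.D ^ 2 / len p.ε k) ≤ 40 * p.D ^ 2 := by
    have hend : (c : ℝ) ≤ a + 4 * len p.ε k := by exact_mod_cast hact.lt_end.le
    calc _ ≤ 4 * len p.ε k * (10 * p.D ^ 2 / len p.ε k) := by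
          gcongr
          linarith
      _ = _ := by field_simp; ring
  unfold descentBound
  rw [expect_add, expect_add, expect_add, expect_const, expect_const_mul, expect_const_mul,
    expect_sum, expect_sum]
  linarith

theorem expect_regretOn_expert_le (S : Setting sub p adv K A B) (hrD : p.r ≤ p.D)
    (hact : IsActive p a k c) (hc : c ≤ n) :
    (trace sub p adv n).expect (memOracle K)
      (regretOn adv K (fun σ => (σ.expert (a + 1, k)).x) · a c) ≤
      90 * √(len p.ε k) * regretScale p := by
  have hη := S.stepSize_pos k
  have hsqrt : (1 : ℝ) ≤ √(len p.ε k) := Real.one_le_sqrt.2 (by exact_mod_cast one_le_len p.ε k)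
  have hR := S.regretScale_pos
  refine (expect_mono fun h hh => S.regretOn_expert_le hh hact hc).trans ?_
  rw [expect_add, expect_const, expect_const_mul]
  calc _ ≤ (stepSize p k)⁻¹ * (41 * p.D ^ 2) + 8 * regretScale p := by
        gcongr
        exacts [S.expect_descentBound_le hrD hact hc, S.mul_le_regretScale hrD]
    _ = 82 * √(len p.ε k) * regretScale p + 8 * 1 * regretScale p := by
        rw [stepSize, inv_div, regretScale]
        ring
    _ ≤ 82 * √(len p.ε k) * regretScale p + 8 * √(len p.ε k) * regretScale p := by gcongr
    _ = _ := by ring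

end Setting

end ExpertRegret

/-! ### The lengths of the levels -/

section Lengths

variable {ε : ℝ} {T k : ℕ}

theorem rpow_div_two_lt_len (ε : ℝ) (k : ℕ) : (2 : ℝ) ^ ((1 + ε) ^ k) / 2 < len ε k := by
  unfold len
  exact_mod_cast Nat.lt_floor_add_one ((2 : ℝ) ^ ((1 + ε) ^ k) / 2)

theorem len_le_rpow_div_two_add_one (ε : ℝ) (k : ℕ) :
    (len ε k : ℝ) ≤ (2 : ℝ) ^ ((1 + ε) ^ k) / 2 + 1 := by
  unfold len
  push_cast
  gcongr
  exact Nat.floor_le (by positivity)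

theorem len_mono (hε : 0 < ε) : Monotone (len ε) := by
  intro k k' h
  unfold len
  gcongr
  · norm_num
  · linarith

theorem two_le_two_rpow (hε : 0 < ε) (k : ℕ) : (2 : ℝ) ≤ (2 : ℝ) ^ ((1 + ε) ^ k) :=
  Real.self_le_rpow_of_one_le one_le_two (one_le_pow₀ (by linarith))

theorem two_le_len (hε : 0 < ε) (k : ℕ) : 2 ≤ len ε k := by
  have h : (1 : ℝ) < len ε k := by linarith [rpow_div_two_lt_len ε k, two_le_two_rpow hε k]
  exact_mod_cast h

theorem len_one (hε : 0 < ε) (hε1 : ε < 1) : len ε 1 = 2 := by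
  refine le_antisymm (Nat.lt_succ_iff.1 ?_) (two_le_len hε 1)
  have hpow : (2 : ℝ) ^ (1 + ε) < 2 ^ (2 : ℝ) :=
    Real.rpow_lt_rpow_of_exponent_lt one_lt_two (by linarith)
  have hlen := len_le_rpow_div_two_add_one ε 1
  rw [pow_one] at hlen
  norm_num at hpow
  have h : (len ε 1 : ℝ) < 3 := by linarith
  exact_mod_cast h

theorem mem_levels_of_len_le (hε : 0 < ε) (hk : 1 ≤ k) (h : len ε k ≤ T) : k ∈ levels ε T :=
  (mem_levels hε T k).2 ⟨hk, (rpow_div_two_lt_len ε k).le.trans (by exact_mod_cast h)⟩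

theorem length_levels_le (hε : 0 < ε) (T : ℕ) :
    ((levels ε T).length : ℝ) ≤ 2 * T / ε + 2 := by
  have hrange : (levels ε T).length ≤ ⌈2 * (T : ℝ) / ε⌉₊ + 1 :=
    (List.length_filter_le _ _).trans_eq List.length_range
  have hceil := Nat.ceil_lt_add_one (a := 2 * (T : ℝ) / ε) (by positivity)
  have : ((levels ε T).length : ℝ) ≤ ⌈2 * (T : ℝ) / ε⌉₊ + 1 := by exact_mod_cast hrange
  linarith

theorem exists_lt_len (hε : 0 < ε) (m : ℕ) : ∃ k, m < len ε (k + 1) := by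
  refine ⟨⌈2 * (m : ℝ) / ε⌉₊, ?_⟩
  by_contra! hle
  have := mem_levels_of_len_le hε (Nat.le_add_left 1 _) hle
  simp [levels] at this

theorem exists_two_mul_len_le_lt (hε : 0 < ε) (hε1 : ε < 1) {m : ℕ} (hm : 4 ≤ m) :
    ∃ k, 1 ≤ k ∧ 2 * len ε k ≤ m ∧ m < 2 * len ε (k + 1) := by
  classical
  have hex : ∃ k, m < 2 * len ε (k + 1) := (exists_lt_len hε m).imp fun k hk => by omega
  have hspec := Nat.find_spec hex
  have hpos : Nat.find hex ≠ 0 := by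
    intro h0
    rw [h0, zero_add, len_one hε hε1] at hspec
    omega
  obtain ⟨k, hk⟩ := Nat.exists_eq_succ_of_ne_zero hpos
  have hmin := Nat.find_min hex (m := k) (by omega)
  rw [hk] at hspec
  exact ⟨k + 1, by omega, by omega, hspec⟩

theorem two_mul_two_rpow_succ_le (hε : 0 < ε) (k : ℕ) :
    2 * (2 : ℝ) ^ ((1 + ε) ^ (k + 1)) ≤ (4 * len ε k : ℝ) ^ (1 + ε) := by
  have hlen := rpow_div_two_lt_len ε k
  have htwo : (2 : ℝ) ≤ 2 ^ (1 + ε) := Real.self_le_rpow_of_one_le one_le_two (by linarith)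
  calc 2 * (2 : ℝ) ^ ((1 + ε) ^ (k + 1))
      = 2 * ((2 : ℝ) ^ ((1 + ε) ^ k)) ^ (1 + ε) := by rw [pow_succ, Real.rpow_mul zero_le_two]
    _ ≤ 2 ^ (1 + ε) * (2 * len ε k : ℝ) ^ (1 + ε) := by
        gcongr
        linarith
    _ = _ := by
        rw [← Real.mul_rpow zero_le_two (by positivity)]
        ring_nf

theorem rpow_half_sub_le_two_mul_sqrt_len (hε : 0 < ε) {m : ℕ} (hm : 1 ≤ m)
    (hmk : m < 2 * len ε (k + 1)) : (m : ℝ) ^ (1 / 2 - ε) ≤ 2 * √(len ε k) := by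
  have hm' : (1 : ℝ) ≤ m := by exact_mod_cast hm
  have hmpow : (m : ℝ) ≤ (4 * len ε k : ℝ) ^ (1 + ε) := by
    have : (m : ℝ) ≤ 2 * len ε (k + 1) := by exact_mod_cast hmk.le
    linarith [len_le_rpow_div_two_add_one ε (k + 1), two_le_two_rpow hε (k + 1),
      two_mul_two_rpow_succ_le hε k]
  have hsq : (m : ℝ) ^ (1 - 2 * ε) ≤ 4 * len ε k := by
    rw [← Real.rpow_le_rpow_iff (z := 1 + ε) (by positivity) (by positivity) (by linarith),
      ← Real.rpow_mul (by positivity)]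
    refine le_trans ?_ hmpow
    exact (Real.rpow_le_rpow_of_exponent_le hm' (by nlinarith)).trans_eq (Real.rpow_one _)
  calc (m : ℝ) ^ (1 / 2 - ε) = √((m : ℝ) ^ (1 - 2 * ε)) := by
        rw [Real.sqrt_eq_rpow, ← Real.rpow_mul (by positivity)]
        ring_nf
    _ ≤ √(2 ^ 2 * len ε k) := by
        gcongr
        linarith
    _ = 2 * √(len ε k) := by rw [Real.sqrt_mul (by positivity), Real.sqrt_sq zero_le_two]

theorem div_sqrt_len_le (hε : 0 < ε) {m : ℕ} (hm : 1 ≤ m) (hmk : m < 2 * len ε (k + 1)) :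
    (m : ℝ) / √(len ε k) ≤ 2 * (m : ℝ) ^ (1 / 2 + ε) := by
  have hm' : (0 : ℝ) < m := by exact_mod_cast hm
  rw [div_le_iff₀ (Real.sqrt_pos.2 (len_pos ε k))]
  calc (m : ℝ) = (m : ℝ) ^ (1 / 2 + ε) * (m : ℝ) ^ (1 / 2 - ε) := by
        rw [← Real.rpow_add hm']
        norm_num
    _ ≤ (m : ℝ) ^ (1 / 2 + ε) * (2 * √(len ε k)) := by
        gcongr
        exact rpow_half_sub_le_two_mul_sqrt_len hε hm hmk
    _ = _ := by ring

/-- The levels with the same length as the level `k`. For tiny `ε` there are many of them, and the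
meta-algorithm has to be compared with the average of their experts. -/
noncomputable def sameLen (ε : ℝ) (T k : ℕ) : Finset ℕ :=
  (levels ε T).toFinset.filter fun k' => len ε k' = len ε k

theorem mem_sameLen {k' : ℕ} :
    k' ∈ sameLen ε T k ↔ k' ∈ levels ε T ∧ len ε k' = len ε k := by
  simp [sameLen]

theorem card_sameLen_pos (hk : k ∈ levels ε T) : 0 < (sameLen ε T k).card :=
  Finset.card_pos.2 ⟨k, mem_sameLen.2 ⟨hk, rfl⟩⟩

theorem two_mul_len_le_of_len_lt (hlt : len ε k < len ε (k + 1)) :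
    2 * (len ε k : ℝ) ≤ 2 ^ ((1 + ε) ^ (k + 1)) := by
  have hfloor : (len ε k : ℝ) ≤ ⌊(2 : ℝ) ^ ((1 + ε) ^ (k + 1)) / 2⌋₊ := by
    rw [len.eq_def ε (k + 1)] at hlt
    exact_mod_cast Nat.lt_succ_iff.1 hlt
  linarith [Nat.floor_le (a := (2 : ℝ) ^ ((1 + ε) ^ (k + 1)) / 2) (by positivity)]

theorem one_sub_mul_one_add_pow_le_one (hε : 0 ≤ ε) (i : ℕ) :
    (1 - i * ε) * (1 + ε) ^ i ≤ 1 := by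
  calc (1 - i * ε) * (1 + ε) ^ i ≤ Real.exp (-(i * ε)) * Real.exp ε ^ i := by
        gcongr
        · exact Real.one_sub_le_exp_neg _
        · linarith [Real.add_one_le_exp ε]
    _ = 1 := by rw [← Real.exp_nat_mul, ← Real.exp_add, neg_add_cancel, Real.exp_zero]

theorem mul_one_sub_mul_log_le_two_rpow (hε : 0 ≤ ε) {x q : ℝ} {i : ℕ} (hx : 1 ≤ x)
    (hxq : x ≤ 2 ^ (q * (1 + ε) ^ i)) : x * (1 - i * ε * Real.log x) ≤ 2 ^ q := by
  have hx0 : 0 < x := by linarith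
  have hlog := Real.log_le_log hx0 hxq
  rw [Real.log_rpow two_pos] at hlog
  have hexponent : Real.log x * (1 - i * ε) ≤ q * Real.log 2 := by
    refine le_of_mul_le_mul_right ?_ (by positivity : 0 < (1 + ε) ^ i)
    calc _ = Real.log x * ((1 - i * ε) * (1 + ε) ^ i) := by ring
      _ ≤ Real.log x * 1 := by
          gcongr
          · exact Real.log_nonneg hx
          · exact one_sub_mul_one_add_pow_le_one hε i
      _ ≤ _ := by linarith
  calc x * (1 - i * ε * Real.log x) ≤ x * Real.exp (-(i * ε * Real.log x)) := by
        gcongr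
        exact Real.one_sub_le_exp_neg _
    _ = Real.exp (Real.log x * (1 - i * ε)) := by
        rw [mul_one_sub, sub_eq_add_neg, Real.exp_add, Real.exp_log hx0, mul_comm (Real.log x)]
    _ ≤ Real.exp (q * Real.log 2) := Real.exp_le_exp.2 hexponent
    _ = 2 ^ q := by rw [Real.rpow_def_of_pos two_pos, mul_comm]

theorem two_mul_len_sub_two_lt (hε : 0 < ε) {i : ℕ} (hT : 2 * len ε k ≤ T)
    (hlt : len ε k < len ε (k + 1)) (hik : i ≤ k + 1) (hi : i * (ε * T ^ 2) ≤ 1) :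
    2 * (len ε k : ℝ) - 2 < (2 : ℝ) ^ ((1 + ε) ^ (k + 1 - i)) := by
  have hl : (1 : ℝ) ≤ len ε k := by exact_mod_cast one_le_len ε k
  have hT' : 2 * (len ε k : ℝ) ≤ T := by exact_mod_cast hT
  have hpow : 2 * (len ε k : ℝ) ≤ 2 ^ ((1 + ε) ^ (k + 1 - i) * (1 + ε) ^ i) := by
    rw [← pow_add, Nat.sub_add_cancel hik]
    exact two_mul_len_le_of_len_lt hlt
  have hmain := mul_one_sub_mul_log_le_two_rpow hε.le (by linarith) hpow
  have hlog : 0 ≤ Real.log (2 * len ε k) := Real.log_nonneg (by linarith)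
  have hlogT : Real.log (2 * len ε k) ≤ T := (Real.log_le_self (by linarith)).trans hT'
  have hloss : len ε k * (i * ε * Real.log (2 * len ε k)) ≤ 1 / 2 := by
    calc len ε k * (i * ε * Real.log (2 * len ε k)) ≤ T / 2 * (i * ε * T) := by
          gcongr
          linarith
      _ = i * (ε * T ^ 2) / 2 := by ring
      _ ≤ _ := by linarith
  linarith

theorem floor_one_div_le_card_sameLen (hε : 0 < ε) (hT : 2 * len ε k ≤ T)
    (hlt : len ε k < len ε (k + 1)) :
    ⌊1 / (ε * (T : ℝ) ^ 2)⌋₊ ≤ (sameLen ε T k).card := by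
  have hT0 : (0 : ℝ) < T := by exact_mod_cast (by linarith [one_le_len ε k] : 0 < T)
  have hsmall : ∀ i ≤ ⌊1 / (ε * (T : ℝ) ^ 2)⌋₊, (i : ℝ) * (ε * T ^ 2) ≤ 1 := fun i hi => by
    rwa [Nat.le_floor_iff (by positivity), le_div_iff₀ (by positivity)] at hi
  have hle : ⌊1 / (ε * (T : ℝ) ^ 2)⌋₊ ≤ k := by
    by_contra! hcon
    have h := two_mul_len_sub_two_lt hε hT hlt le_rfl (hsmall (k + 1) hcon)
    have htwo : (2 : ℝ) ≤ len ε k := by exact_mod_cast two_le_len hε k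
    rw [Nat.sub_self, pow_zero, Real.rpow_one] at h
    linarith
  rw [← Finset.card_range ⌊1 / (ε * (T : ℝ) ^ 2)⌋₊]
  refine Finset.card_le_card_of_injOn (fun i => k - i) (fun i hi => ?_) fun i hi j hj hij => ?_
  · have hi := Finset.mem_range.1 hi
    have h := two_mul_len_sub_two_lt hε hT hlt (i := i + 1) (by omega) (hsmall _ hi)
    rw [Nat.add_sub_add_right] at h
    have hlen : len ε k < len ε (k - i) + 1 := by
      have : (len ε k : ℝ) < len ε (k - i) + 1 := by linarith [rpow_div_two_lt_len ε (k - i)]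
      exact_mod_cast this
    have hmono : len ε (k - i) ≤ len ε k := len_mono hε (Nat.sub_le k i)
    have hlevel : k - i ∈ levels ε T := mem_levels_of_len_le hε (by omega) (by omega)
    have hlen_eq : len ε (k - i) = len ε k := by omega
    exact mem_sameLen.2 ⟨hlevel, hlen_eq⟩
  · rw [Finset.coe_range, Set.mem_Iio] at hi hj
    simp only at hij
    omega

theorem mul_length_levels_le_card_sameLen (hε : 0 < ε) (hT3 : 3 ≤ T) (hk : 1 ≤ k)
    (hT : 2 * len ε k ≤ T) (hlt : len ε k < len ε (k + 1)) :
    (T : ℝ) * (levels ε T).length ≤ T ^ 6 * (sameLen ε T k).card := by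
  have hT0 : (3 : ℝ) ≤ T := by exact_mod_cast hT3
  have hcard : (1 : ℝ) ≤ (sameLen ε T k).card := by
    exact_mod_cast card_sameLen_pos (mem_levels_of_len_le hε hk (by omega))
  have hfloor : (⌊1 / (ε * (T : ℝ) ^ 2)⌋₊ : ℝ) ≤ (sameLen ε T k).card := by
    exact_mod_cast floor_one_div_le_card_sameLen hε hT hlt
  set Q : ℝ := ((sameLen ε T k).card : ℝ)
  have hinv : 1 / ε ≤ 2 * T ^ 2 * Q := by
    calc 1 / ε = 1 / (ε * (T : ℝ) ^ 2) * T ^ 2 := by field_simp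
      _ ≤ 2 * Q * T ^ 2 := by
          gcongr
          linarith [Nat.lt_floor_add_one (1 / (ε * (T : ℝ) ^ 2))]
      _ = _ := by ring
  calc (T : ℝ) * (levels ε T).length ≤ T * (2 * T * (1 / ε) + 2) := by
        gcongr
        exact (length_levels_le hε T).trans_eq (by ring)
    _ ≤ T * (2 * T * (2 * T ^ 2 * Q) + 2 * T ^ 3 * Q) := by
        have : 1 ≤ (T : ℝ) ^ 3 * Q :=
          one_le_mul_of_one_le_of_one_le (one_le_pow₀ (by linarith)) hcard
        gcongr
        linarith
    _ = 6 * T ^ 4 * Q := by ring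
    _ ≤ T ^ 2 * T ^ 4 * Q := by
        gcongr
        nlinarith
    _ = _ := by ring

end Lengths

/-! ### The regret of the meta-algorithm -/

theorem one_le_log {T : ℕ} (hT : 3 ≤ T) : 1 ≤ Real.log T := by
  have hT' : (3 : ℝ) ≤ T := by exact_mod_cast hT
  rw [Real.le_log_iff_exp_le (by linarith)]
  linarith [Real.exp_one_lt_d9]

section Arithmetic

variable {ε : ℝ} {T k : ℕ}

theorem rate_eq_sqrt_div_sqrt (hT : 4 * Real.log T ≤ len ε k) :
    rate ε T k = √(Real.log T) / √(len ε k) := by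
  have hl := len_pos ε k
  rw [rate, ← Real.sqrt_div (Real.log_natCast_nonneg T), min_eq_right]
  rw [Real.sqrt_le_left (by norm_num), div_le_iff₀ hl]
  linarith

theorem log_pow_div_rate_add_le (hT3 : 3 ≤ T) (hT : 4 * Real.log T ≤ len ε k) {x : ℝ}
    (hx : x ≤ 4 * len ε k) :
    Real.log ((T : ℝ) ^ 6) / rate ε T k + 2 * rate ε T k * x ≤
      14 * (√(Real.log T) * √(len ε k)) := by
  have hlog := one_le_log hT3
  have hl : 0 < √(len ε k : ℝ) := Real.sqrt_pos.2 (len_pos ε k)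
  have hL : 0 < √(Real.log T) := Real.sqrt_pos.2 (by linarith)
  rw [← Real.mul_self_sqrt (len_pos ε k).le] at hx
  rw [rate_eq_sqrt_div_sqrt hT, Real.log_pow, ← Real.mul_self_sqrt (by linarith : 0 ≤ Real.log T),
    Real.sqrt_mul_self hL.le]
  calc _ ≤ (6 : ℕ) * (√(Real.log T) * √(Real.log T)) / (√(Real.log T) / √(len ε k)) +
        2 * (√(Real.log T) / √(len ε k)) * (4 * (√(len ε k) * √(len ε k))) := by gcongr
    _ = _ := by
        field_simp
        norm_num

theorem exists_lt_dvd_add {l : ℕ} (hl : 0 < l) (a : ℕ) : ∃ i < l, l ∣ a + i := by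
  refine ⟨(l - 1) * a % l, Nat.mod_lt _ hl, ?_⟩
  have hmul : a + (l - 1) * a = l * a := by
    rw [← one_add_mul, Nat.add_comm, Nat.sub_one_add_one hl.ne']
  rw [← Nat.modEq_zero_iff_dvd]
  exact ((Nat.mod_modEq _ _).add_left a).trans (hmul ▸ Nat.mul_mod_right l a)

theorem sqrt_le_rpow_half_add {x : ℝ} (hε : 0 ≤ ε) (hx : 1 ≤ x) : √x ≤ x ^ (1 / 2 + ε) := by
  rw [Real.sqrt_eq_rpow]
  exact Real.rpow_le_rpow_of_exponent_le hx (by linarith)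

theorem rpow_half_add_le_of_two_mul_le (hε : 0 ≤ ε) {x y : ℝ} (hx : 0 ≤ x) (hxy : 2 * x ≤ y) :
    x ^ (1 / 2 + ε) ≤ 3 / 4 * y ^ (1 / 2 + ε) := by
  have hhalf : (1 / 2 : ℝ) ^ (1 / 2 + ε) ≤ 3 / 4 := by
    calc (1 / 2 : ℝ) ^ (1 / 2 + ε) ≤ (1 / 2 : ℝ) ^ (1 / 2 : ℝ) :=
          Real.rpow_le_rpow_of_exponent_ge (by norm_num) (by norm_num) (by linarith)
      _ ≤ 3 / 4 := by
          rw [← Real.sqrt_eq_rpow, Real.sqrt_le_left (by norm_num)]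
          norm_num
  calc x ^ (1 / 2 + ε) ≤ (1 / 2 * y) ^ (1 / 2 + ε) := by
        gcongr
        linarith
    _ = (1 / 2 : ℝ) ^ (1 / 2 + ε) * y ^ (1 / 2 + ε) :=
        Real.mul_rpow (by norm_num) (by linarith)
    _ ≤ _ := mul_le_mul_of_nonneg_right hhalf (Real.rpow_nonneg (by linarith) _)

theorem div_add_one_mul_sqrt_len_le (hε : 0 < ε) {m q : ℕ} (hqm : q ≤ m) (hm : len ε k ≤ m)
    (hmk : m < 2 * len ε (k + 1)) :
    ((q : ℝ) / (4 * len ε k) + 1) * √(len ε k) ≤ 3 / 2 * (m : ℝ) ^ (1 / 2 + ε) := by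
  have hm1 : 1 ≤ m := (one_le_len ε k).trans hm
  have hsqrt : √(len ε k : ℝ) ≤ (m : ℝ) ^ (1 / 2 + ε) :=
    (Real.sqrt_le_sqrt (by exact_mod_cast hm)).trans
      (sqrt_le_rpow_half_add hε.le (by exact_mod_cast hm1))
  have hdiv : (q : ℝ) / √(len ε k) ≤ 2 * (m : ℝ) ^ (1 / 2 + ε) :=
    le_trans (by gcongr) (div_sqrt_len_le hε hm1 hmk)
  have hsplit : ((q : ℝ) / (4 * len ε k) + 1) * √(len ε k) =
      q / √(len ε k) / 4 + √(len ε k) := by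
    rw [add_one_mul, mul_comm (4 : ℝ), ← div_div, div_mul_eq_mul_div, div_mul_eq_mul_div,
      mul_div_assoc, Real.sqrt_div_self, ← div_eq_mul_inv]
  linarith

end Arithmetic

section Regret

variable {E : Type} [NormedAddCommGroup E] [InnerProductSpace ℝ E] {sub : Subroutines E}
  {p : Params E} {adv : Adversary E} {K : Set E} {A B : ℝ} {n a b c i k m : ℕ} {h : ℕ → State E}

namespace Setting

theorem take_plays (S : Setting sub p adv K A B)
    (hh : h ∈ (trace sub p adv n).support (memOracle K)) (him : i ≤ m) (hm : m ≤ n) :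
    (h m).plays.take i = (h i).plays := by
  induction m, him using Nat.le_induction with
  | base => rw [List.take_of_length_le (S.stateInv_trace hh hm).plays_length.le]
  | succ m him ih =>
    have hlength := (S.stateInv_trace hh (by omega : m ≤ n)).plays_length
    rw [plays_succ_of_mem_support_trace hh hm, List.take_append_of_le_length (by omega),
      ih (by omega)]

theorem regret_eq_regretOn (S : Setting sub p adv K A B)
    (hh : h ∈ (trace sub p adv n).support (memOracle K)) (a : ℕ) (hb : b ≤ n) :
    regret K adv (h n).plays (a + 1) b = regretOn adv K State.play h a b := by
  have hpast : ∀ i ∈ Finset.Ico a b, (h n).plays.take (i + 1) = (h i).plays ++ [(h i).play] := by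
    intro i hi
    have hib := (Finset.mem_Ico.1 hi).2
    rw [S.take_plays hh (by omega) le_rfl, plays_succ_of_mem_support_trace hh (by omega)]
  have hplay : ∀ i ∈ Finset.Ico a b, (h n).plays.getD i 0 = (h i).play := by
    intro i hi
    have hib := (Finset.mem_Ico.1 hi).2
    have hlength := (S.stateInv_trace hh (by omega : i ≤ n)).plays_length
    have hget : (h n).plays.getD i 0 = ((h n).plays.take (i + 1)).getD i 0 := by
      simp only [List.getD_eq_getElem?_getD, List.getElem?_take_of_succ]
    rw [hget, hpast i hi, List.getD_append_right _ _ _ _ hlength.le, hlength, Nat.sub_self]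
    rfl
  have hshift : ∀ F : ℕ → ℝ, ∑ i ∈ Finset.Icc (a + 1) b, F i = ∑ i ∈ Finset.Ico a b, F (i + 1) :=
    fun F => (Finset.sum_Ico_add' F a b 1).symm
  unfold regret regretOn
  simp only [hshift, Nat.add_sub_cancel]
  congr 1
  · exact Finset.sum_congr rfl fun i hi => by rw [hpast i hi, hplay i hi]; rfl
  · exact iInf_congr fun u => Finset.sum_congr rfl fun i hi => by rw [hpast i hi]; rfl

theorem expectedRegret_eq (S : Setting sub p adv K A B) (a : ℕ) (hb : b ≤ p.T) :
    expectedRegret sub p adv K (a + 1) b =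
      (trace sub p adv p.T).expect (memOracle K) (regretOn adv K State.play · a b) := by
  rw [expectedRegret, expect_run]
  exact expect_congr fun h hh => S.regret_eq_regretOn hh a hb

theorem regretOn_play_le (S : Setting sub p adv K A B)
    (hh : h ∈ (trace sub p adv n).support (memOracle K)) (hab : a ≤ b) (hb : b ≤ n) :
    regretOn adv K State.play h a b ≤ (b - a) * (p.G * p.D) := by
  have := S.nonempty
  refine regretOn_le_of_forall_le fun u hu =>
    (Finset.sum_le_card_nsmul _ _ (p.G * p.D) fun i hi => ?_).trans_eq ?_
  · have hib := (Finset.mem_Ico.1 hi).2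
    exact (le_abs_self _).trans (S.abs_loss_sub_le _ (S.play_mem hh (by omega)) hu)
  · rw [Nat.card_Ico, nsmul_eq_mul, Nat.cast_sub hab]

theorem expect_regretOn_play_le_add (S : Setting sub p adv K A B) (hab : a ≤ b) (hbc : b ≤ c) :
    (trace sub p adv n).expect (memOracle K) (regretOn adv K State.play · a c) ≤
      (trace sub p adv n).expect (memOracle K) (regretOn adv K State.play · a b) +
        (trace sub p adv n).expect (memOracle K) (regretOn adv K State.play · b c) := by
  have := S.nonempty
  rw [← expect_add]
  exact expect_mono fun h _ => regretOn_le_add (fun l => (S.admissible l).nonneg) hab hbc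

theorem expect_regretOn_play_le (S : Setting sub p adv K A B) (hab : a ≤ b) (hb : b ≤ n) :
    (trace sub p adv n).expect (memOracle K) (regretOn adv K State.play · a b) ≤
      (b - a) * (p.G * p.D) :=
  expect_le_const fun _ hh => S.regretOn_play_le hh hab hb

theorem one_le_sqrt_log (S : Setting sub p adv K A B) : 1 ≤ √(Real.log p.T) :=
  Real.one_le_sqrt.2 (one_le_log S.three_le_T)

theorem card_mul_regretOn_play_le (S : Setting sub p adv K A B)
    (hh : h ∈ (trace sub p adv p.T).support (memOracle K)) (hact : IsActive p a k c)
    (hc : c < p.T) (hlog : 4 * Real.log p.T ≤ len p.ε k)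
    (hbal : (p.T : ℝ) * (levels p.ε p.T).length ≤ p.T ^ 6 * (sameLen p.ε p.T k).card) :
    (sameLen p.ε p.T k).card * regretOn adv K State.play h a c ≤
      (sameLen p.ε p.T k).card * (p.G * p.D * (14 * (√(Real.log p.T) * √(len p.ε k)))) +
        ∑ j ∈ sameLen p.ε p.T k, regretOn adv K (fun σ => (σ.expert (a + 1, j)).x) h a c := by
  have hGD : 0 < p.G * p.D := mul_pos S.G_pos S.D_pos
  have hlife : (c : ℝ) - a ≤ 4 * len p.ε k := by
    have hend : (c : ℝ) ≤ a + 4 * len p.ε k := by exact_mod_cast hact.lt_end.le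
    linarith
  have hT : (0 : ℝ) < p.T := by exact_mod_cast (by omega : 0 < p.T)
  have hcard : ((c : ℝ) + 1) * (levels p.ε p.T).length ≤
      p.T ^ 6 * (sameLen p.ε p.T k).card := by
    refine le_trans ?_ hbal
    gcongr
    exact_mod_cast hc
  have hexcess := S.sum_sum_excess_le (k := k) hh (Q := sameLen p.ε p.T k)
    (fun j hj => by
      obtain ⟨hlvl, hlen⟩ := mem_sameLen.1 hj
      exact ⟨hlvl, hlen ▸ hact.dvd, hact.le, hlen ▸ hact.lt_end⟩)
    (fun j hj => by rw [rate, rate, (mem_sameLen.1 hj).2]) hc.le (pow_pos hT 6) hcard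
  have hsum : ∑ j ∈ sameLen p.ε p.T k, ∑ i ∈ Finset.Ico a c, (h i).excess adv (a + 1, j) =
      (sameLen p.ε p.T k).card * regretOn adv K State.play h a c -
        ∑ j ∈ sameLen p.ε p.T k, regretOn adv K (fun σ => (σ.expert (a + 1, j)).x) h a c := by
    rw [← nsmul_eq_mul, ← Finset.sum_const, ← Finset.sum_sub_distrib]
    exact Finset.sum_congr rfl fun j _ => by rw [regretOn_sub_regretOn]; rfl
  rw [hsum, sub_le_iff_le_add] at hexcess
  refine hexcess.trans (add_le_add_left ?_ _)
  gcongr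
  exact log_pow_div_rate_add_le S.three_le_T hlog hlife

theorem expect_regretOn_play_le_of_isActive (S : Setting sub p adv K A B) (hrD : p.r ≤ p.D)
    (hact : IsActive p a k c) (hc : c < p.T) (hlog : 4 * Real.log p.T ≤ len p.ε k)
    (hbal : (p.T : ℝ) * (levels p.ε p.T).length ≤ p.T ^ 6 * (sameLen p.ε p.T k).card) :
    (trace sub p adv p.T).expect (memOracle K) (regretOn adv K State.play · a c) ≤
      104 * √(len p.ε k) * (√(Real.log p.T) * regretScale p) := by
  have hR := S.regretScale_pos
  have hcard : (0 : ℝ) < (sameLen p.ε p.T k).card := by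
    exact_mod_cast card_sameLen_pos hact.lvl_mem
  have haverage : (trace sub p adv p.T).expect (memOracle K) (regretOn adv K State.play · a c) ≤
      p.G * p.D * (14 * (√(Real.log p.T) * √(len p.ε k))) +
        90 * √(len p.ε k) * regretScale p := by
    refine le_of_mul_le_mul_left ?_ hcard
    rw [← expect_const_mul]
    refine (expect_mono fun h hh => S.card_mul_regretOn_play_le hh hact hc hlog hbal).trans ?_
    rw [expect_add, expect_const, expect_sum, mul_add, ← nsmul_eq_mul (_ : ℕ) (90 * _ * _)]
    refine add_le_add_right (Finset.sum_le_card_nsmul _ _ _ fun j hj => ?_) _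
    obtain ⟨hlvl, hlen⟩ := mem_sameLen.1 hj
    rw [← hlen]
    exact S.expect_regretOn_expert_le hrD
      ⟨hlvl, hlen ▸ hact.dvd, hact.le, hlen ▸ hact.lt_end⟩ hc.le
  calc _ ≤ regretScale p * (14 * (√(Real.log p.T) * √(len p.ε k))) +
        90 * √(len p.ε k) * (√(Real.log p.T) * regretScale p) := by
        refine haverage.trans (add_le_add ?_ ?_)
        · gcongr
          exact S.mul_le_regretScale hrD
        · gcongr
          exact le_mul_of_one_le_left hR.le S.one_le_sqrt_log
    _ = _ := by ring

theorem expect_regretOn_play_le_of_len_le (S : Setting sub p adv K A B) (hrD : p.r ≤ p.D)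
    (hab : a ≤ b) (hlife : b ≤ a + 4 * len p.ε k) (hb : b ≤ p.T)
    (hlog : len p.ε k ≤ 4 * Real.log p.T) :
    (trace sub p adv p.T).expect (memOracle K) (regretOn adv K State.play · a b) ≤
      8 * √(len p.ε k) * (√(Real.log p.T) * regretScale p) := by
  have hGD : 0 < p.G * p.D := mul_pos S.G_pos S.D_pos
  have hba : (b : ℝ) - a ≤ 4 * (√(len p.ε k) * √(len p.ε k)) := by
    have hlife' : (b : ℝ) ≤ a + 4 * len p.ε k := by exact_mod_cast hlife
    rw [Real.mul_self_sqrt (len_pos p.ε k).le]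
    linarith
  have hsqrt : √(len p.ε k : ℝ) ≤ 2 * √(Real.log p.T) := by
    refine (Real.sqrt_le_sqrt hlog).trans_eq ?_
    rw [show (4 : ℝ) = 2 ^ 2 by norm_num, Real.sqrt_mul (by norm_num),
      Real.sqrt_sq (by norm_num)]
  calc _ ≤ ((b : ℝ) - a) * (p.G * p.D) := S.expect_regretOn_play_le hab hb
    _ ≤ 4 * (√(len p.ε k) * (2 * √(Real.log p.T))) * regretScale p := by
        refine mul_le_mul (hba.trans ?_) (S.mul_le_regretScale hrD) hGD.le (by positivity)
        gcongr
    _ = _ := by ring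

theorem expect_regretOn_play_block_le (S : Setting sub p adv K A B) (hrD : p.r ≤ p.D)
    (hk : k ∈ levels p.ε p.T) (hdvd : len p.ε k ∣ a) (hab : a ≤ b)
    (hlife : b ≤ a + 4 * len p.ε k) (hb : b ≤ p.T)
    (hbal : (p.T : ℝ) * (levels p.ε p.T).length ≤ p.T ^ 6 * (sameLen p.ε p.T k).card) :
    (trace sub p adv p.T).expect (memOracle K) (regretOn adv K State.play · a b) ≤
      105 * √(len p.ε k) * (√(Real.log p.T) * regretScale p) := by
  have hR := S.regretScale_pos
  rcases le_total (len p.ε k : ℝ) (4 * Real.log p.T) with hlog | hlog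
  · refine (S.expect_regretOn_play_le_of_len_le hrD hab hlife hb hlog).trans ?_
    gcongr
    norm_num
  rcases Nat.eq_or_lt_of_le hab with rfl | hab'
  · simp only [regretOn_self, expect_const]
    positivity
  -- An expert is no longer active after its last round, so that round is bounded separately.
  obtain ⟨c, rfl⟩ : ∃ c, b = c + 1 := ⟨b - 1, by omega⟩
  have hlen : (1 : ℝ) ≤ √(len p.ε k) := Real.one_le_sqrt.2 (by exact_mod_cast one_le_len p.ε k)
  have hlast : (trace sub p adv p.T).expect (memOracle K)
      (regretOn adv K State.play · c (c + 1)) ≤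
      √(len p.ε k) * (√(Real.log p.T) * regretScale p) := by
    refine (S.expect_regretOn_play_le c.le_succ hb).trans ?_
    rw [Nat.cast_succ, add_sub_cancel_left]
    refine mul_le_mul hlen ((S.mul_le_regretScale hrD).trans
      (le_mul_of_one_le_left hR.le S.one_le_sqrt_log)) (mul_pos S.G_pos S.D_pos).le (by positivity)
  have hactive := S.expect_regretOn_play_le_of_isActive hrD
    ⟨hk, hdvd, Nat.le_of_lt_succ hab', hlife⟩ hb hlog hbal
  linarith [S.expect_regretOn_play_le_add (n := p.T) (Nat.le_of_lt_succ hab') c.le_succ]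

theorem expect_regretOn_play_le_of_dvd (S : Setting sub p adv K A B) (hrD : p.r ≤ p.D)
    (hk : k ∈ levels p.ε p.T)
    (hbal : (p.T : ℝ) * (levels p.ε p.T).length ≤ p.T ^ 6 * (sameLen p.ε p.T k).card)
    (hdvd : len p.ε k ∣ a) (hT : a + m ≤ p.T) :
    (trace sub p adv p.T).expect (memOracle K) (regretOn adv K State.play · a (a + m)) ≤
      ((m : ℝ) / (4 * len p.ε k) + 1) *
        (105 * √(len p.ε k) * (√(Real.log p.T) * regretScale p)) := by
  have hR := S.regretScale_pos
  have hlen := one_le_len p.ε k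
  induction m using Nat.strong_induction_on generalizing a with
  | _ m ih =>
    by_cases hm : m ≤ 4 * len p.ε k
    · refine (S.expect_regretOn_play_block_le hrD hk hdvd (by omega) (by omega) hT hbal).trans ?_
      refine le_mul_of_one_le_left (by positivity) (le_add_of_nonneg_left (by positivity))
    · obtain ⟨q, rfl⟩ := Nat.exists_eq_add_of_le (not_le.1 hm).le
      have hblock := S.expect_regretOn_play_block_le hrD hk hdvd (Nat.le_add_right _ _) le_rfl
        (by omega) hbal
      have hrest := ih q (by omega) (hdvd.add (Dvd.intro_left 4 rfl)) (by omega)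
      have hcount : ((4 * len p.ε k + q : ℕ) : ℝ) / (4 * len p.ε k) =
          1 + (q : ℝ) / (4 * len p.ε k) := by
        push_cast
        rw [add_div, div_self (by positivity)]
      rw [hcount, ← add_assoc]
      linarith [S.expect_regretOn_play_le_add (n := p.T) (Nat.le_add_right a (4 * len p.ε k))
        (Nat.le_add_right _ q)]

theorem expect_regretOn_play_le_of_lt_four (S : Setting sub p adv K A B) (hrD : p.r ≤ p.D)
    (hm : m < 4) (hT : a + m ≤ p.T) :
    (trace sub p adv p.T).expect (memOracle K) (regretOn adv K State.play · a (a + m)) ≤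
      2 * (m : ℝ) ^ (1 / 2 + p.ε) * (√(Real.log p.T) * regretScale p) := by
  have hR := S.regretScale_pos
  have hε := S.eps_pos
  rcases Nat.eq_zero_or_pos m with rfl | hm0
  · simp only [Nat.add_zero, regretOn_self, expect_const]
    positivity
  have hsqrt : √(m : ℝ) ≤ 2 := by
    rw [Real.sqrt_le_left (by norm_num)]
    exact_mod_cast hm.le
  refine (S.expect_regretOn_play_le (Nat.le_add_right a m) hT).trans ?_
  rw [Nat.cast_add, add_sub_cancel_left]
  refine mul_le_mul ?_ ((S.mul_le_regretScale hrD).trans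
    (le_mul_of_one_le_left hR.le S.one_le_sqrt_log)) (mul_pos S.G_pos S.D_pos).le (by positivity)
  calc (m : ℝ) = √m * √m := (Real.mul_self_sqrt m.cast_nonneg).symm
    _ ≤ _ := by
        gcongr
        exact sqrt_le_rpow_half_add hε.le (by exact_mod_cast hm0)

/-- The experts of one level with `l_k` comparable to the length of the interval bound the regret
from the first multiple of `l_k` on. The part before it is less than half as long, so that the
recursion sums to a geometric series. -/
theorem expect_regretOn_play_le_rpow (S : Setting sub p adv K A B) (hrD : p.r ≤ p.D)
    (hε1 : p.ε < 1) (hT : a + m ≤ p.T) :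
    (trace sub p adv p.T).expect (memOracle K) (regretOn adv K State.play · a (a + m)) ≤
      630 * (m : ℝ) ^ (1 / 2 + p.ε) * (√(Real.log p.T) * regretScale p) := by
  have hε := S.eps_pos
  have hR := S.regretScale_pos
  induction m using Nat.strong_induction_on generalizing a with
  | _ m ih =>
    rcases lt_or_ge m 4 with hm4 | hm4
    · refine (S.expect_regretOn_play_le_of_lt_four hrD hm4 hT).trans ?_
      gcongr
      norm_num
    obtain ⟨k, hk1, hkm, hmk⟩ := exists_two_mul_len_le_lt hε hε1 hm4
    have hk : k ∈ levels p.ε p.T := mem_levels_of_len_le hε hk1 (by omega)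
    have hbal := mul_length_levels_le_card_sameLen hε S.three_le_T hk1
      (by omega : 2 * len p.ε k ≤ p.T) (by omega)
    obtain ⟨i, hi, hdvd⟩ := exists_lt_dvd_add (len_pos p.ε k |> Nat.cast_pos.1) a
    obtain ⟨q, rfl⟩ := Nat.exists_eq_add_of_le (by omega : i ≤ m)
    have hhead := ih i (by omega) (by omega : a + i ≤ p.T)
    have htail := S.expect_regretOn_play_le_of_dvd hrD hk hbal hdvd (by omega : a + i + q ≤ p.T)
    have hhalf := mul_le_mul_of_nonneg_right (rpow_half_add_le_of_two_mul_le hε.le i.cast_nonneg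
      (by exact_mod_cast (by omega) : 2 * (i : ℝ) ≤ ((i + q : ℕ) : ℝ)))
      (by positivity : 0 ≤ √(Real.log p.T) * regretScale p)
    have hblocks := mul_le_mul_of_nonneg_right (div_add_one_mul_sqrt_len_le hε
      (Nat.le_add_left q i) (by omega) hmk) (by positivity : 0 ≤ √(Real.log p.T) * regretScale p)
    rw [← add_assoc]
    linarith [S.expect_regretOn_play_le_add (n := p.T) (Nat.le_add_right a i)
      (Nat.le_add_right _ q)]

end Setting

end Regret

/-! ### The number of membership calls -/

theorem one_le_thirty_mul_log_log {x : ℝ} (hx : 3 ≤ x) : 1 ≤ 30 * Real.log (Real.log x) := by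
  have hlog_three : 6 * Real.log 2 ≤ 4 * Real.log 3 := by
    have h : Real.log ((2 : ℝ) ^ 6) ≤ Real.log ((3 : ℝ) ^ 4) :=
      Real.log_le_log (by norm_num) (by norm_num)
    rw [Real.log_pow, Real.log_pow] at h
    exact_mod_cast h
  have hlog : 1.039 ≤ Real.log x := by
    linarith [Real.log_two_gt_d9, Real.log_le_log (by norm_num) hx]
  have hinv : (Real.log x)⁻¹ ≤ (1.039 : ℝ)⁻¹ := inv_anti₀ (by norm_num) hlog
  norm_num at hinv
  linarith [Real.one_sub_inv_le_log_of_pos (by linarith : 0 < Real.log x)]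

section Levels

variable {ε : ℝ} {T k : ℕ}

theorem min_one_le_two_mul_log_one_add (hε : 0 < ε) : min ε 1 ≤ 2 * Real.log (1 + ε) := by
  have hpos : 0 < min ε 1 := lt_min hε one_pos
  have hle := min_le_right ε 1
  have hmono : Real.log (1 + min ε 1) ≤ Real.log (1 + ε) :=
    Real.log_le_log (by linarith) (by linarith [min_le_left ε 1])
  have hinv : (1 + min ε 1)⁻¹ ≤ 1 - min ε 1 / 2 := by
    rw [inv_le_iff_one_le_mul₀ (by linarith)]
    nlinarith
  linarith [Real.one_sub_inv_le_log_of_pos (by linarith : 0 < 1 + min ε 1)]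

theorem mul_min_one_le_of_mem_levels (hε : 0 < ε) (hT : 3 ≤ T) (hk : k ∈ levels ε T) :
    k * min ε 1 ≤ 122 * Real.log (Real.log T) := by
  have hT3 : (3 : ℝ) ≤ T := by exact_mod_cast hT
  have hlog := one_le_log hT
  have hpow : (1 + ε) ^ k * Real.log 2 ≤ Real.log 2 + Real.log T := by
    rw [← Real.log_mul (by norm_num) (by linarith), ← Real.log_rpow (by norm_num)]
    exact Real.log_le_log (by positivity) (by linarith [((mem_levels hε T k).1 hk).2])
  have hpow_le : (1 + ε) ^ k ≤ 3 * Real.log T := by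
    have hpos : 0 ≤ (1 + ε) ^ k := by positivity
    nlinarith [Real.log_two_gt_d9, Real.log_two_lt_d9]
  have hlog_pow : k * Real.log (1 + ε) ≤ Real.log 3 + Real.log (Real.log T) := by
    rw [← Real.log_mul (by norm_num) (by linarith), ← Real.log_pow]
    exact Real.log_le_log (by positivity) hpow_le
  have hlog_three : Real.log 3 ≤ 2 := by
    linarith [Real.log_le_sub_one_of_pos (by norm_num : (0 : ℝ) < 3)]
  linarith [one_le_thirty_mul_log_log hT3,
    mul_le_mul_of_nonneg_left (min_one_le_two_mul_log_one_add hε) (Nat.cast_nonneg (α := ℝ) k)]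

theorem length_levels_le_log_log (hε : 0 < ε) (hT : 3 ≤ T) :
    ((levels ε T).length : ℝ) ≤ 122 * Real.log (Real.log T) / min ε 1 := by
  have hmin : 0 < min ε 1 := lt_min hε one_pos
  have hloglog := one_le_thirty_mul_log_log (x := T) (by exact_mod_cast hT)
  have hbound : 0 ≤ 122 * Real.log (Real.log T) / min ε 1 := div_nonneg (by linarith) hmin.le
  have hsubset :
      (levels ε T).toFinset ⊆ Finset.Icc 1 ⌊122 * Real.log (Real.log T) / min ε 1⌋₊ := by
    intro k hk
    rw [List.mem_toFinset] at hk
    rw [Finset.mem_Icc, Nat.le_floor_iff hbound, le_div_iff₀ hmin]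
    exact ⟨((mem_levels hε T k).1 hk).1, mul_min_one_le_of_mem_levels hε hT hk⟩
  have hcard := Finset.card_le_card hsubset
  rwa [List.toFinset_card_of_nodup (nodup_levels ε T), Nat.card_Icc, Nat.add_sub_cancel,
    Nat.le_floor_iff hbound] at hcard

theorem one_add_log_horizon_le (hε : 0 < ε) (hT : 3 ≤ T) (hk : k ∈ levels ε T) :
    1 + Real.log ((4 * len ε k : ℕ) : ℝ) ≤ 4 * Real.log T := by
  have hT3 : (3 : ℝ) ≤ T := by exact_mod_cast hT
  have hhorizon : ((4 * len ε k : ℕ) : ℝ) ≤ (T : ℝ) ^ 3 := by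
    have hcube : (3 : ℝ) ^ 2 * T ≤ T ^ 2 * T := by gcongr
    push_cast
    linarith [len_le_rpow_div_two_add_one ε k, ((mem_levels hε T k).1 hk).2]
  have hlog := Real.log_le_log (by exact_mod_cast one_le_four_mul_len ε k) hhorizon
  rw [Real.log_pow, Nat.cast_ofNat] at hlog
  linarith [one_le_log hT]

end Levels

section Calls

variable {E : Type} [NormedAddCommGroup E] {p : Params E} {K : Set E} {A B : ℝ} {n i t : ℕ}
  {σ : State E} {e : Expert E}

theorem ExpertInv.div_len_lt (he : ExpertInv p K A i e) :
    i / len p.ε e.lvl < (e.birth - 1) / len p.ε e.lvl + 4 := by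
  rw [Nat.div_lt_iff_lt_mul (one_le_len _ _), add_mul, Nat.div_mul_cancel he.dvd]
  have halive := he.alive
  omega

theorem ExpertInv.key_eq_of_age_eq {e' : Expert E} (he : ExpertInv p K A i e)
    (he' : ExpertInv p K A i e') (hlvl : e.lvl = e'.lvl)
    (hage : i / len p.ε e.lvl - (e.birth - 1) / len p.ε e.lvl =
      i / len p.ε e'.lvl - (e'.birth - 1) / len p.ε e'.lvl) : e.key = e'.key := by
  have hdvd' := he'.dvd
  rw [← hlvl] at hage hdvd'
  have hle : (e.birth - 1) / len p.ε e.lvl ≤ i / len p.ε e.lvl :=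
    Nat.div_le_div_right (Nat.sub_le_of_le_add he.birth_le)
  have hle' : (e'.birth - 1) / len p.ε e.lvl ≤ i / len p.ε e.lvl :=
    Nat.div_le_div_right (Nat.sub_le_of_le_add he'.birth_le)
  have hbirth : e.birth - 1 = e'.birth - 1 := (Nat.div_left_inj he.dvd hdvd').1 (by omega)
  have hone := he.one_le_birth
  have hone' := he'.one_le_birth
  exact Prod.ext (by simp only [Expert.key]; omega) hlvl

theorem StateInv.length_experts_le (hσ : StateInv p K A i σ) :
    σ.experts.length ≤ (levels p.ε p.T).length * 4 := by
  have hkey : ∀ κ ∈ (σ.experts.map Expert.key).toFinset,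
      ∃ e : Expert E, ExpertInv p K A i e ∧ e.key = κ := fun κ hκ => by
    obtain ⟨e, he, rfl⟩ := List.mem_map.1 (List.mem_toFinset.1 hκ)
    exact ⟨e, hσ.expertInv e he, rfl⟩
  rw [← List.length_map Expert.key, ← List.toFinset_card_of_nodup hσ.nodup,
    ← List.toFinset_card_of_nodup (nodup_levels _ _), ← Finset.card_range 4,
    ← Finset.card_product]
  -- The active experts of one level differ in the number of blocks of length `l_k` they have seen.
  refine Finset.card_le_card_of_injOn
    (fun κ => (κ.2, i / len p.ε κ.2 - (κ.1 - 1) / len p.ε κ.2)) (fun κ hκ => ?_) ?_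
  · obtain ⟨e, he, rfl⟩ := hkey κ hκ
    have hage := he.div_len_lt
    exact Finset.mem_product.2 ⟨List.mem_toFinset.2 he.lvl_mem,
      Finset.mem_range.2 (by simp only [Expert.key]; omega)⟩
  · intro κ hκ κ' hκ' hage
    obtain ⟨e, he, rfl⟩ := hkey κ hκ
    obtain ⟨e', he', rfl⟩ := hkey κ' hκ'
    exact he.key_eq_of_age_eq he' (Prod.mk.inj hage).1 (Prod.mk.inj hage).2

variable [InnerProductSpace ℝ E] {sub : Subroutines E} {adv : Adversary E}

namespace Setting

theorem norm_y_add_le (S : Setting sub p adv K A B) (he : ExpertInv p K A i e) :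
    ‖e.y‖ + A ≤ 2 * A * (4 * len p.ε e.lvl : ℕ) := by
  have halive : ((i + 1 : ℕ) : ℝ) ≤ (e.birth + 4 * len p.ε e.lvl : ℕ) := by
    exact_mod_cast he.alive.le
  have hhorizon : (2 : ℝ) ≤ (4 * len p.ε e.lvl : ℕ) := by
    have := one_le_len p.ε e.lvl
    exact_mod_cast (by omega)
  push_cast at halive hhorizon ⊢
  nlinarith [he.norm_y_le, S.D_le, S.A_pos]

theorem maxCalls_updateExpert_le (S : Setting sub p adv K A B) (hB : 0 ≤ B)
    (he : ExpertInv p K A i e) (x : E) (h : List E) :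
    (updateExpert sub p x (adv h) e).maxCalls (memOracle K) ≤
      2 * ⌊B * (4 * Real.log p.T)⌋₊ := by
  have hgood := S.good _ (one_le_four_mul_len p.ε e.lvl)
  have hy := S.norm_y_add_le he
  have hcalls : ∀ {m : ℕ}, (m : ℝ) ≤ B * (1 + Real.log ((4 * len p.ε e.lvl : ℕ) : ℝ)) →
      m ≤ ⌊B * (4 * Real.log p.T)⌋₊ := fun hm =>
    Nat.le_floor (hm.trans (mul_le_mul_of_nonneg_left
      (one_add_log_horizon_le S.eps_pos S.three_le_T he.lvl_mem) hB))
  have hstep : (baseStep sub (4 * len p.ε e.lvl) (stepSize p e.lvl) p.G p.D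
      (adv h) e.y).maxCalls (memOracle K) ≤
        ⌊B * (4 * Real.log p.T)⌋₊ + (⌊B * (4 * Real.log p.T)⌋₊ + 0) := by
    refine maxCalls_bind_le (hcalls (hgood.calls_subgrad _ (by linarith [S.A_pos]))) fun s hs =>
      maxCalls_bind_le (hcalls (hgood.calls_value (nextPoint p e.lvl (adv h) e.y s) ?_))
        fun c _ => le_rfl
    linarith [S.norm_nextPoint_sub_le_of_mem_support e.lvl h hs,
      norm_le_norm_add_norm_sub' (nextPoint p e.lvl (adv h) e.y s) e.y]
  exact (maxCalls_bind_le (b := 0) hstep fun z _ => le_rfl).trans (by omega)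

theorem maxCalls_round_le (S : Setting sub p adv K A B) (hB : 0 ≤ B) (hσ : StateInv p K A i σ)
    (t : ℕ) : ((round sub p adv t σ).maxCalls (memOracle K) : ℝ) ≤
      3904 * B * (Real.log p.T * Real.log (Real.log p.T) / min p.ε 1) := by
  have hlog := one_le_log S.three_le_T
  have hcalls : (round sub p adv t σ).maxCalls (memOracle K) ≤
      σ.experts.length * (2 * ⌊B * (4 * Real.log p.T)⌋₊) + 0 :=
    maxCalls_bind_le (maxCalls_traverse_le fun e he =>
      S.maxCalls_updateExpert_le hB (hσ.expertInv e he) _ _) fun es _ => le_rfl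
  have hfloor : (⌊B * (4 * Real.log p.T)⌋₊ : ℝ) ≤ B * (4 * Real.log p.T) :=
    Nat.floor_le (by positivity)
  have hexperts : (σ.experts.length : ℝ) ≤ 122 * Real.log (Real.log p.T) / min p.ε 1 * 4 := by
    have hlength : (σ.experts.length : ℝ) ≤ (levels p.ε p.T).length * 4 := by
      exact_mod_cast hσ.length_experts_le
    linarith [length_levels_le_log_log S.eps_pos S.three_le_T]
  calc ((round sub p adv t σ).maxCalls (memOracle K) : ℝ)
      ≤ σ.experts.length * (2 * ⌊B * (4 * Real.log p.T)⌋₊) := by exact_mod_cast hcalls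
    _ ≤ (122 * Real.log (Real.log p.T) / min p.ε 1 * 4) * (2 * (B * (4 * Real.log p.T))) :=
        mul_le_mul hexperts (by linarith) (by positivity) ((Nat.cast_nonneg _).trans hexperts)
    _ = _ := by ring

theorem stateInv_of_mem_support_run (S : Setting sub p adv K A B)
    (hσ : σ ∈ (run sub p adv n).support (memOracle K)) : StateInv p K A n σ := by
  obtain ⟨h, hh, rfl⟩ := exists_trace_of_mem_support_run hσ
  exact S.stateInv_trace hh le_rfl

end Setting

end Calls

/-! ### The regret on intervals -/

theorem regret_nonpos_of_subsingleton {E : Type} [NormedAddCommGroup E] [Subsingleton E]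
    (adv : Adversary E) (K : Set E) [Nonempty K] (plays : List E) (s t : ℕ) :
    regret K adv plays s t ≤ 0 := by
  rw [regret, sub_nonpos]
  refine le_ciInf fun u => (Finset.sum_congr rfl fun i _ => ?_).le
  rw [Subsingleton.elim (u : E)]

theorem rpow_half_add_one_div_log_le {T : ℕ} (hT : 3 ≤ T) {x : ℝ} (hx : 1 ≤ x) (hxT : x ≤ T) :
    x ^ (1 / 2 + 1 / Real.log T) ≤ 3 * √x := by
  have hlog := one_le_log hT
  have hpow : x ^ (1 / Real.log T) ≤ 3 := by
    calc x ^ (1 / Real.log T) ≤ (T : ℝ) ^ (1 / Real.log T) := by gcongr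
      _ = Real.exp 1 := by
          rw [Real.rpow_def_of_pos (by linarith), mul_one_div_cancel (by linarith)]
      _ ≤ 3 := Real.exp_one_lt_three.le
  rw [Real.rpow_add (by linarith), ← Real.sqrt_eq_rpow, mul_comm]
  gcongr

section Interval

variable {E : Type} [NormedAddCommGroup E] [InnerProductSpace ℝ E] {sub : Subroutines E}
  {p : Params E} {adv : Adversary E} {K : Set E} {A B : ℝ} {s t a m : ℕ}

namespace Setting

theorem r_le_D [Nontrivial E] (S : Setting sub p adv K A B) : p.r ≤ p.D := by
  obtain ⟨x, hx⟩ := exists_norm_eq E S.r_pos.le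
  rw [← hx]
  exact S.norm_le (S.ball (mem_closedBall_zero_iff.2 hx.le))

theorem expect_regretOn_play_le_of_le_two_mul (S : Setting sub p adv K A B) (hrD : p.r ≤ p.D)
    (hT : a + m ≤ p.T) {x : ℝ} (hx : 1 ≤ x) (hm : m ≤ 2 * x) :
    (trace sub p adv p.T).expect (memOracle K) (regretOn adv K State.play · a (a + m)) ≤
      2520 * x ^ (1 / 2 + p.ε) * (√(Real.log p.T) * regretScale p) := by
  have hε := S.eps_pos
  have hR := S.regretScale_pos
  rcases lt_or_ge p.ε 1 with hε1 | hε1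
  · refine (S.expect_regretOn_play_le_rpow hrD hε1 hT).trans ?_
    have hpow : (m : ℝ) ^ (1 / 2 + p.ε) ≤ 4 * x ^ (1 / 2 + p.ε) := by
      calc (m : ℝ) ^ (1 / 2 + p.ε) ≤ (2 * x) ^ (1 / 2 + p.ε) := by gcongr
        _ = 2 ^ (1 / 2 + p.ε) * x ^ (1 / 2 + p.ε) := Real.mul_rpow (by norm_num) (by linarith)
        _ ≤ 2 ^ (2 : ℝ) * x ^ (1 / 2 + p.ε) := by
            gcongr
            · norm_num
            · linarith
        _ = 4 * x ^ (1 / 2 + p.ε) := by norm_num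
    refine mul_le_mul_of_nonneg_right ?_ (by positivity)
    linarith
  · refine (S.expect_regretOn_play_le (Nat.le_add_right a m) hT).trans ?_
    rw [Nat.cast_add, add_sub_cancel_left]
    refine mul_le_mul ?_ ((S.mul_le_regretScale hrD).trans
      (le_mul_of_one_le_left hR.le S.one_le_sqrt_log)) (mul_pos S.G_pos S.D_pos).le (by positivity)
    linarith [Real.self_le_rpow_of_one_le hx (by linarith : 1 ≤ 1 / 2 + p.ε)]

theorem expectedRegret_le (S : Setting sub p adv K A B) (hs : 1 ≤ s) (hst : s ≤ t)
    (ht : t ≤ p.T) : expectedRegret sub p adv K s t ≤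
      2520 * (p.D ^ 2 * p.G * √(Real.log p.T) * (max 1 ((t : ℝ) - s)) ^ (1 / 2 + p.ε) / p.r) := by
  have hG := S.G_pos
  have hr := S.r_pos
  rcases subsingleton_or_nontrivial E with _ | _
  · have := S.nonempty
    exact (expect_le_const fun σ _ => regret_nonpos_of_subsingleton adv K _ s t).trans
      (by positivity)
  · obtain ⟨a, rfl⟩ := Nat.exists_eq_add_of_le' hs
    obtain ⟨m, rfl⟩ := Nat.exists_eq_add_of_le (by omega : a ≤ t)
    have hm : (m : ℝ) ≤ 2 * max 1 (((a + m : ℕ) : ℝ) - (a + 1 : ℕ)) := by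
      push_cast
      linarith [le_max_left (1 : ℝ) (a + m - (a + 1)), le_max_right (1 : ℝ) (a + m - (a + 1))]
    rw [S.expectedRegret_eq a ht]
    refine (S.expect_regretOn_play_le_of_le_two_mul S.r_le_D ht (le_max_left _ _) hm).trans_eq ?_
    rw [regretScale]
    ring

theorem expectedRegret_le_sqrt (S : Setting sub p adv K A B) (hε : p.ε = 1 / Real.log p.T)
    (hs : 1 ≤ s) (hst : s ≤ t) (ht : t ≤ p.T) : expectedRegret sub p adv K s t ≤
      7560 * (p.D ^ 2 * p.G * √(Real.log p.T) * √(max 1 ((t : ℝ) - s)) / p.r) := by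
  have hG := S.G_pos
  have hr := S.r_pos
  have hlength : max 1 ((t : ℝ) - s) ≤ p.T := by
    have hT : (1 : ℝ) ≤ p.T := by exact_mod_cast (by linarith [S.three_le_T] : 1 ≤ p.T)
    have ht' : (t : ℝ) ≤ p.T := by exact_mod_cast ht
    exact max_le hT (by linarith [Nat.cast_nonneg (α := ℝ) s])
  have hpow : (max 1 ((t : ℝ) - s)) ^ (1 / 2 + p.ε) ≤ 3 * √(max 1 ((t : ℝ) - s)) := by
    rw [hε]
    exact rpow_half_add_one_div_log_le S.three_le_T (le_max_left _ _) hlength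
  calc expectedRegret sub p adv K s t
      ≤ 2520 * (p.D ^ 2 * p.G * √(Real.log p.T) * (max 1 ((t : ℝ) - s)) ^ (1 / 2 + p.ε) / p.r) :=
        S.expectedRegret_le hs hst ht
    _ ≤ 2520 * (p.D ^ 2 * p.G * √(Real.log p.T) * (3 * √(max 1 ((t : ℝ) - s))) / p.r) := by
        gcongr
    _ = _ := by ring

end Setting

end Interval

end ProjFree

theorem mainTheorem4 :
    ∃ C : ℝ, 0 < C ∧ ∀ (d : ℕ) (r D : ℝ), 0 < r → 1 ≤ D →
      ∃ (B : ℝ) (sub : ProjFree.Subroutines (EuclideanSpace ℝ (Fin d))),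
        ∀ K : Set (EuclideanSpace ℝ (Fin d)), Convex ℝ K → Metric.closedBall 0 r ⊆ K →
          (∀ x ∈ K, ∀ y ∈ K, dist x y ≤ D) →
          (∀ H : ℕ, 1 ≤ H → sub.IsApprox K r H (1 / (H : ℝ) ^ 2)) ∧
          ∀ (p : ProjFree.Params (EuclideanSpace ℝ (Fin d)))
            (adv : ProjFree.Adversary (EuclideanSpace ℝ (Fin d))),
            p.r = r → p.D = D → 1 ≤ p.G → 0 < p.ε → 3 ≤ p.T → p.x₁ ∈ K → p.y₁ ∈ K →
            (∀ h, (adv h).IsAdmissible K p.G) →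
            -- all played points lie in the domain
            (∀ σ ∈ (ProjFree.run sub p adv p.T).support (ProjFree.memOracle K),
              ∀ x ∈ σ.plays, x ∈ K) ∧
            -- the number of membership calls in each round
            (∀ t : ℕ, 1 ≤ t → t ≤ p.T →
              ∀ σ ∈ (ProjFree.run sub p adv (t - 1)).support (ProjFree.memOracle K),
                ((ProjFree.round sub p adv t σ).maxCalls (ProjFree.memOracle K) : ℝ) ≤
                  B * (Real.log p.T * Real.log (Real.log p.T) / min p.ε 1)) ∧
            -- the regret on every interval
            (∀ s t : ℕ, 1 ≤ s → s ≤ t → t ≤ p.T →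
              ProjFree.expectedRegret sub p adv K s t ≤
                C * (D ^ 2 * p.G * √(Real.log p.T) *
                  (max 1 ((t : ℝ) - s)) ^ (1 / 2 + p.ε) / r)) ∧
            -- the choice `ε = 1 / log T`
            (p.ε = 1 / Real.log p.T → ∀ s t : ℕ, 1 ≤ s → s ≤ t → t ≤ p.T →
              ProjFree.expectedRegret sub p adv K s t ≤
                C * (D ^ 2 * p.G * √(Real.log p.T) * √(max 1 ((t : ℝ) - s)) / r)) := by
  refine ⟨7560, by norm_num, fun d r D hr hD => ?_⟩
  have hA : 0 ≤ D + r + 6 * d * D := by positivity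
  refine ⟨3904 * ProjFree.callConst d r (D + r + 6 * d * D),
    ProjFree.gridSubroutines d r (D + r + 6 * d * D), fun K hK hball hdiam => ?_⟩
  have hgood : ∀ H : ℕ, 1 ≤ H →
      (ProjFree.gridSubroutines d r (D + r + 6 * d * D)).IsGood K r D (D + r + 6 * d * D)
        (ProjFree.callConst d r (D + r + 6 * d * D)) H := fun H hH =>
    ProjFree.gridSubroutines_isGood hK hr hball (by linarith) (by linarith) hH
  refine ⟨fun H hH => (hgood H hH).approx, ?_⟩
  rintro p adv rfl rfl hG hε hT hx hy hadv
  have hDA : p.D ≤ p.D + p.r + 6 * d * p.D := by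
    rw [add_assoc]
    exact le_add_of_nonneg_right (by positivity)
  have S : ProjFree.Setting _ p adv K _ _ :=
    ⟨hK, hr, hball, hdiam, hD, hG, hε, hT, hx, hy, hadv, hgood, hDA⟩
  have hB := ProjFree.callConst_nonneg (d := d) hr hA
  refine ⟨fun σ hσ => (S.stateInv_of_mem_support_run hσ).plays_mem,
    fun t _ _ σ hσ => S.maxCalls_round_le hB (S.stateInv_of_mem_support_run hσ) t,
    fun s t hs hst ht => (S.expectedRegret_le hs hst ht).trans ?_,
    fun hε' s t hs hst ht => S.expectedRegret_le_sqrt hε' hs hst ht⟩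
  have := S.G_pos
  gcongr
  norm_num
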